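/- Let $d\ge 3$ be an integer and let $\mathbb B^d$ be the set of nonoriented nearest-neighbour bonds $e=\{x,y\}$, $x,y\in\mathbb Z^d$, $|x-y|=1$. Each bond is written $e=\{\underline e,\overline e\}$ with $\overline e-\underline e\in\{e_1,\dots,e_d\}$. For $u:\mathbb Z^d\to\mathbb R$ put $\nabla u(e)=u(\overline e)-u(\underline e)$, and for $F:\mathbb B^d\to\mathbb R$ put $\nabla^*F(x)=\sum_{i=1}^d\big(F(\{x-e_i,x\})-F(\{x,x+e_i\})\big)$. For $n\in\mathbb N=\{1,2,\dots\}$ let $B(n)=([-n,n]\cap\mathbb Z)^d$. For a finite set $S$ of vertices or bonds, a real function $f$ on it and $r\in(0,\infty)$ let $$\|f\|_{\underline L^r(S)}=\Big(\frac1{|S|}\sum_{z\in S}|f(z)|^r\Big)^{1/r},\qquad \|f\|_{\underline L^\infty(S)}=\sup_{z\in S}|f(z)|.$$ Let $p,q\in(1,\infty]$ satisfy $\frac1p+\frac1q<\frac2{d-1}$ (with $\frac1\infty=0$). Put $p'=\frac p{p-1}$ (so $p'=1$ if $p=\infty$) and $\delta=\frac1{d-1}-\frac1{2p}-\frac1{2q}$.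 For $\omega:\mathbb B^d\to(0,\infty)$ and finite $S\subset\mathbb Z^d$ put $$\Lambda^\omega(S)=\|\omega\|_{\underline L^p(S_{\mathbb B^d})}\,\|\omega^{-1}\|_{\underline L^q(S_{\mathbb B^d})},$$ where $S_{\mathbb B^d}$ is the set of bonds with both end-points in $S$. Then $\delta>0$, and for every $\gamma\in(0,1]$ there is a constant $c=c(d,p,q,\gamma)\in[1,\infty)$ such that for every $\omega:\mathbb B^d\to(0,\infty)$, every $u:\mathbb Z^d\to\mathbb R$ with $\nabla^*(\omega\nabla u)=0$ in $\mathbb Z^d$, and every $n\in\mathbb N$, $$\max_{x\in B(n)}|u(x)|\le c\,\Lambda^\omega(B(2n))^{\frac{\delta+1}{2\delta\gamma}}\,\|u\|_{\underline L^{2p'\gamma}(B(2n))}.$$ -/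

import Mathlib

open scoped ENNReal

noncomputable section

namespace RandomConductance

/-- The vertices of the lattice `ℤ^d`. -/
abbrev Vertex (d : ℕ) : Type := Fin d → ℤ

/-- The nearest neighbour bonds of `ℤ^d`.  Every nonoriented bond has exactly one lower end-point `x`
and one direction `i` such that its end-points are `x` and `x + e_i`; it is encoded as `(x, i)`.
See `Bond.toSym2_injective` and `Bond.range_toSym2`. -/
abbrev Bond (d : ℕ) : Type := Vertex d × Fin d

/-- The lower end-point of a bond. -/
def Bond.lower {d : ℕ} (e : Bond d) : Vertex d := e.1

/-- The upper end-point of a bond: lower end-point plus the unit vector of its direction. -/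
def Bond.upper {d : ℕ} (e : Bond d) : Vertex d := e.1 + Pi.single e.2 1

/-- The nonoriented pair of end-points. -/
def Bond.toSym2 {d : ℕ} (e : Bond d) : Sym2 (Vertex d) := s(Bond.lower e, Bond.upper e)

theorem Bond.toSym2_injective (d : ℕ) :
    Function.Injective (Bond.toSym2 : Bond d → Sym2 (Vertex d)) := by
  rintro ⟨x, i⟩ ⟨y, j⟩ h
  simp only [Bond.toSym2, Bond.lower, Bond.upper, Sym2.eq_iff] at h
  rcases h with ⟨rfl, h⟩ | ⟨h1, h2⟩
  · have h := congrFun (add_left_cancel h) i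
    by_cases hij : i = j
    · rw [hij]
    · simp [Pi.single_eq_of_ne hij] at h
  · exfalso
    rw [h1] at h2
    have h3 := congrFun h2 i
    simp only [Pi.add_apply, Pi.single_eq_same] at h3
    by_cases hij : i = j
    · subst hij
      simp at h3
      omega
    · rw [Pi.single_eq_of_ne hij] at h3
      omega

theorem Bond.range_toSym2 (d : ℕ) :
    Set.range (Bond.toSym2 : Bond d → Sym2 (Vertex d)) =
      {e | ∃ x y : Vertex d, e = s(x, y) ∧ ∑ i, (x i - y i) ^ 2 = 1} := by
  ext e
  constructor
  · rintro ⟨⟨x, i⟩, rfl⟩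
    refine ⟨x, x + Pi.single i 1, rfl, ?_⟩
    rw [Finset.sum_eq_single i]
    · simp
    · intro j _ hj
      simp [Pi.single_eq_of_ne hj]
    · simp
  · rintro ⟨x, y, rfl, h⟩
    obtain ⟨i, hi⟩ : ∃ i, x i - y i ≠ 0 := by
      by_contra! hc
      simp [hc] at h
    have hsplit : (x i - y i) ^ 2 + ∑ j ∈ Finset.univ.erase i, (x j - y j) ^ 2 = 1 :=
      (Finset.add_sum_erase Finset.univ (fun i => (x i - y i) ^ 2) (Finset.mem_univ i)).trans h
    have hnn : 0 ≤ ∑ j ∈ Finset.univ.erase i, (x j - y j) ^ 2 :=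
      Finset.sum_nonneg fun j _ => sq_nonneg _
    have hpos : 0 < (x i - y i) ^ 2 := by positivity
    have hone : (x i - y i) ^ 2 = 1 := by linarith
    have hzero : ∑ j ∈ Finset.univ.erase i, (x j - y j) ^ 2 = 0 := by linarith
    have hoff : ∀ j, j ≠ i → x j = y j := by
      intro j hj
      have := (Finset.sum_eq_zero_iff_of_nonneg fun j _ => sq_nonneg (x j - y j)).1 hzero j
        (Finset.mem_erase.2 ⟨hj, Finset.mem_univ j⟩)
      have := pow_eq_zero_iff (two_ne_zero) |>.1 this
      omega
    have hh : x i - y i = 1 ∨ x i - y i = -1 := by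
      have : (x i - y i - 1) * (x i - y i + 1) = 0 := by linear_combination hone
      rcases mul_eq_zero.1 this with h | h
      · left; omega
      · right; omega
    rcases hh with h1 | h1
    · have hx : y + Pi.single i 1 = x := by
        ext j
        by_cases hj : j = i
        · subst hj
          simp
          omega
        · simp [Pi.single_eq_of_ne hj, hoff j hj]
      exact ⟨(y, i), by simp only [Bond.toSym2, Bond.lower, Bond.upper, hx, Sym2.eq_swap]⟩
    · have hy : x + Pi.single i 1 = y := by
        ext j
        by_cases hj : j = i
        · subst hj
          simp
          omega
        · simp [Pi.single_eq_of_ne hj, hoff j hj]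
      exact ⟨(x, i), by simp only [Bond.toSym2, Bond.lower, Bond.upper, hy]⟩

/-- `∇f (e) = f (upper e) - f (lower e)`. -/
def grad {d : ℕ} (f : Vertex d → ℝ) (e : Bond d) : ℝ := f (Bond.upper e) - f (Bond.lower e)

/-- The discrete divergence
`∇* F (x) = ∑ i, (F {x - e_i, x} - F {x, x + e_i})`. -/
def divStar {d : ℕ} (F : Bond d → ℝ) (x : Vertex d) : ℝ :=
  ∑ i : Fin d, (F (x - Pi.single i 1, i) - F (x, i))

/-- `u` solves `∇* (ω ∇u) = 0` in all of `ℤ^d`. -/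
def IsSolution {d : ℕ} (ω : Bond d → ℝ) (u : Vertex d → ℝ) : Prop :=
  ∀ x : Vertex d, divStar (fun e => ω e * grad u e) x = 0

/-- The box `B(n) = ([-n, n] ∩ ℤ)^d` centred at the origin. -/
def box (d n : ℕ) : Finset (Vertex d) := Finset.Icc (fun _ => -(n : ℤ)) (fun _ => (n : ℤ))

/-- The bonds both of whose end-points belong to `S`. -/
def bondsIn {d : ℕ} (S : Finset (Vertex d)) : Finset (Bond d) :=
  (S ×ˢ Finset.univ).filter fun e => Bond.lower e ∈ S ∧ Bond.upper e ∈ S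

/-- The averaged `L^r` norm over a finite set `S`, for `r ∈ (0, ∞]`:
`((1 / |S|) ∑_{x ∈ S} |f x| ^ r) ^ (1 / r)` for `r < ∞`, and `sup_{x ∈ S} |f x|` for `r = ∞`. -/
def avgNorm {α : Type*} (r : ℝ≥0∞) (S : Finset α) (f : α → ℝ) : ℝ :=
  if r = ∞ then sSup ((fun x => |f x|) '' (S : Set α))
  else ((1 / (S.card : ℝ)) * ∑ x ∈ S, |f x| ^ r.toReal) ^ (1 / r.toReal)

/-- `Λ^ω(S)`: the averaged `L^p` norm of `ω` times the averaged `L^q` norm of `ω⁻¹`, both over the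
bonds in `S`. -/
def Lam {d : ℕ} (p q : ℝ≥0∞) (ω : Bond d → ℝ) (S : Finset (Vertex d)) : ℝ :=
  avgNorm p (bondsIn S) ω * avgNorm q (bondsIn S) fun e => (ω e)⁻¹

/-- `δ = 1/(d-1) - 1/(2p) - 1/(2q)`, where `1/∞ = 0`. -/
def delta (d : ℕ) (p q : ℝ≥0∞) : ℝ :=
  1 / ((d : ℝ) - 1) - p⁻¹.toReal / 2 - q⁻¹.toReal / 2

/-- The conjugate exponent `p' = p/(p-1)` of `p ∈ (1, ∞]`, with `p' = 1` for `p = ∞`. -/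
def conj (p : ℝ≥0∞) : ℝ := (1 - p⁻¹.toReal)⁻¹

end RandomConductance

end

namespace RandomConductance

open Finset

/-! ### Hölder's inequality for finitely many factors -/

/-! Write D = d − 1, P = 1/p, Q = 1/q, t = 2p' = 2/(1 − P) and v = (u − K)₊. The proof is a De
Giorgi iteration on two quantities: the number of points where u > K, and the energy Σ ω|∇v|². The
cut-offs are adapted to the solution, so that the energy estimate needs a Sobolev inequality only on
spheres, which have dimension D instead of d. This is why 1/p + 1/q < 2/(d − 1) suffices.

Testing the equation with η²v gives `caccioppoli`. If η drops by one exactly across the layers of a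
set G of radii, only the bonds crossing these layers contribute (`card_sq_mul_energy_le`). By
Markov, at least half of the radii between two boxes are good: weights, energy and support there are
at most a multiple of their averages (`exists_good_subset`). On a good layer Hölder's inequality
leads to L^t norms of v on two spheres, and `sobolev_sphere` bounds these by the energy on the
spheres times |supp v|^{2δ}, where δ > 0 is the exponent left over in Hölder's inequality. The
outcome is `energy_step`: shrinking the box multiplies the energy by at most C Λ λ³ (density of {u >
K})^{2δ}, with λ comparing n to the gap. Conversely, Chebyshev and the Sobolev inequality in
dimension d (`mul_above_le`, `sum_trunc_sq_le`) bound the number of points above a higher level by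
the energy at a lower one.

If the initial density is a small multiple of Λ^{-1/(2δ)}, both quantities decay geometrically
(`le_two_mul_of_iteration`). Radii are integers, so the halving of the gap ends after finitely many
steps, and by then less than one point can remain above the level. The initial density and energy
are controlled by the L^t norm of u through Chebyshev and a linear cut-off, with K of order Λ^{1/2 +
1/(2δ)} ‖u‖_t: the 1/2 comes from the initial energy, the 1/(2δ) from the required density
(`le_of_isSolution`).

For the exponent tγ, the L^t norm is interpolated between the maximum on a larger box and the L^{tγ}
norm, and the resulting recursion is run over boxes between B(n) and B(2n) (`abs_le_of_isSolution`).
-/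

theorem sum_prod_rpow_le {ι κ : Type*} (s : Finset ι) (t : Finset κ) (f : κ → ι → ℝ) (p : κ → ℝ)
    (hf : ∀ j ∈ t, ∀ i ∈ s, 0 ≤ f j i) (hp : ∀ j ∈ t, 0 ≤ p j) (hsum : ∑ j ∈ t, p j = 1) :
    ∑ i ∈ s, ∏ j ∈ t, f j i ^ p j ≤ ∏ j ∈ t, (∑ i ∈ s, f j i) ^ p j := by
  have hF : ∀ j ∈ t, 0 ≤ ∑ i ∈ s, f j i := fun j hj => sum_nonneg (hf j hj)
  -- If a sum with nonzero exponent vanishes, so does the left side. Otherwise normalise each factor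
  -- by its sum and apply weighted AM-GM pointwise. Zero exponents are kept: they encode p = ∞ and q
  -- = ∞ later.
  by_cases hz : ∃ j ∈ t, p j ≠ 0 ∧ ∑ i ∈ s, f j i = 0
  · obtain ⟨j, hj, hpj, h0⟩ := hz
    have h0' := (sum_eq_zero_iff_of_nonneg (hf j hj)).1 h0
    rw [sum_eq_zero]
    · exact prod_nonneg fun j hj => Real.rpow_nonneg (hF j hj) _
    · intro i hi
      exact prod_eq_zero hj (by rw [h0' i hi, Real.zero_rpow hpj])
  · push Not at hz
    have key : ∀ i ∈ s, ∏ j ∈ t, f j i ^ p j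
        ≤ (∏ j ∈ t, (∑ i ∈ s, f j i) ^ p j) * ∑ j ∈ t, p j * (f j i / ∑ i ∈ s, f j i) := by
      intro i hi
      have h1 := Real.geom_mean_le_arith_mean_weighted t p (fun j => f j i / ∑ i ∈ s, f j i) hp hsum
        (fun j hj => div_nonneg (hf j hj i hi) (hF j hj))
      have h2 : ∏ j ∈ t, f j i ^ p j = (∏ j ∈ t, (∑ i ∈ s, f j i) ^ p j) *
          ∏ j ∈ t, (f j i / ∑ i ∈ s, f j i) ^ p j := by
        rw [← prod_mul_distrib]
        refine prod_congr rfl fun j hj => ?_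
        by_cases hpj : p j = 0
        · simp [hpj]
        · have := hz j hj hpj
          rw [← Real.mul_rpow (hF j hj) (div_nonneg (hf j hj i hi) (hF j hj)),
            mul_div_cancel₀ _ this]
      rw [h2]
      exact mul_le_mul_of_nonneg_left h1 (prod_nonneg fun j hj => Real.rpow_nonneg (hF j hj) _)
    refine (sum_le_sum key).trans ?_
    rw [← mul_sum, sum_comm]
    refine mul_le_of_le_one_right (prod_nonneg fun j hj => Real.rpow_nonneg (hF j hj) _) ?_
    rw [← hsum]
    refine sum_le_sum fun j hj => ?_
    rw [← mul_sum, ← sum_div]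
    exact mul_le_of_le_one_right (hp j hj) (div_self_le_one _)

theorem sum_rpow_mul_four_le {ι : Type*} (s : Finset ι) {f₁ f₂ f₃ f₄ : ι → ℝ} {p₁ p₂ p₃ p₄ : ℝ}
    (h₁ : ∀ i ∈ s, 0 ≤ f₁ i) (h₂ : ∀ i ∈ s, 0 ≤ f₂ i) (h₃ : ∀ i ∈ s, 0 ≤ f₃ i)
    (h₄ : ∀ i ∈ s, 0 ≤ f₄ i) (hp₁ : 0 ≤ p₁) (hp₂ : 0 ≤ p₂) (hp₃ : 0 ≤ p₃) (hp₄ : 0 ≤ p₄)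
    (hsum : p₁ + p₂ + p₃ + p₄ = 1) :
    ∑ i ∈ s, f₁ i ^ p₁ * f₂ i ^ p₂ * f₃ i ^ p₃ * f₄ i ^ p₄ ≤
      (∑ i ∈ s, f₁ i) ^ p₁ * (∑ i ∈ s, f₂ i) ^ p₂ * (∑ i ∈ s, f₃ i) ^ p₃ *
        (∑ i ∈ s, f₄ i) ^ p₄ := by
  have := sum_prod_rpow_le s (univ : Finset (Fin 4)) ![f₁, f₂, f₃, f₄] ![p₁, p₂, p₃, p₄]
    (by
      intro j _
      fin_cases j
      · exact h₁
      · exact h₂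
      · exact h₃
      · exact h₄)
    (by
      intro j _
      fin_cases j
      · exact hp₁
      · exact hp₂
      · exact hp₃
      · exact hp₄)
    (by simpa [Fin.sum_univ_four] using hsum)
  simpa [Fin.prod_univ_four] using this

theorem sum_rpow_mul_le {ι : Type*} (s : Finset ι) {f₁ f₂ : ι → ℝ} {p₁ p₂ : ℝ}
    (h₁ : ∀ i ∈ s, 0 ≤ f₁ i) (h₂ : ∀ i ∈ s, 0 ≤ f₂ i) (hp₁ : 0 ≤ p₁) (hp₂ : 0 ≤ p₂)
    (hsum : p₁ + p₂ = 1) :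
    ∑ i ∈ s, f₁ i ^ p₁ * f₂ i ^ p₂ ≤ (∑ i ∈ s, f₁ i) ^ p₁ * (∑ i ∈ s, f₂ i) ^ p₂ := by
  have := sum_rpow_mul_four_le s h₁ h₂ (f₃ := fun _ => 1) (f₄ := fun _ => 1) (by simp) (by simp)
    hp₁ hp₂ (le_refl 0) (le_refl 0) (by linarith)
  simpa using this

theorem sum_rpow_le_card_rpow {ι : Type*} (s : Finset ι) {f : ι → ℝ} {p : ℝ}
    (h : ∀ i ∈ s, 0 ≤ f i) (hp₀ : 0 ≤ p) (hp₁ : p ≤ 1) :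
    ∑ i ∈ s, f i ^ p ≤ (∑ i ∈ s, f i) ^ p * (s.card : ℝ) ^ (1 - p) := by
  have := sum_rpow_mul_le s h (f₂ := fun _ => 1) (by simp) hp₀ (sub_nonneg.2 hp₁) (by ring)
  simpa using this

/-! ### Elementary inequalities -/

/-- Bernoulli's inequality for the ratio of the smaller to the larger number. It replaces the chain
rule for powers. -/
theorem abs_rpow_sub_rpow_le {a b β : ℝ} (ha : 0 ≤ a) (hb : 0 ≤ b) (hβ : 1 ≤ β) :
    |a ^ β - b ^ β| ≤ β * max a b ^ (β - 1) * |a - b| := by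
  wlog hab : a ≤ b generalizing a b
  · have := this hb ha (le_of_not_ge hab)
    rwa [abs_sub_comm, max_comm, abs_sub_comm a b]
  rcases hb.eq_or_lt with rfl | hb'
  · have : a = 0 := le_antisymm hab ha
    simp [this]
  have h1 := one_add_mul_self_le_rpow_one_add (s := a / b - 1)
    (by have := div_nonneg ha hb; linarith) hβ
  have h2 : (1 + (a / b - 1)) ^ β = a ^ β / b ^ β := by
    rw [add_sub_cancel, Real.div_rpow ha hb]
  have h3 : b ^ β = b ^ (β - 1) * b := by
    rw [← Real.rpow_add_one hb'.ne']
    congr 1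
    ring
  have hbβ : 0 < b ^ β := Real.rpow_pos_of_pos hb' _
  rw [h2, le_div_iff₀ hbβ] at h1
  have h4 : a ^ β ≤ b ^ β := Real.rpow_le_rpow ha hab (by linarith)
  rw [max_eq_right hab, abs_of_nonpos (by linarith), abs_of_nonpos (by linarith)]
  have h5 : (1 + β * (a / b - 1)) * b ^ β = b ^ β - β * b ^ (β - 1) * (b - a) := by
    rw [h3]
    field_simp
    ring
  linarith

/-- Markov's inequality on an index set, for four quantities at once: at least half of the indices
are below eight times the average for all of them. -/
theorem exists_good_subset {ι : Type*} (I : Finset ι) (X : Fin 4 → ι → ℝ)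
    (hX : ∀ j, ∀ k ∈ I, 0 ≤ X j k) :
    ∃ G ⊆ I, (I.card : ℝ) ≤ 2 * G.card ∧
      ∀ k ∈ G, ∀ j, X j k * I.card ≤ 8 * ∑ i ∈ I, X j i := by
  classical
  let bad : Fin 4 → Finset ι := fun j => I.filter fun k => 8 * ∑ i ∈ I, X j i < X j k * I.card
  -- Each bad set holds at most one eighth of the indices, so the four together hold at most half.
  -- The strict inequality in `bad` excludes the case where the total is zero.
  have hbad : ∀ j, 8 * ((bad j).card : ℝ) ≤ I.card := by
    intro j
    by_contra! hlt
    have h1 : (bad j).card • (8 * ∑ i ∈ I, X j i) ≤ ∑ k ∈ bad j, X j k * I.card :=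
      card_nsmul_le_sum _ _ _ fun k hk => (mem_filter.1 hk).2.le
    have hne : (bad j).Nonempty := by
      rw [← card_pos]
      by_contra h0
      have : (bad j).card = 0 := by omega
      rw [this] at hlt
      have : (0 : ℝ) ≤ I.card := by positivity
      norm_num at hlt
      linarith
    obtain ⟨k, hk⟩ := hne
    have h2 : ∑ k ∈ bad j, X j k * I.card ≤ (∑ i ∈ I, X j i) * I.card := by
      rw [← sum_mul]
      refine mul_le_mul_of_nonneg_right ?_ (by positivity)
      exact sum_le_sum_of_subset_of_nonneg (filter_subset _ _) fun i hi _ => hX j i hi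
    have hS : 0 ≤ ∑ i ∈ I, X j i := sum_nonneg (hX j)
    rw [nsmul_eq_mul] at h1
    have hS0 : ∑ i ∈ I, X j i = 0 := by nlinarith
    have h3 := (mem_filter.1 hk).2
    have h4 := (sum_eq_zero_iff_of_nonneg (hX j)).1 hS0 k (mem_filter.1 hk).1
    rw [hS0, h4] at h3
    simp at h3
  refine ⟨I \ univ.biUnion bad, sdiff_subset, ?_, ?_⟩
  · have h1 : (univ.biUnion bad).card ≤ ∑ j, (bad j).card := card_biUnion_le
    have h2 : ((univ.biUnion bad).card : ℝ) ≤ ∑ j, ((bad j).card : ℝ) := by exact_mod_cast h1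
    rw [Fin.sum_univ_four] at h2
    have h3 : I.card ≤ (I \ univ.biUnion bad).card + (univ.biUnion bad).card := by
      have := le_card_sdiff (univ.biUnion bad) I
      omega
    have h3' : (I.card : ℝ) ≤ (I \ univ.biUnion bad).card + (univ.biUnion bad).card := by
      exact_mod_cast h3
    linarith [hbad 0, hbad 1, hbad 2, hbad 3]
  · intro k hk j
    by_contra! hlt
    rw [mem_sdiff] at hk
    exact hk.2 (mem_biUnion.2 ⟨j, mem_univ j, mem_filter.2 ⟨hk.1, hlt⟩⟩)

end RandomConductance

namespace RandomConductance

open Finset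

/-! ### Boxes and bonds -/

theorem mem_box {d n : ℕ} {x : Vertex d} : x ∈ box d n ↔ ∀ i, |x i| ≤ n := by
  simp only [box, Finset.mem_Icc, Pi.le_def, abs_le]
  exact ⟨fun h i => ⟨h.1 i, h.2 i⟩, fun h => ⟨fun i => (h i).1, fun i => (h i).2⟩⟩

theorem mem_bondsIn {d : ℕ} {S : Finset (Vertex d)} {e : Bond d} :
    e ∈ bondsIn S ↔ e.lower ∈ S ∧ e.upper ∈ S := by
  simp only [bondsIn, mem_filter, mem_product, mem_univ, and_true]
  exact ⟨fun h => h.2, fun h => ⟨h.1, h⟩⟩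

theorem card_box (d n : ℕ) : (box d n).card = (2 * n + 1) ^ d := by
  rw [box, Pi.card_Icc]
  simp only [Int.card_Icc, prod_const, card_univ, Fintype.card_fin]
  congr 1
  omega

theorem sum_bondsIn {d : ℕ} (S : Finset (Vertex d)) (F : Bond d → ℝ) :
    ∑ e ∈ bondsIn S, F e = ∑ x ∈ S, ∑ i, if (x, i) ∈ bondsIn S then F (x, i) else 0 := by
  rw [← sum_product', ← sum_filter]
  refine sum_congr ?_ fun _ _ => rfl
  ext e
  simp only [mem_filter, mem_product, mem_univ, and_true, Prod.mk.eta]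
  exact ⟨fun h => ⟨(mem_bondsIn.1 h).1, h⟩, fun h => h.2⟩

/-! ### The isoperimetric form of the Sobolev inequality on a box -/

/-- Telescoping along a segment. The increment from k to k + 1 is dropped because its bond leaves
the box. -/
theorem abs_sub_le_sum_Icc {k : ℕ} (g : ℤ → ℝ) {a b : ℤ} (ha : |a| ≤ k) (hb : |b| ≤ k) :
    |g a - g b| ≤ ∑ s ∈ Icc (-(k : ℤ)) k, if s < k then |g (s + 1) - g s| else 0 := by
  wlog hab : a ≤ b generalizing a b
  · rw [abs_sub_comm]
    exact this hb ha (le_of_not_ge hab)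
  obtain ⟨n, rfl⟩ := Int.le.dest hab
  rw [abs_le] at ha hb
  have h := dist_le_Ico_sum_dist (fun m : ℕ => g (a + m)) (Nat.zero_le n)
  simp only [Nat.cast_zero, add_zero, Real.dist_eq] at h
  refine h.trans ?_
  have hinj : Set.InjOn (fun m : ℕ => a + (m : ℤ)) (Ico 0 n : Finset ℕ) := by
    intro x _ y _ hxy
    simpa using hxy
  have hsub : (Ico 0 n).image (fun m : ℕ => a + (m : ℤ)) ⊆ Icc (-(k : ℤ)) k := by
    intro s hs
    obtain ⟨m, hm, rfl⟩ := mem_image.1 hs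
    rw [mem_Ico] at hm
    rw [mem_Icc]
    omega
  refine le_trans ?_ (sum_le_sum_of_subset_of_nonneg hsub fun s _ _ => by positivity)
  rw [sum_image hinj]
  refine sum_le_sum fun m hm => ?_
  rw [mem_Ico] at hm
  rw [if_pos (by omega), abs_sub_comm]
  push_cast
  rw [add_assoc]

/-- Compare g a with every g s on the line and average over s. The zero order term is needed because
g need not vanish at the ends. -/
theorem le_sum_line {k : ℕ} (g : ℤ → ℝ) {a : ℤ} (ha : |a| ≤ k) :
    g a ≤ ∑ s ∈ Icc (-(k : ℤ)) k,
      ((if s < k then |g (s + 1) - g s| else 0) + ((2 * k + 1 : ℕ) : ℝ)⁻¹ * g s) := by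
  set V := ∑ s ∈ Icc (-(k : ℤ)) k, if s < k then |g (s + 1) - g s| else 0 with hV
  have hcard : (Icc (-(k : ℤ)) k).card = 2 * k + 1 := by
    rw [Int.card_Icc]
    omega
  have h : ∑ s ∈ Icc (-(k : ℤ)) k, g a ≤ ∑ s ∈ Icc (-(k : ℤ)) k, (g s + V) := by
    refine sum_le_sum fun s hs => ?_
    have := abs_sub_le_sum_Icc g ha (b := s) (by rw [abs_le]; exact mem_Icc.1 hs)
    have := (abs_le.1 this).2
    linarith
  rw [sum_const, hcard, sum_add_distrib, sum_const, hcard, nsmul_eq_mul, nsmul_eq_mul] at h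
  rw [sum_add_distrib, ← mul_sum, ← hV]
  have hpos : (0 : ℝ) < ((2 * k + 1 : ℕ) : ℝ) := by positivity
  refine le_of_mul_le_mul_left (h.trans ?_) hpos
  rw [mul_add, mul_inv_cancel_left₀ hpos.ne']
  linarith

/-- Turns the grid-lines lemma for product measures into a statement about lattice sums. -/
theorem lintegral_pi_count {ι : Type*} [Fintype ι] (f : (ι → ℤ) → ℝ≥0∞) :
    ∫⁻ x, f x ∂(MeasureTheory.Measure.pi fun _ : ι => MeasureTheory.Measure.count) = ∑' x, f x := by
  rw [MeasureTheory.lintegral_countable']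
  refine tsum_congr fun x => ?_
  rw [← Set.univ_pi_singleton, MeasureTheory.Measure.pi_pi]
  simp

theorem update_mem_box {d k : ℕ} {x : Vertex d} (hx : x ∈ box d k) (i : Fin d) (s : ℤ) :
    Function.update x i s ∈ box d k ↔ s ∈ Icc (-(k : ℤ)) k := by
  rw [mem_box, mem_Icc, ← abs_le]
  constructor
  · intro h
    simpa using h i
  · intro h j
    by_cases hj : j = i
    · subst hj
      simpa using h
    · rw [Function.update_of_ne hj]
      exact mem_box.1 hx j

/-- The discrete Loomis-Whitney inequality in the form of the grid-lines lemma. -/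
theorem sum_prod_sum_line_le {D k : ℕ} (hD : 2 ≤ D) (f : Vertex D → ℝ) (hf : ∀ x, 0 ≤ f x) :
    ∑ x ∈ box D k, ∏ i, (∑ s ∈ Icc (-(k : ℤ)) k, f (Function.update x i s)) ^
        (1 / ((D : ℝ) - 1)) ≤ (∑ x ∈ box D k, f x) ^ ((D : ℝ) / (D - 1)) := by
  have hD' : (2 : ℝ) ≤ D := by exact_mod_cast hD
  have hconj : Real.HolderConjugate (Fintype.card (Fin D)) ((D : ℝ) / (D - 1)) := by
    rw [Fintype.card_fin, Real.holderConjugate_iff]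
    refine ⟨by linarith, ?_⟩
    have : (D : ℝ) ≠ 0 := by positivity
    field_simp
    ring
  -- Extension by zero, so that integrals over lines and over the whole lattice become sums over the
  -- box.
  let F : Vertex D → ℝ≥0∞ := fun x => if x ∈ box D k then ENNReal.ofReal (f x) else 0
  have hF : Measurable F := measurable_of_countable _
  have h := MeasureTheory.lintegral_prod_lintegral_pow_le
    (fun _ : Fin D => (MeasureTheory.Measure.count : MeasureTheory.Measure ℤ)) hconj hF
  rw [lintegral_pi_count, lintegral_pi_count] at h
  have hR : ∑' x, F x = ENNReal.ofReal (∑ x ∈ box D k, f x) := by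
    rw [tsum_eq_sum (s := box D k) fun x hx => if_neg hx, ENNReal.ofReal_sum_of_nonneg fun x _ => hf x]
    exact sum_congr rfl fun x hx => if_pos hx
  have hline : ∀ x ∈ box D k, ∀ i, ∫⁻ s, F (Function.update x i s) ∂MeasureTheory.Measure.count =
      ENNReal.ofReal (∑ s ∈ Icc (-(k : ℤ)) k, f (Function.update x i s)) := by
    intro x hx i
    rw [MeasureTheory.lintegral_count, tsum_eq_sum (s := Icc (-(k : ℤ)) k),
      ENNReal.ofReal_sum_of_nonneg fun s _ => hf _]
    · exact sum_congr rfl fun s hs => if_pos ((update_mem_box hx i s).2 hs)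
    · exact fun s hs => if_neg fun h => hs ((update_mem_box hx i s).1 h)
  have hp : 0 ≤ 1 / ((D : ℝ) - 1) := by
    apply div_nonneg <;> linarith
  have hL : ENNReal.ofReal (∑ x ∈ box D k, ∏ i, (∑ s ∈ Icc (-(k : ℤ)) k,
      f (Function.update x i s)) ^ (1 / ((D : ℝ) - 1))) ≤ ∑' x, ∏ i,
        (∫⁻ s, F (Function.update x i s) ∂MeasureTheory.Measure.count) ^
          (1 / ((Fintype.card (Fin D) : ℝ) - 1)) := by
    refine le_trans (le_of_eq ?_) (ENNReal.sum_le_tsum (box D k))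
    rw [ENNReal.ofReal_sum_of_nonneg fun x _ => prod_nonneg fun i _ =>
      Real.rpow_nonneg (sum_nonneg fun s _ => hf _) _]
    refine sum_congr rfl fun x hx => ?_
    rw [ENNReal.ofReal_prod_of_nonneg fun i _ => Real.rpow_nonneg (sum_nonneg fun s _ => hf _) _]
    refine prod_congr rfl fun i _ => ?_
    rw [hline x hx i, Fintype.card_fin, ENNReal.ofReal_rpow_of_nonneg (sum_nonneg fun s _ => hf _) hp]
  have h2 := hL.trans h
  rw [hR, ENNReal.ofReal_rpow_of_nonneg (sum_nonneg fun x _ => hf x)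
    (div_nonneg (by linarith) (by linarith))] at h2
  exact (ENNReal.ofReal_le_ofReal_iff (Real.rpow_nonneg (sum_nonneg fun x _ => hf x) _)).1 h2

/-- Gagliardo and Nirenberg's argument: w is bounded by the sum of f = |∇w| + w/(2k+1) along each of
the D lines through a point. Multiplying the D bounds, each to the power 1/(D−1), and summing gives
the left side of Loomis-Whitney. -/
theorem sobolev_box {D k : ℕ} (hD : 2 ≤ D) (w : Vertex D → ℝ) (hw : ∀ x, 0 ≤ w x) :
    (∑ x ∈ box D k, w x ^ ((D : ℝ) / (D - 1))) ^ (((D : ℝ) - 1) / D) ≤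
      ∑ e ∈ bondsIn (box D k), |grad w e| +
        ((2 * k + 1 : ℕ) : ℝ)⁻¹ * ∑ x ∈ box D k, w x := by
  have hD' : (2 : ℝ) ≤ D := by exact_mod_cast hD
  let f : Vertex D → ℝ := fun x =>
    (∑ i, if (x, i) ∈ bondsIn (box D k) then |grad w (x, i)| else 0) +
      ((2 * k + 1 : ℕ) : ℝ)⁻¹ * w x
  have hf : ∀ x, 0 ≤ f x := fun x => by
    have := hw x
    have : ∀ i, 0 ≤ if (x, i) ∈ bondsIn (box D k) then |grad w (x, i)| else 0 := fun i => by
      positivity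
    have := sum_nonneg fun i (_ : i ∈ univ) => this i
    positivity
  have hsum : ∑ x ∈ box D k, f x = ∑ e ∈ bondsIn (box D k), |grad w e| +
        ((2 * k + 1 : ℕ) : ℝ)⁻¹ * ∑ x ∈ box D k, w x := by
    rw [sum_bondsIn, mul_sum, ← sum_add_distrib]
  have hline : ∀ x ∈ box D k, ∀ i, w x ≤
      ∑ s ∈ Icc (-(k : ℤ)) k, f (Function.update x i s) := by
    intro x hx i
    have h := le_sum_line (fun s => w (Function.update x i s)) (mem_box.1 hx i)
    rw [Function.update_eq_self] at h
    refine h.trans (sum_le_sum fun s hs => ?_)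
    refine add_le_add ?_ le_rfl
    split_ifs with hsk
    · have hup : Bond.upper (Function.update x i s, i) = Function.update x i (s + 1) := by
        ext j
        by_cases hj : j = i
        · subst hj
          simp [Bond.upper]
        · simp [Bond.upper, hj]
      have hmem : (Function.update x i s, i) ∈ bondsIn (box D k) := by
        rw [mem_bondsIn, hup]
        refine ⟨(update_mem_box hx i s).2 hs, (update_mem_box hx i _).2 ?_⟩
        rw [mem_Icc] at hs ⊢
        omega
      refine le_trans (le_of_eq ?_) (single_le_sum (fun j _ => ?_) (mem_univ i))
      · rw [if_pos hmem, grad, hup]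
        rfl
      · positivity
    · exact sum_nonneg fun j _ => by positivity
  have hpt : ∀ x ∈ box D k, w x ^ ((D : ℝ) / (D - 1)) ≤
      ∏ i, (∑ s ∈ Icc (-(k : ℤ)) k, f (Function.update x i s)) ^ (1 / ((D : ℝ) - 1)) := by
    intro x hx
    have h1 : w x ^ ((D : ℝ) / (D - 1)) = ∏ _i : Fin D, w x ^ (1 / ((D : ℝ) - 1)) := by
      rw [prod_const, card_univ, Fintype.card_fin, ← Real.rpow_natCast, ← Real.rpow_mul (hw x)]
      congr 1
      ring
    rw [h1]
    refine prod_le_prod (fun i _ => Real.rpow_nonneg (hw x) _) fun i _ => ?_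
    exact Real.rpow_le_rpow (hw x) (hline x hx i) (div_nonneg (by linarith) (by linarith))
  have h := (sum_le_sum hpt).trans (sum_prod_sum_line_le (k := k) hD f hf)
  rw [← hsum]
  have hS : 0 ≤ ∑ x ∈ box D k, f x := sum_nonneg fun x _ => hf x
  have h2 := Real.rpow_le_rpow (sum_nonneg fun x _ => Real.rpow_nonneg (hw x) _) h
    (z := ((D : ℝ) - 1) / D) (div_nonneg (by linarith) (by linarith))
  rw [← Real.rpow_mul hS] at h2
  have h3 : (D : ℝ) / (D - 1) * ((D - 1) / D) = 1 := by
    have h4 : (D : ℝ) ≠ 0 := by positivity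
    have h5 : (D : ℝ) - 1 ≠ 0 := by linarith
    field_simp
  rwa [h3, Real.rpow_one] at h2

/-- A function whose support fills at most the fraction `2⁻ᴰ` of a box satisfies the Sobolev
inequality there without lower order term. -/
theorem sobolev_box_of_card_support_le {D k : ℕ} (hD : 2 ≤ D) (w : Vertex D → ℝ)
    (hw : ∀ x, 0 ≤ w x)
    (hsupp : (((box D k).filter fun x => 0 < w x).card : ℝ) ≤ ((2 * k + 1 : ℕ) / 2 : ℝ) ^ D) :
    (∑ x ∈ box D k, w x) ≤ (((box D k).filter fun x => 0 < w x).card : ℝ) ^ (1 / (D : ℝ)) *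
        (∑ x ∈ box D k, w x ^ ((D : ℝ) / (D - 1))) ^ (((D : ℝ) - 1) / D) ∧
    (∑ x ∈ box D k, w x ^ ((D : ℝ) / (D - 1))) ^ (((D : ℝ) - 1) / D) ≤
      2 * ∑ e ∈ bondsIn (box D k), |grad w e| := by
  have hD' : (2 : ℝ) ≤ D := by exact_mod_cast hD
  have hD0 : (D : ℝ) ≠ 0 := by positivity
  have hD1 : (D : ℝ) - 1 ≠ 0 := by linarith
  set A := (box D k).filter fun x => 0 < w x with hA
  set Z := (∑ x ∈ box D k, w x ^ ((D : ℝ) / (D - 1))) ^ (((D : ℝ) - 1) / D) with hZ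
  have hZ0 : 0 ≤ Z := Real.rpow_nonneg (sum_nonneg fun x _ => Real.rpow_nonneg (hw x) _) _
  have h1 : (∑ x ∈ box D k, w x) ≤ (A.card : ℝ) ^ (1 / (D : ℝ)) * Z := by
    have e1 : ∑ x ∈ box D k, w x = ∑ x ∈ A, (w x ^ ((D : ℝ) / (D - 1))) ^ (((D : ℝ) - 1) / D) := by
      rw [hA, sum_filter]
      refine sum_congr rfl fun x _ => ?_
      rw [← Real.rpow_mul (hw x)]
      have : (D : ℝ) / (D - 1) * ((D - 1) / D) = 1 := by field_simp
      rw [this, Real.rpow_one]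
      split_ifs with h
      · rfl
      · exact le_antisymm (not_lt.1 h) (hw x)
    rw [e1]
    refine (sum_rpow_le_card_rpow A (fun x _ => Real.rpow_nonneg (hw x) _)
      (div_nonneg (by linarith) (by linarith)) ?_).trans ?_
    · rw [div_le_one (by positivity)]
      linarith
    · have : 1 - ((D : ℝ) - 1) / D = 1 / D := by field_simp; ring
      rw [this, mul_comm]
      refine mul_le_mul_of_nonneg_left ?_ (by positivity)
      refine Real.rpow_le_rpow (sum_nonneg fun x _ => Real.rpow_nonneg (hw x) _) ?_
        (div_nonneg (by linarith) (by linarith))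
      exact sum_le_sum_of_subset_of_nonneg (filter_subset _ _) fun x _ _ =>
        Real.rpow_nonneg (hw x) _
  refine ⟨h1, ?_⟩
  have h2 := sobolev_box (k := k) hD w hw
  rw [← hZ] at h2
  have h3 : (A.card : ℝ) ^ (1 / (D : ℝ)) ≤ (2 * k + 1 : ℕ) / 2 := by
    refine (Real.rpow_le_rpow (by positivity) hsupp (by positivity)).trans (le_of_eq ?_)
    rw [one_div, Real.pow_rpow_inv_natCast (by positivity) (by omega)]
  have hpos : (0 : ℝ) < ((2 * k + 1 : ℕ) : ℝ) := by positivity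
  -- The zero order term is at most half of the left side, by Hölder on the small support, and is
  -- absorbed.
  have h4 : ((2 * k + 1 : ℕ) : ℝ)⁻¹ * ∑ x ∈ box D k, w x ≤ Z / 2 := by
    rw [inv_mul_le_iff₀ hpos]
    refine h1.trans ((mul_le_mul_of_nonneg_right h3 hZ0).trans (le_of_eq ?_))
    ring
  linarith

end RandomConductance

noncomputable section

namespace RandomConductance

open Finset

/-! ### Radial layers -/

/-- The sup norm of a vertex. -/
def rad {d : ℕ} (x : Vertex d) : ℕ := univ.sup fun i => (x i).natAbs

theorem rad_le {d n : ℕ} {x : Vertex d} : rad x ≤ n ↔ x ∈ box d n := by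
  rw [rad, Finset.sup_le_iff, mem_box]
  constructor
  · intro h i
    have := h i (mem_univ i)
    rw [Int.abs_eq_natAbs]
    exact_mod_cast this
  · intro h i _
    have := h i
    rw [Int.abs_eq_natAbs] at this
    exact_mod_cast this

theorem natAbs_le_rad {d : ℕ} (x : Vertex d) (i : Fin d) : (x i).natAbs ≤ rad x :=
  Finset.le_sup (f := fun i => (x i).natAbs) (mem_univ i)

theorem natAbs_upper_sub_le {d : ℕ} (e : Bond d) (i : Fin d) :
    (e.upper i).natAbs ≤ (e.lower i).natAbs + 1 ∧ (e.lower i).natAbs ≤ (e.upper i).natAbs + 1 := by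
  obtain ⟨x, j⟩ := e
  by_cases h : i = j
  · subst h
    simp only [Bond.upper, Bond.lower, Pi.add_apply, Pi.single_eq_same]
    omega
  · simp only [Bond.upper, Bond.lower, Pi.add_apply, Pi.single_eq_of_ne h]
    omega

theorem rad_upper_le {d : ℕ} (e : Bond d) : rad e.upper ≤ rad e.lower + 1 :=
  Finset.sup_le fun i _ => by
    have := (natAbs_upper_sub_le e i).1
    have := natAbs_le_rad e.lower i
    omega

theorem rad_lower_le {d : ℕ} (e : Bond d) : rad e.lower ≤ rad e.upper + 1 :=
  Finset.sup_le fun i _ => by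
    have := (natAbs_upper_sub_le e i).2
    have := natAbs_le_rad e.upper i
    omega

theorem box_mono {d m n : ℕ} (h : m ≤ n) : box d m ⊆ box d n := fun _ hx =>
  rad_le.1 ((rad_le.2 hx).trans h)

theorem bondsIn_mono {d : ℕ} {S T : Finset (Vertex d)} (h : S ⊆ T) : bondsIn S ⊆ bondsIn T :=
  fun _ he => mem_bondsIn.2 ⟨h (mem_bondsIn.1 he).1, h (mem_bondsIn.1 he).2⟩

/-- The bonds of the box of radius `m` which join the spheres of radius `k` and `k + 1`. -/
def crossing (d m k : ℕ) : Finset (Bond d) :=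
  (bondsIn (box d m)).filter fun e =>
    rad e.lower ≠ rad e.upper ∧ min (rad e.lower) (rad e.upper) = k

/-- The sphere of radius `k` in the sup norm. -/
def sphere (d k : ℕ) : Finset (Vertex d) := (box d k).filter fun x => rad x = k

/-- The bonds with both end-points on the sphere of radius `k`. -/
def tangential (d k : ℕ) : Finset (Bond d) := bondsIn (sphere d k)

theorem mem_sphere {d k : ℕ} {x : Vertex d} : x ∈ sphere d k ↔ rad x = k := by
  rw [sphere, mem_filter, ← rad_le]
  exact ⟨fun h => h.2, fun h => ⟨h.le, h⟩⟩

theorem sum_sum_filter_le {α : Type*} (s : Finset α) (I : Finset ℕ) (r : α → ℕ) (F : α → ℝ)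
    (hF : ∀ x ∈ s, 0 ≤ F x) : ∑ k ∈ I, ∑ x ∈ s with r x = k, F x ≤ ∑ x ∈ s, F x :=
  sum_fiberwise_le_sum_of_sum_fiber_nonneg fun _ _ =>
    sum_nonneg fun x hx => hF x (mem_filter.1 hx).1

theorem sum_crossing_le {d m : ℕ} (I : Finset ℕ) (F : Bond d → ℝ) (hF : ∀ e, 0 ≤ F e) :
    ∑ k ∈ I, ∑ e ∈ crossing d m k, F e ≤ ∑ e ∈ bondsIn (box d m), F e := by
  refine le_trans (sum_le_sum fun k _ => ?_) (sum_sum_filter_le (bondsIn (box d m)) I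
    (fun e => min (rad e.lower) (rad e.upper)) F fun e _ => hF e)
  refine sum_le_sum_of_subset_of_nonneg ?_ fun e _ _ => hF e
  exact monotone_filter_right _ fun e _ h => h.2

theorem sum_tangential_le {d m : ℕ} (I : Finset ℕ) (hI : ∀ k ∈ I, k ≤ m) (F : Bond d → ℝ)
    (hF : ∀ e, 0 ≤ F e) :
    ∑ k ∈ I, ∑ e ∈ tangential d k, F e ≤ ∑ e ∈ bondsIn (box d m), F e := by
  refine le_trans (sum_le_sum fun k hk => ?_) (sum_sum_filter_le (bondsIn (box d m)) I
    (fun e => rad e.lower) F fun e _ => hF e)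
  refine sum_le_sum_of_subset_of_nonneg ?_ fun e _ _ => hF e
  intro e he
  have h := mem_bondsIn.1 he
  rw [mem_sphere, mem_sphere] at h
  have := hI k hk
  exact mem_filter.2 ⟨mem_bondsIn.2 ⟨rad_le.1 (by omega), rad_le.1 (by omega)⟩, h.1⟩

/-! ### Energy estimates -/

/-- Summation by parts. The box on the right is larger by one so that it contains every bond with an
end-point in the support of ψ. -/
theorem sum_mul_divStar {d m : ℕ} (F : Bond d → ℝ) (ψ : Vertex d → ℝ)
    (hψ : ∀ x, x ∉ box d m → ψ x = 0) :
    ∑ x ∈ box d m, ψ x * divStar F x = ∑ e ∈ bondsIn (box d (m + 1)), F e * grad ψ e := by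
  have hout : ∀ x i, (x, i) ∉ bondsIn (box d (m + 1)) → x ∈ box d (m + 1) →
      grad ψ ((x, i) : Bond d) = 0 := by
    intro x i h hx
    have h2 : Bond.upper ((x, i) : Bond d) ∉ box d (m + 1) := fun hu => h (mem_bondsIn.2 ⟨hx, hu⟩)
    have h3 := rad_upper_le ((x, i) : Bond d)
    rw [← rad_le] at h2
    rw [grad, hψ, hψ, sub_zero]
    · rw [← rad_le]
      omega
    · rw [← rad_le]
      omega
  have hR : ∑ e ∈ bondsIn (box d (m + 1)), F e * grad ψ e =
      ∑ i, ∑ x ∈ box d (m + 1), F (x, i) * (ψ (x + Pi.single i 1) - ψ x) := by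
    rw [sum_bondsIn, sum_comm]
    refine sum_congr rfl fun i _ => sum_congr rfl fun x hx => ?_
    split_ifs with h
    · rfl
    · have := hout x i h hx
      rw [grad] at this
      change ψ (x + Pi.single i 1) - ψ x = 0 at this
      rw [this, mul_zero]
  rw [hR]
  simp only [divStar, mul_sum]
  rw [sum_comm]
  refine sum_congr rfl fun i _ => ?_
  -- The box is not invariant under translation, so the shift by e_i is carried out on the whole
  -- lattice.
  have h1 : ∑ x ∈ box d (m + 1), F (x, i) * ψ (x + Pi.single i 1) =
      ∑ x ∈ box d m, F (x - Pi.single i 1, i) * ψ x := by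
    rw [← finsum_eq_sum_of_support_subset (s := box d (m + 1)),
      ← finsum_eq_sum_of_support_subset (s := box d m)]
    · have h := finsum_comp_equiv (Equiv.addRight (Pi.single i 1 : Vertex d))
        (f := fun x => F (x - Pi.single i 1, i) * ψ x)
      simpa using h
    · intro x hx
      by_contra h
      exact hx (by simp [hψ x h])
    · intro x hx
      by_contra h
      refine hx ?_
      have h3 := rad_lower_le ((x, i) : Bond d)
      change rad x ≤ rad (x + Pi.single i 1) + 1 at h3
      have h4 : ¬ rad x ≤ m + 1 := fun h' => h (rad_le.1 h')
      have h5 : ψ (x + Pi.single i 1) = 0 := hψ _ (by rw [← rad_le]; omega)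
      simp [h5]
  have h2 : ∑ x ∈ box d (m + 1), F (x, i) * ψ x = ∑ x ∈ box d m, F (x, i) * ψ x := by
    symm
    refine sum_subset (box_mono (Nat.le_succ m)) fun x _ hx => ?_
    rw [hψ x hx, mul_zero]
  simp only [mul_sub, sum_sub_distrib]
  rw [h1, h2]
  simp only [mul_comm]

/-- The truncation `(u - K)₊`. -/
def trunc {α : Type*} (u : α → ℝ) (K : ℝ) (x : α) : ℝ := max (u x - K) 0

theorem trunc_nonneg {α : Type*} (u : α → ℝ) (K : ℝ) (x : α) : 0 ≤ trunc u K x := le_max_right _ _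

theorem trunc_pos {α : Type*} {u : α → ℝ} {K : ℝ} {x : α} : 0 < trunc u K x ↔ K < u x := by
  simp [trunc]

/-- Test with η²v, v = (u − K)₊. The bondwise identity ∇v ∇(η²v) = (∇(ηv))² − v(x)v(y)(∇η)² keeps
the product of the two end-point values and the constant 1, with no absorption of terms. -/
theorem caccioppoli {d m : ℕ} {ω : Bond d → ℝ} (hω : ∀ e, 0 < ω e) {u : Vertex d → ℝ}
    (hu : IsSolution ω u) (K : ℝ) (η : Vertex d → ℝ) (hη : ∀ x, x ∉ box d m → η x = 0) :
    ∑ e ∈ bondsIn (box d (m + 1)), ω e * grad (fun x => η x * trunc u K x) e ^ 2 ≤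
      ∑ e ∈ bondsIn (box d (m + 1)),
        ω e * (trunc u K e.lower * trunc u K e.upper) * grad η e ^ 2 := by
  have h0 := sum_mul_divStar (fun e => ω e * grad u e) (fun x => η x ^ 2 * trunc u K x)
    (m := m) fun x hx => by simp [hη x hx]
  rw [sum_eq_zero fun x _ => by rw [hu x, mul_zero]] at h0
  rw [← add_zero (∑ e ∈ bondsIn (box d (m + 1)), ω e * (_ * _) * _), h0, ← sum_add_distrib]
  refine sum_le_sum fun e _ => ?_
  simp only [grad]
  generalize e.upper = y
  generalize e.lower = x
  -- The part of u below K contributes with a favourable sign, so ∇v may replace ∇u.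
  have key : (trunc u K y - trunc u K x) * (η y ^ 2 * trunc u K y - η x ^ 2 * trunc u K x) ≤
      (u y - u x) * (η y ^ 2 * trunc u K y - η x ^ 2 * trunc u K x) := by
    have hx := sq_nonneg (η x)
    have hy := sq_nonneg (η y)
    simp only [trunc]
    rcases le_total (u x - K) 0 with h1 | h1 <;> rcases le_total (u y - K) 0 with h2 | h2
    · simp [max_eq_right h1, max_eq_right h2]
    · rw [max_eq_right h1, max_eq_left h2]
      nlinarith [mul_nonneg hy h2]
    · rw [max_eq_left h1, max_eq_right h2]
      nlinarith [mul_nonneg hx h1]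
    · rw [max_eq_left h1, max_eq_left h2]
      apply le_of_eq
      ring
  have := mul_le_mul_of_nonneg_left key (hω e).le
  linarith

/-- Cutting off along the layers in `G` only. -/
theorem card_sq_mul_energy_le {d ρ σ : ℕ} {ω : Bond d → ℝ} (hω : ∀ e, 0 < ω e) {u : Vertex d → ℝ}
    (hu : IsSolution ω u) (K : ℝ) {G : Finset ℕ} (hG : G ⊆ Ico ρ σ) :
    (G.card : ℝ) ^ 2 * ∑ e ∈ bondsIn (box d ρ), ω e * grad (trunc u K) e ^ 2 ≤
      ∑ k ∈ G, ∑ e ∈ crossing d σ k, ω e * (trunc u K e.lower * trunc u K e.upper) := by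
  rcases G.eq_empty_or_nonempty with rfl | ⟨k₀, hk₀⟩
  · simp
  have hk₀' := mem_Ico.1 (hG hk₀)
  obtain ⟨m, rfl⟩ : ∃ m, σ = m + 1 := ⟨σ - 1, by omega⟩
  -- Counts the chosen layers not yet crossed on the way out: |G| on the inner box, 0 outside the
  -- box of radius σ − 1, and a drop of one across each layer in G and nowhere else.
  let η : Vertex d → ℝ := fun x => ((G.filter fun j => rad x ≤ j).card : ℝ)
  have hη : ∀ x, x ∉ box d m → η x = 0 := by
    intro x hx
    rw [← rad_le] at hx
    simp only [η, Nat.cast_eq_zero, card_eq_zero]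
    refine filter_eq_empty_iff.2 fun j hj => ?_
    have := mem_Ico.1 (hG hj)
    omega
  have hη1 : ∀ x ∈ box d ρ, η x = G.card := by
    intro x hx
    rw [← rad_le] at hx
    simp only [η, Nat.cast_inj]
    congr 1
    refine filter_eq_self.2 fun j hj => ?_
    have := mem_Ico.1 (hG hj)
    omega
  have hstep : ∀ x y : Vertex d, rad y = rad x + 1 →
      (η x - η y) ^ 2 = if rad x ∈ G then 1 else 0 := by
    intro x y hxy
    have : (G.filter fun j => rad x ≤ j) =
        (G.filter fun j => rad y ≤ j) ∪ G.filter fun j => j = rad x := by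
      ext j
      simp only [mem_union, mem_filter]
      rw [← and_or_left]
      refine and_congr_right fun _ => ?_
      omega
    have hdisj : Disjoint (G.filter fun j => rad y ≤ j) (G.filter fun j => j = rad x) := by
      rw [disjoint_filter]
      intro j _ h1 h2
      omega
    simp only [η]
    rw [this, card_union_of_disjoint hdisj, filter_eq']
    split_ifs <;> simp
  have hgrad : ∀ e ∈ bondsIn (box d (m + 1)), grad η e ^ 2 =
      if rad e.lower ≠ rad e.upper ∧ min (rad e.lower) (rad e.upper) ∈ G then 1 else 0 := by
    intro e _
    have h1 := rad_upper_le e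
    have h2 := rad_lower_le e
    rcases lt_trichotomy (rad e.lower) (rad e.upper) with h | h | h
    · have h3 := hstep e.lower e.upper (by omega)
      rw [grad, ← neg_sub, neg_sq, h3, min_eq_left h.le]
      simp [h.ne]
    · have : η e.upper = η e.lower := by simp only [η, h]
      rw [grad, this]
      simp [h]
    · have h3 := hstep e.upper e.lower (by omega)
      rw [grad, h3, min_eq_right h.le]
      simp [h.ne']
  have hc := caccioppoli hω hu K η hη
  have hl : (G.card : ℝ) ^ 2 * ∑ e ∈ bondsIn (box d ρ), ω e * grad (trunc u K) e ^ 2 ≤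
      ∑ e ∈ bondsIn (box d (m + 1)), ω e * grad (fun x => η x * trunc u K x) e ^ 2 := by
    rw [mul_sum]
    refine le_trans (le_of_eq (sum_congr rfl fun e he => ?_))
      (sum_le_sum_of_subset_of_nonneg (bondsIn_mono (box_mono (by omega : ρ ≤ m + 1)))
        fun e _ _ => mul_nonneg (hω e).le (sq_nonneg _))
    have := mem_bondsIn.1 he
    simp only [grad]
    rw [hη1 _ this.1, hη1 _ this.2]
    ring
  refine hl.trans (hc.trans (le_of_eq ?_))
  rw [sum_congr rfl fun e he => by rw [hgrad e he, mul_ite, mul_one, mul_zero], ← sum_filter,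
    ← sum_fiberwise_of_maps_to (t := G) (g := fun e => min (rad e.lower) (rad e.upper))]
  · refine sum_congr rfl fun k hk => sum_congr ?_ fun _ _ => rfl
    ext e
    simp only [crossing, mem_filter]
    constructor
    · rintro ⟨⟨a, b, _⟩, c⟩
      exact ⟨a, b, c⟩
    · rintro ⟨a, b, c⟩
      exact ⟨⟨a, b, c ▸ hk⟩, c⟩
  · intro e he
    exact (mem_filter.1 he).2.2

end RandomConductance

end

noncomputable section

namespace RandomConductance

open Finset

/-! ### The Sobolev inequality on spheres -/

/-- A vertex is the lower end-point of at most d bonds and the upper end-point of at most d. -/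
theorem sum_bondsIn_lower_add_upper_le {d : ℕ} (S : Finset (Vertex d)) (f : Vertex d → ℝ)
    (hf : ∀ x, 0 ≤ f x) :
    ∑ e ∈ bondsIn S, (f e.lower + f e.upper) ≤ 2 * d * ∑ x ∈ S, f x := by
  have hprod : ∑ e ∈ S ×ˢ (univ : Finset (Fin d)), f e.1 = d * ∑ x ∈ S, f x := by
    rw [sum_product]
    simp [mul_sum]
  have h1 : ∑ e ∈ bondsIn S, f e.lower ≤ d * ∑ x ∈ S, f x := by
    rw [← hprod]
    refine sum_le_sum_of_subset_of_nonneg (fun e he => ?_) fun e _ _ => hf _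
    exact mem_product.2 ⟨(mem_bondsIn.1 he).1, mem_univ _⟩
  have h2 : ∑ e ∈ bondsIn S, f e.upper ≤ d * ∑ x ∈ S, f x := by
    have hinj : Set.InjOn (fun e : Bond d => (e.upper, e.2)) (bondsIn S : Finset (Bond d)) := by
      rintro ⟨x, i⟩ _ ⟨y, j⟩ _ h
      simp only [Bond.upper, Prod.mk.injEq] at h
      obtain ⟨h, rfl⟩ := h
      rw [add_right_cancel h]
    rw [← hprod, ← sum_image (f := fun e : Vertex d × Fin d => f e.1) hinj]
    refine sum_le_sum_of_subset_of_nonneg (fun e he => ?_) fun e _ _ => hf _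
    obtain ⟨b, hb, rfl⟩ := mem_image.1 he
    exact mem_product.2 ⟨(mem_bondsIn.1 hb).2, mem_univ _⟩
  rw [sum_add_distrib]
  linarith

theorem card_filter_pos_eq_sum {α : Type*} (S : Finset α) (v : α → ℝ) :
    (((S.filter fun x => 0 < v x).card : ℕ) : ℝ) = ∑ x ∈ S, if 0 < v x then 1 else 0 := by
  rw [sum_boole]

/-- Apply the L¹ Sobolev inequality to v^β with β = 1 + tθ, chosen so that βD/(D−1) = t. Since
|∇v^β| is at most β max(v)^{tθ} |∇v|, Hölder with the exponents θ for v^t, δ for the indicator of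
the support, 1/2 for the energy and Q/2 for the weight closes exactly, as they add up to 1. The
factor Z^θ is then divided out, and 1 − 1/D − θ = (1 − P)/2 is the exponent left on Z. -/
theorem sobolev_face {D k : ℕ} (hD : 2 ≤ D) {P Q δ : ℝ} (hP : 0 ≤ P) (hP1 : P < 1) (hQ : 0 ≤ Q)
    (hδ : 0 < δ) (hδ' : δ = 1 / D - P / 2 - Q / 2) (v : Vertex D → ℝ) (hv : ∀ x, 0 ≤ v x)
    (en hh : Bond D → ℝ) (hen : ∀ e, 0 ≤ en e) (hhh : ∀ e, 0 ≤ hh e) {κ : ℝ} (hκ : 0 ≤ κ)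
    (hgrad : ∀ e ∈ bondsIn (box D k), |grad v e| ≤ κ * (en e ^ (1 / 2 : ℝ) * hh e ^ (Q / 2)))
    (hsupp : (((box D k).filter fun x => 0 < v x).card : ℝ) ≤ ((2 * k + 1 : ℕ) / 2 : ℝ) ^ D) :
    (∑ x ∈ box D k, v x ^ (2 / (1 - P))) ^ ((1 - P) / 2) ≤
      4 * D * (1 + 2 / (1 - P)) * κ *
        ((((box D k).filter fun x => 0 < v x).card : ℝ) ^ δ *
          (∑ e ∈ bondsIn (box D k), en e) ^ (1 / 2 : ℝ) *
            (∑ e ∈ bondsIn (box D k), hh e) ^ (Q / 2)) := by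
  have hD' : (2 : ℝ) ≤ D := by exact_mod_cast hD
  have hD0 : (0 : ℝ) < D := by positivity
  have hDinv : 1 / (D : ℝ) ≤ 1 / 2 := one_div_le_one_div_of_le (by norm_num) hD'
  have hDD : ((D : ℝ) - 1) / D = 1 - 1 / D := by field_simp
  set t : ℝ := 2 / (1 - P) with ht
  have ht0 : 0 < t := div_pos two_pos (by linarith)
  have htP : t * (1 - P) = 2 := by
    rw [ht]
    exact div_mul_cancel₀ _ (by linarith)
  set θ : ℝ := (1 + P) / 2 - 1 / D with hθ
  have hθ0 : 0 ≤ θ := by linarith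
  have hθ1 : θ ≤ 1 := by
    have : 0 < 1 / (D : ℝ) := by positivity
    linarith
  have hsum1 : θ + δ + 1 / 2 + Q / 2 = 1 := by linarith
  have hβt : (1 + t * θ) * ((D : ℝ) / (D - 1)) = t := by
    have h1 : 1 + t * θ = t * (1 - 1 / D) := by
      rw [hθ]
      linear_combination (-1 / 2 : ℝ) * htP
    rw [h1, ← hDD]
    have : (D : ℝ) - 1 ≠ 0 := by linarith
    field_simp
  set A := (box D k).filter fun x => 0 < v x with hA
  set Z := ∑ x ∈ box D k, v x ^ t with hZ
  have hZ0 : 0 ≤ Z := sum_nonneg fun x _ => Real.rpow_nonneg (hv x) _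
  set R := (A.card : ℝ) ^ δ * (∑ e ∈ bondsIn (box D k), en e) ^ (1 / 2 : ℝ) *
            (∑ e ∈ bondsIn (box D k), hh e) ^ (Q / 2) with hR
  have hR0 : 0 ≤ R := by
    have := sum_nonneg fun e (_ : e ∈ bondsIn (box D k)) => hen e
    have := sum_nonneg fun e (_ : e ∈ bondsIn (box D k)) => hhh e
    positivity
  have hβ1 : 1 ≤ 1 + t * θ := by
    have := mul_nonneg ht0.le hθ0
    linarith
  have hβ2 : 1 + t * θ ≤ 1 + t := by
    have := mul_le_of_le_one_right ht0.le hθ1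
    linarith
  have hβ0 : 0 < 1 + t * θ := by linarith
  -- the Sobolev inequality for a power of `v`
  have hA' : (box D k).filter (fun x => 0 < v x ^ (1 + t * θ)) = A := by
    refine filter_congr fun x _ => ?_
    constructor
    · intro h
      refine lt_of_le_of_ne (hv x) fun h0 => ?_
      rw [← h0, Real.zero_rpow hβ0.ne'] at h
      exact lt_irrefl _ h
    · exact fun h => Real.rpow_pos_of_pos h _
  have hS := (sobolev_box_of_card_support_le (k := k) hD (fun x => v x ^ (1 + t * θ))
    (fun x => Real.rpow_nonneg (hv x) _) (by rw [hA']; exact hsupp)).2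
  have hZ' : ∑ x ∈ box D k, (v x ^ (1 + t * θ)) ^ ((D : ℝ) / (D - 1)) = Z :=
    sum_congr rfl fun x _ => by rw [← Real.rpow_mul (hv x), hβt]
  rw [hZ', hDD] at hS
  let χ : Vertex D → ℝ := fun x => if 0 < v x then 1 else 0
  have hχ : ∀ x, 0 ≤ χ x := fun x => by
    simp only [χ]
    positivity
  have hpt : ∀ e ∈ bondsIn (box D k), |grad (fun x => v x ^ (1 + t * θ)) e| ≤
      ((1 + t) * κ) * ((v e.lower ^ t + v e.upper ^ t) ^ θ * (χ e.lower + χ e.upper) ^ δ *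
        en e ^ (1 / 2 : ℝ) * hh e ^ (Q / 2)) := by
    intro e he
    have hg := hgrad e he
    have h1 := abs_rpow_sub_rpow_le (hv e.upper) (hv e.lower) hβ1
    rw [add_sub_cancel_left] at h1
    have hR' : 0 ≤ ((1 + t) * κ) * ((v e.lower ^ t + v e.upper ^ t) ^ θ *
        (χ e.lower + χ e.upper) ^ δ * en e ^ (1 / 2 : ℝ) * hh e ^ (Q / 2)) := by
      have := hv e.lower
      have := hv e.upper
      have := hχ e.lower
      have := hχ e.upper
      have := hen e
      have := hhh e
      positivity
    by_cases hz : v e.lower = 0 ∧ v e.upper = 0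
    · refine le_trans (le_of_eq ?_) hR'
      simp only [grad]
      rw [hz.1, hz.2, sub_self, abs_zero]
    -- The indicator costs nothing on bonds where v^β can vary, since v is positive at one end.
    have hχ1 : 1 ≤ (χ e.lower + χ e.upper) ^ δ := by
      refine Real.one_le_rpow ?_ hδ.le
      by_cases hl : 0 < v e.lower
      · have : χ e.lower = 1 := if_pos hl
        linarith [hχ e.upper]
      · have hl0 : v e.lower = 0 := le_antisymm (not_lt.1 hl) (hv _)
        have hu : 0 < v e.upper := lt_of_le_of_ne (hv _) fun h => hz ⟨hl0, h.symm⟩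
        have : χ e.upper = 1 := if_pos hu
        linarith [hχ e.lower]
    have hmax : max (v e.upper) (v e.lower) ^ (t * θ) ≤ (v e.lower ^ t + v e.upper ^ t) ^ θ := by
      rw [Real.rpow_mul (le_max_of_le_left (hv _))]
      refine Real.rpow_le_rpow (Real.rpow_nonneg (le_max_of_le_left (hv _)) _) ?_ hθ0
      have h3 := Real.rpow_nonneg (hv e.lower) t
      have h4 := Real.rpow_nonneg (hv e.upper) t
      rcases max_choice (v e.upper) (v e.lower) with h | h <;> rw [h] <;> linarith
    have hm0 : 0 ≤ max (v e.upper) (v e.lower) ^ (t * θ) :=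
      Real.rpow_nonneg (le_max_of_le_left (hv _)) _
    calc |grad (fun x => v x ^ (1 + t * θ)) e|
        ≤ (1 + t * θ) * max (v e.upper) (v e.lower) ^ (t * θ) * |grad v e| := h1
      _ ≤ (1 + t) * ((v e.lower ^ t + v e.upper ^ t) ^ θ * (χ e.lower + χ e.upper) ^ δ) *
          (κ * (en e ^ (1 / 2 : ℝ) * hh e ^ (Q / 2))) := by
          refine mul_le_mul (mul_le_mul hβ2 ?_ hm0 (by linarith)) hg (abs_nonneg _) ?_
          · calc _ ≤ (v e.lower ^ t + v e.upper ^ t) ^ θ * 1 := by rw [mul_one]; exact hmax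
              _ ≤ _ := mul_le_mul_of_nonneg_left hχ1 (hm0.trans hmax)
          · exact mul_nonneg (by linarith) (mul_nonneg (hm0.trans hmax) (zero_le_one.trans hχ1))
      _ = _ := by ring
  have hHol := sum_rpow_mul_four_le (bondsIn (box D k))
    (f₁ := fun e => v e.lower ^ t + v e.upper ^ t) (f₂ := fun e => χ e.lower + χ e.upper)
    (f₃ := en) (f₄ := hh) (fun e _ => add_nonneg (Real.rpow_nonneg (hv _) _)
      (Real.rpow_nonneg (hv _) _)) (fun e _ => add_nonneg (hχ _) (hχ _)) (fun e _ => hen e)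
    (fun e _ => hhh e) hθ0 hδ.le (by norm_num : (0 : ℝ) ≤ 1 / 2) (by linarith : 0 ≤ Q / 2) hsum1
  have hb1 := sum_bondsIn_lower_add_upper_le (box D k) (fun x => v x ^ t)
    fun x => Real.rpow_nonneg (hv x) _
  have hb2 := sum_bondsIn_lower_add_upper_le (box D k) χ hχ
  rw [← card_filter_pos_eq_sum] at hb2
  have hbound : (∑ e ∈ bondsIn (box D k), (v e.lower ^ t + v e.upper ^ t)) ^ θ *
      (∑ e ∈ bondsIn (box D k), (χ e.lower + χ e.upper)) ^ δ ≤
      (2 * D) * (Z ^ θ * (A.card : ℝ) ^ δ) := by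
    calc _ ≤ (2 * D * Z) ^ θ * (2 * D * (A.card : ℝ)) ^ δ := by
          refine mul_le_mul (Real.rpow_le_rpow (sum_nonneg fun e _ => add_nonneg
            (Real.rpow_nonneg (hv _) _) (Real.rpow_nonneg (hv _) _)) hb1 hθ0)
            (Real.rpow_le_rpow (sum_nonneg fun e _ => add_nonneg (hχ _) (hχ _)) hb2 hδ.le)
            (Real.rpow_nonneg (sum_nonneg fun e _ => add_nonneg (hχ _) (hχ _)) _) ?_
          positivity
      _ = (2 * D : ℝ) ^ (θ + δ) * (Z ^ θ * (A.card : ℝ) ^ δ) := by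
          rw [Real.mul_rpow (x := 2 * D) (by positivity) hZ0,
            Real.mul_rpow (x := 2 * D) (by positivity) (by positivity),
            Real.rpow_add (by positivity)]
          ring
      _ ≤ (2 * D : ℝ) ^ (1 : ℝ) * (Z ^ θ * (A.card : ℝ) ^ δ) := by
          refine mul_le_mul_of_nonneg_right ?_ (by positivity)
          exact Real.rpow_le_rpow_of_exponent_le (by linarith) (by linarith)
      _ = _ := by rw [Real.rpow_one]
  have hmain : Z ^ (1 - 1 / (D : ℝ)) ≤ 4 * D * (1 + t) * κ * R * Z ^ θ := by
    have h0e := sum_nonneg fun e (_ : e ∈ bondsIn (box D k)) => hen e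
    have h0h := sum_nonneg fun e (_ : e ∈ bondsIn (box D k)) => hhh e
    calc Z ^ (1 - 1 / (D : ℝ)) ≤ 2 * ∑ e ∈ bondsIn (box D k),
          |grad (fun x => v x ^ (1 + t * θ)) e| := hS
      _ ≤ 2 * (((1 + t) * κ) * ((2 * D) * (Z ^ θ * (A.card : ℝ) ^ δ) *
          (∑ e ∈ bondsIn (box D k), en e) ^ (1 / 2 : ℝ) *
            (∑ e ∈ bondsIn (box D k), hh e) ^ (Q / 2))) := by
          refine mul_le_mul_of_nonneg_left ((sum_le_sum hpt).trans ?_) two_pos.le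
          rw [← mul_sum]
          refine mul_le_mul_of_nonneg_left (hHol.trans ?_) (by positivity)
          gcongr
      _ = _ := by
          rw [hR]
          ring
  -- Division by Z^θ needs Z > 0; for Z = 0 the left side vanishes.
  rcases hZ0.eq_or_lt with h0 | hpos
  · rw [← h0, Real.zero_rpow (by linarith)]
    positivity
  · have hsplit : Z ^ (1 - 1 / (D : ℝ)) = Z ^ ((1 - P) / 2) * Z ^ θ := by
      rw [← Real.rpow_add hpos]
      congr 1
      rw [hθ]
      ring
    rw [hsplit] at hmain
    exact le_of_mul_le_mul_right hmain (Real.rpow_pos_of_pos hpos _)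

theorem rad_insertNth {D k : ℕ} (i : Fin (D + 1)) {c : ℤ} (hc : c.natAbs = k) {y : Vertex D}
    (hy : y ∈ box D k) : rad (i.insertNth c y : Vertex (D + 1)) = k := by
  refine le_antisymm (Finset.sup_le fun j _ => ?_) ?_
  · rcases Fin.eq_self_or_eq_succAbove i j with rfl | ⟨j, rfl⟩
    · simp [hc]
    · rw [Fin.insertNth_apply_succAbove]
      exact (natAbs_le_rad y j).trans (rad_le.2 hy)
  · have := natAbs_le_rad (i.insertNth c y : Vertex (D + 1)) i
    rwa [Fin.insertNth_apply_same, hc] at this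

/-- The embedding of a face carries bonds to bonds, direction j becoming `i.succAbove j`. -/
theorem insertNth_add_single {D : ℕ} (i : Fin (D + 1)) (c : ℤ) (y : Vertex D) (j : Fin D) :
    (i.insertNth c (y + Pi.single j 1) : Vertex (D + 1)) =
      i.insertNth c y + Pi.single (i.succAbove j) 1 := by
  funext l
  rcases Fin.eq_self_or_eq_succAbove i l with rfl | ⟨l, rfl⟩
  · simp
  · simp only [Fin.insertNth_apply_succAbove, Pi.add_apply, Pi.single_apply,
      Fin.succAbove_right_inj]

/-- Some coordinate of a point on the sphere equals k or −k, so the faces cover the sphere; overlaps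
only help. -/
theorem sum_sphere_le {D k : ℕ} (F : Vertex (D + 1) → ℝ) (hF : ∀ x, 0 ≤ F x) :
    ∑ x ∈ sphere (D + 1) k, F x ≤ ∑ i : Fin (D + 1), ∑ c ∈ ({(k : ℤ), -(k : ℤ)} : Finset ℤ),
      ∑ y ∈ box D k, F (i.insertNth c y) := by
  have h1 : ∀ x ∈ sphere (D + 1) k, F x ≤ ∑ i : Fin (D + 1),
      ∑ c ∈ ({(k : ℤ), -(k : ℤ)} : Finset ℤ), if x i = c then F x else 0 := by
    intro x hx
    rw [mem_sphere] at hx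
    obtain ⟨i, -, hi⟩ := exists_mem_eq_sup univ univ_nonempty fun i => (x i).natAbs
    change rad x = _ at hi
    have hmem : x i ∈ ({(k : ℤ), -(k : ℤ)} : Finset ℤ) := by
      rw [mem_insert, mem_singleton]
      omega
    have h0 : ∀ i c, 0 ≤ if x i = c then F x else 0 := fun i c => by
      have := hF x
      positivity
    refine le_trans ?_ (single_le_sum (fun i _ => sum_nonneg fun c _ => h0 i c) (mem_univ i))
    refine le_trans (le_of_eq ?_) (single_le_sum (fun c _ => h0 i c) hmem)
    rw [if_pos rfl]
  refine (sum_le_sum h1).trans ?_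
  rw [sum_comm]
  refine sum_le_sum fun i _ => ?_
  rw [sum_comm]
  refine sum_le_sum fun c _ => ?_
  rw [← sum_filter]
  have hins : ∀ x : Vertex (D + 1), x i = c → i.insertNth c (i.removeNth x) = x := by
    rintro x rfl
    exact Fin.insertNth_self_removeNth i x
  have hinj : Set.InjOn (fun x : Vertex (D + 1) => i.removeNth x)
      ((sphere (D + 1) k).filter fun x => x i = c : Finset (Vertex (D + 1))) := by
    intro x hx y hy hxy
    have hx' := hins x (mem_filter.1 hx).2
    have hy' := hins y (mem_filter.1 hy).2
    simp only at hxy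
    rw [← hx', ← hy', hxy]
  have himg : ∑ x ∈ sphere (D + 1) k with x i = c, F x = ∑ y ∈ ((sphere (D + 1) k).filter fun x =>
      x i = c).image (fun x : Vertex (D + 1) => i.removeNth x), F (i.insertNth c y) := by
    rw [sum_image hinj]
    exact sum_congr rfl fun x hx => by rw [hins x (mem_filter.1 hx).2]
  rw [himg]
  refine sum_le_sum_of_subset_of_nonneg (fun y hy => ?_) fun _ _ _ => hF _
  obtain ⟨x, hx, rfl⟩ := mem_image.1 hy
  have hr := mem_sphere.1 (mem_filter.1 hx).1
  exact mem_box.2 fun j => mem_box.1 (rad_le.1 hr.le) _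

/-- Each face is a D-dimensional box whose support, energy and weight are at most those of the
sphere. The bound is `sobolev_face` squared and summed over at most 2(D+1) faces; squaring doubles
the exponents δ, 1/2 and Q/2. -/
theorem sobolev_sphere {D k : ℕ} (hD : 2 ≤ D) {P Q δ : ℝ} (hP : 0 ≤ P) (hP1 : P < 1) (hQ : 0 ≤ Q)
    (hδ : 0 < δ) (hδ' : δ = 1 / D - P / 2 - Q / 2) (v : Vertex (D + 1) → ℝ) (hv : ∀ x, 0 ≤ v x)
    (en hh : Bond (D + 1) → ℝ) (hen : ∀ e, 0 ≤ en e) (hhh : ∀ e, 0 ≤ hh e) {κ : ℝ} (hκ : 0 ≤ κ)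
    (hgrad : ∀ e ∈ tangential (D + 1) k, |grad v e| ≤ κ * (en e ^ (1 / 2 : ℝ) * hh e ^ (Q / 2)))
    (hsupp : (((sphere (D + 1) k).filter fun x => 0 < v x).card : ℝ) ≤
      ((2 * k + 1 : ℕ) / 2 : ℝ) ^ D) :
    (∑ x ∈ sphere (D + 1) k, v x ^ (2 / (1 - P))) ^ (1 - P) ≤
      2 * (D + 1) * (4 * D * (1 + 2 / (1 - P))) ^ 2 * κ ^ 2 *
        ((((sphere (D + 1) k).filter fun x => 0 < v x).card : ℝ) ^ (2 * δ) *
          (∑ e ∈ tangential (D + 1) k, en e) * (∑ e ∈ tangential (D + 1) k, hh e) ^ Q) := by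
  have hD0 : (0 : ℝ) < D := by positivity
  set t : ℝ := 2 / (1 - P) with ht
  have ht0 : 0 < t := div_pos two_pos (by linarith)
  have htP : (1 - P) / 2 * t = 1 := by
    rw [ht]
    have : 1 - P ≠ 0 := by linarith
    field_simp
  set s := (((sphere (D + 1) k).filter fun x => 0 < v x).card : ℝ) with hs
  have hs0 : 0 ≤ s := by positivity
  set EN := ∑ e ∈ tangential (D + 1) k, en e with hEN
  set HH := ∑ e ∈ tangential (D + 1) k, hh e with hHH
  have hEN0 : 0 ≤ EN := sum_nonneg fun e _ => hen e
  have hHH0 : 0 ≤ HH := sum_nonneg fun e _ => hhh e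
  set R := 4 * D * (1 + t) * κ * (s ^ δ * EN ^ (1 / 2 : ℝ) * HH ^ (Q / 2)) with hR
  have hR0 : 0 ≤ R := by positivity
  have hface : ∀ i : Fin (D + 1), ∀ c ∈ ({(k : ℤ), -(k : ℤ)} : Finset ℤ),
      ∑ y ∈ box D k, v (i.insertNth c y) ^ t ≤ R ^ t := by
    intro i c hc
    have hc' : c.natAbs = k := by
      rw [mem_insert, mem_singleton] at hc
      omega
    let b : Bond D → Bond (D + 1) := fun e => (i.insertNth c e.1, i.succAbove e.2)
    have hup : ∀ e : Bond D, (b e).upper = i.insertNth c e.upper := fun e =>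
      (insertNth_add_single i c e.1 e.2).symm
    have hbmem : ∀ e ∈ bondsIn (box D k), b e ∈ tangential (D + 1) k := by
      intro e he
      have := mem_bondsIn.1 he
      refine mem_bondsIn.2 ⟨mem_sphere.2 (rad_insertNth i hc' this.1), ?_⟩
      rw [hup]
      exact mem_sphere.2 (rad_insertNth i hc' this.2)
    have hbinj : Function.Injective b := by
      rintro ⟨x, j⟩ ⟨y, l⟩ h
      simp only [b, Prod.mk.injEq] at h
      rw [Fin.succAbove_right_inj] at h
      rw [Fin.insertNth_injective2 h.1 |>.2, h.2]
    have hsumb : ∀ F : Bond (D + 1) → ℝ, (∀ e, 0 ≤ F e) →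
        ∑ e ∈ bondsIn (box D k), F (b e) ≤ ∑ e ∈ tangential (D + 1) k, F e := by
      intro F hF
      rw [← sum_image (f := F) hbinj.injOn]
      refine sum_le_sum_of_subset_of_nonneg (fun e he => ?_) fun e _ _ => hF e
      obtain ⟨e', he', rfl⟩ := mem_image.1 he
      exact hbmem e' he'
    have hcard : (((box D k).filter fun y => 0 < v (i.insertNth c y)).card : ℝ) ≤ s := by
      rw [hs]
      refine Nat.cast_le.2 (card_le_card_of_injOn (fun y => i.insertNth c y) ?_ ?_)
      · intro y hy
        have hy := mem_filter.1 hy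
        exact mem_filter.2 ⟨mem_sphere.2 (rad_insertNth i hc' hy.1), hy.2⟩
      · intro x _ y _ hxy
        exact (Fin.insertNth_injective2 hxy).2
    have h := sobolev_face (k := k) hD hP hP1 hQ hδ hδ' (fun y => v (i.insertNth c y))
      (fun y => hv _) (fun e => en (b e)) (fun e => hh (b e)) (fun e => hen _) (fun e => hhh _) hκ
      (fun e he => by
        have := hgrad (b e) (hbmem e he)
        rw [grad, hup] at this
        exact this)
      (hcard.trans hsupp)
    have h2 : (∑ y ∈ box D k, v (i.insertNth c y) ^ t) ^ ((1 - P) / 2) ≤ R := by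
      refine h.trans ?_
      have h3 := hsumb en hen
      have h4 := hsumb hh hhh
      have h5 := sum_nonneg fun e (_ : e ∈ bondsIn (box D k)) => hen (b e)
      have h6 := sum_nonneg fun e (_ : e ∈ bondsIn (box D k)) => hhh (b e)
      rw [hR]
      gcongr
    have hz0 : 0 ≤ ∑ y ∈ box D k, v (i.insertNth c y) ^ t :=
      sum_nonneg fun y _ => Real.rpow_nonneg (hv _) _
    have h3 := Real.rpow_le_rpow (Real.rpow_nonneg hz0 _) h2 ht0.le
    rwa [← Real.rpow_mul hz0, htP, Real.rpow_one] at h3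
  have hsum := sum_sphere_le (k := k) (fun x : Vertex (D + 1) => v x ^ t)
    fun x => Real.rpow_nonneg (hv x) _
  have hsum2 : ∑ x ∈ sphere (D + 1) k, v x ^ t ≤ 2 * (D + 1) * R ^ t := by
    refine hsum.trans ((sum_le_sum fun i _ => sum_le_sum (hface i)).trans ?_)
    rw [sum_const, sum_const, card_univ, Fintype.card_fin, nsmul_eq_mul, nsmul_eq_mul]
    have h2 : ((#({(k : ℤ), -(k : ℤ)} : Finset ℤ) : ℕ) : ℝ) ≤ 2 := by
      exact_mod_cast card_le_two
    have h3 : 0 ≤ R ^ t := Real.rpow_nonneg hR0 _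
    push_cast
    have h4 := mul_le_mul_of_nonneg_right h2 h3
    nlinarith
  have hz0 : 0 ≤ ∑ x ∈ sphere (D + 1) k, v x ^ t := sum_nonneg fun x _ => Real.rpow_nonneg (hv x) _
  have hsq : ∀ x : ℝ, 0 ≤ x → ∀ a : ℝ, (x ^ a) ^ 2 = x ^ (2 * a) := by
    intro x hx a
    rw [← Real.rpow_natCast, ← Real.rpow_mul hx]
    congr 1
    push_cast
    ring
  calc (∑ x ∈ sphere (D + 1) k, v x ^ t) ^ (1 - P) ≤ (2 * (D + 1) * R ^ t) ^ (1 - P) :=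
        Real.rpow_le_rpow hz0 hsum2 (by linarith)
    _ = (2 * (D + 1) : ℝ) ^ (1 - P) * R ^ 2 := by
        rw [Real.mul_rpow (by positivity) (by positivity), ← Real.rpow_mul hR0, ← Real.rpow_natCast]
        congr 2
        push_cast
        linarith
    _ ≤ (2 * (D + 1) : ℝ) ^ (1 : ℝ) * R ^ 2 := by
        refine mul_le_mul_of_nonneg_right ?_ (by positivity)
        exact Real.rpow_le_rpow_of_exponent_le (by linarith) (by linarith)
    _ = _ := by
        rw [Real.rpow_one, hR, mul_pow, mul_pow _ κ, mul_pow _ (HH ^ (Q / 2)), mul_pow (s ^ δ),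
          hsq s hs0, hsq EN hEN0, hsq HH hHH0]
        rw [show (2 : ℝ) * (1 / 2) = 1 by norm_num, Real.rpow_one, show 2 * (Q / 2) = Q by ring]
        ring

end RandomConductance

end

noncomputable section

namespace RandomConductance

open Finset

/-! ### Energy estimates for truncated solutions -/

/-- The weight `ω` and its inverse are dominated on the box of radius `2n` by powers of functions of
bounded average. -/
structure Majorized {d : ℕ} (ω : Bond d → ℝ) (n : ℕ) (P Q Wp Wq : ℝ) (g h : Bond d → ℝ) :
    Prop where
  pos : ∀ e, 0 < ω e
  g_nonneg : ∀ e, 0 ≤ g e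
  h_nonneg : ∀ e, 0 ≤ h e
  Wp_nonneg : 0 ≤ Wp
  Wq_nonneg : 0 ≤ Wq
  le_g : ∀ e ∈ bondsIn (box d (2 * n)), ω e ≤ Wp * g e ^ P
  inv_le_h : ∀ e ∈ bondsIn (box d (2 * n)), (ω e)⁻¹ ≤ Wq * h e ^ Q
  sum_g : ∑ e ∈ bondsIn (box d (2 * n)), g e ≤ (bondsIn (box d (2 * n))).card
  sum_h : ∑ e ∈ bondsIn (box d (2 * n)), h e ≤ (bondsIn (box d (2 * n))).card

/-- The energy of `v` in the box of radius `m`. -/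
def energy {d : ℕ} (ω : Bond d → ℝ) (v : Vertex d → ℝ) (m : ℕ) : ℝ :=
  ∑ e ∈ bondsIn (box d m), ω e * grad v e ^ 2

/-- The number of points of the box of radius `m` where `u` exceeds `K`. -/
def above {d : ℕ} (u : Vertex d → ℝ) (K : ℝ) (m : ℕ) : ℝ :=
  (((box d m).filter fun x => K < u x).card : ℝ)

theorem energy_nonneg {d : ℕ} {ω : Bond d → ℝ} (hω : ∀ e, 0 < ω e) (v : Vertex d → ℝ) (m : ℕ) :
    0 ≤ energy ω v m :=
  sum_nonneg fun e _ => mul_nonneg (hω e).le (sq_nonneg _)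

theorem above_nonneg {d : ℕ} (u : Vertex d → ℝ) (K : ℝ) (m : ℕ) : 0 ≤ above u K m :=
  Nat.cast_nonneg _

theorem card_bondsIn_le {d n : ℕ} (hn : 1 ≤ n) :
    ((bondsIn (box d (2 * n))).card : ℝ) ≤ d * 5 ^ d * (n : ℝ) ^ d := by
  have h1 : (bondsIn (box d (2 * n))).card ≤ (4 * n + 1) ^ d * d := by
    refine (card_filter_le _ _).trans (le_of_eq ?_)
    rw [card_product, card_box, card_univ, Fintype.card_fin]
    ring
  have h2 : (4 * n + 1) ^ d * d ≤ (5 * n) ^ d * d :=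
    Nat.mul_le_mul_right _ (Nat.pow_le_pow_left (by omega) _)
  have h3 : (((bondsIn (box d (2 * n))).card : ℕ) : ℝ) ≤ (((5 * n) ^ d * d : ℕ) : ℝ) := by
    exact_mod_cast h1.trans h2
  refine h3.trans (le_of_eq ?_)
  push_cast
  rw [mul_pow]
  ring

/-- Split |∇v| = (ω|∇v|²)^{1/2} (ω⁻¹)^{1/2} and bound ω⁻¹ by its majorant; this is the form of
gradient bound required by `sobolev_face`. -/
theorem abs_grad_le {d n : ℕ} {ω : Bond d → ℝ} {P Q Wp Wq : ℝ} {g h : Bond d → ℝ}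
    (H : Majorized ω n P Q Wp Wq g h) (v : Vertex d → ℝ) {e : Bond d}
    (he : e ∈ bondsIn (box d (2 * n))) :
    |grad v e| ≤ Wq ^ (1 / 2 : ℝ) * ((ω e * grad v e ^ 2) ^ (1 / 2 : ℝ) * h e ^ (Q / 2)) := by
  have hω := H.pos e
  have hWq := H.Wq_nonneg
  have hh := H.h_nonneg e
  have h1 : grad v e ^ 2 ≤ Wq * (ω e * grad v e ^ 2) * h e ^ Q := by
    have := mul_le_mul_of_nonneg_left (H.inv_le_h e he)
      (mul_nonneg hω.le (sq_nonneg (grad v e)))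
    rw [mul_comm (ω e), mul_assoc, mul_inv_cancel₀ hω.ne', mul_one] at this
    linarith
  have h2 : |grad v e| = (grad v e ^ 2) ^ (1 / 2 : ℝ) := by
    rw [← Real.sqrt_eq_rpow, Real.sqrt_sq_eq_abs]
  have hE : 0 ≤ ω e * grad v e ^ 2 := mul_nonneg hω.le (sq_nonneg _)
  rw [h2]
  refine (Real.rpow_le_rpow (sq_nonneg _) h1 (by norm_num)).trans (le_of_eq ?_)
  rw [Real.mul_rpow (mul_nonneg hWq hE) (Real.rpow_nonneg hh _), Real.mul_rpow hWq hE,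
    ← Real.rpow_mul hh, mul_assoc]
  congr 3
  ring

/-- The product is at most the square of the larger factor. The power 1 − P is the one dual to g^P
in Hölder's inequality. -/
theorem mul_le_rpow_add_rpow {P a b : ℝ} (hP1 : P < 1) (ha : 0 ≤ a) (hb : 0 ≤ b) :
    a * b ≤ (a ^ (2 / (1 - P)) + b ^ (2 / (1 - P))) ^ (1 - P) := by
  have hP : 1 - P ≠ 0 := by linarith
  have key : ∀ c : ℝ, 0 ≤ c → (c ^ (2 / (1 - P))) ^ (1 - P) = c ^ 2 := by
    intro c hc
    rw [← Real.rpow_mul hc, div_mul_cancel₀ _ hP]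
    norm_num
  have h1 := Real.rpow_nonneg ha (2 / (1 - P))
  have h2 := Real.rpow_nonneg hb (2 / (1 - P))
  rcases le_total a b with h | h
  · calc a * b ≤ b ^ 2 := by nlinarith
      _ = (b ^ (2 / (1 - P))) ^ (1 - P) := (key b hb).symm
      _ ≤ _ := Real.rpow_le_rpow h2 (by linarith) (by linarith)
  · calc a * b ≤ a ^ 2 := by nlinarith
      _ = (a ^ (2 / (1 - P))) ^ (1 - P) := (key a ha).symm
      _ ≤ _ := Real.rpow_le_rpow h1 (by linarith) (by linarith)

/-- Hölder with exponents P for g and 1 − P for the t-th powers of v, followed by counting bonds at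
each vertex. -/
theorem sum_weight_mul_le {d n : ℕ} {ω : Bond d → ℝ} {P Q Wp Wq : ℝ} {g h : Bond d → ℝ}
    (H : Majorized ω n P Q Wp Wq g h) (hP : 0 ≤ P) (hP1 : P < 1) {v : Vertex d → ℝ}
    (hv : ∀ x, 0 ≤ v x) {T : Finset (Bond d)} (hT : T ⊆ bondsIn (box d (2 * n)))
    {S : Finset (Vertex d)} (hTS : T ⊆ bondsIn S) :
    ∑ e ∈ T, ω e * (v e.lower * v e.upper) ≤
      Wp * ((∑ e ∈ T, g e) ^ P * (2 * d * ∑ x ∈ S, v x ^ (2 / (1 - P))) ^ (1 - P)) := by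
  have hv' : ∀ x, 0 ≤ v x ^ (2 / (1 - P)) := fun x => Real.rpow_nonneg (hv x) _
  have h1 : ∑ e ∈ T, ω e * (v e.lower * v e.upper) ≤ Wp * ∑ e ∈ T, g e ^ P *
      (v e.lower ^ (2 / (1 - P)) + v e.upper ^ (2 / (1 - P))) ^ (1 - P) := by
    rw [mul_sum]
    refine sum_le_sum fun e he => ?_
    rw [← mul_assoc Wp]
    exact mul_le_mul (H.le_g e (hT he)) (mul_le_rpow_add_rpow hP1 (hv _) (hv _))
      (mul_nonneg (hv _) (hv _)) ((H.pos e).le.trans (H.le_g e (hT he)))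
  refine h1.trans (mul_le_mul_of_nonneg_left ?_ H.Wp_nonneg)
  refine (sum_rpow_mul_le T (fun e _ => H.g_nonneg e) (fun e _ => add_nonneg (hv' _) (hv' _))
    hP (by linarith) (by ring)).trans ?_
  refine mul_le_mul_of_nonneg_left ?_ (Real.rpow_nonneg (sum_nonneg fun e _ => H.g_nonneg e) _)
  refine Real.rpow_le_rpow (sum_nonneg fun e _ => add_nonneg (hv' _) (hv' _)) ?_ (by linarith)
  refine le_trans ?_ (sum_bondsIn_lower_add_upper_le S _ hv')
  exact sum_le_sum_of_subset_of_nonneg hTS fun e _ _ => add_nonneg (hv' _) (hv' _)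

/-- The linear cut-off. -/
theorem energy_le_of_cutoff {d n : ℕ} (hn : 1 ≤ n) {ω : Bond d → ℝ} {P Q Wp Wq : ℝ}
    {g h : Bond d → ℝ} (H : Majorized ω n P Q Wp Wq g h) (hP : 0 ≤ P) (hP1 : P < 1)
    {u : Vertex d → ℝ} (hu : IsSolution ω u) {K : ℝ} (hK : 0 ≤ K) {ρ σ : ℕ} (hρσ : ρ < σ)
    (hσ : σ ≤ 2 * n) :
    ((σ : ℝ) - ρ) ^ 2 * energy ω (trunc u K) ρ ≤ d * 5 ^ d * Wp * (n : ℝ) ^ d *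
      ((∑ x ∈ box d σ, |u x| ^ (2 / (1 - P))) / (n : ℝ) ^ d) ^ (1 - P) := by
  have hsub := bondsIn_mono (box_mono (d := d) hσ)
  have hn0 : (0 : ℝ) < (n : ℝ) ^ d := by positivity
  -- Taking all layers makes η linear in the radius.
  have h1 := card_sq_mul_energy_le (G := Ico ρ σ) H.pos hu K subset_rfl
  rw [Nat.card_Ico, Nat.cast_sub hρσ.le] at h1
  refine h1.trans ?_
  refine (sum_crossing_le _ (fun e => ω e * (trunc u K e.lower * trunc u K e.upper)) fun e =>
    mul_nonneg (H.pos e).le (mul_nonneg (trunc_nonneg _ _ _) (trunc_nonneg _ _ _))).trans ?_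
  refine (sum_weight_mul_le H hP hP1 (trunc_nonneg u K) hsub subset_rfl).trans ?_
  have hg : ∑ e ∈ bondsIn (box d σ), g e ≤ d * 5 ^ d * (n : ℝ) ^ d :=
    (sum_le_sum_of_subset_of_nonneg hsub fun e _ _ => H.g_nonneg e).trans
      (H.sum_g.trans (card_bondsIn_le hn))
  have hv : ∑ x ∈ box d σ, trunc u K x ^ (2 / (1 - P)) ≤ ∑ x ∈ box d σ, |u x| ^ (2 / (1 - P)) := by
    refine sum_le_sum fun x _ => Real.rpow_le_rpow (trunc_nonneg _ _ _) ?_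
      (div_nonneg two_pos.le (by linarith))
    exact max_le ((sub_le_self _ hK).trans (le_abs_self _)) (abs_nonneg _)
  have hv0 : 0 ≤ ∑ x ∈ box d σ, trunc u K x ^ (2 / (1 - P)) :=
    sum_nonneg fun x _ => Real.rpow_nonneg (trunc_nonneg _ _ _) _
  have h25 : (2 : ℝ) * d ≤ d * 5 ^ d := by
    rcases Nat.eq_zero_or_pos d with rfl | hd
    · simp
    · have : (5 : ℝ) ^ 1 ≤ 5 ^ d := pow_le_pow_right₀ (by norm_num) hd
      have hd' : (0 : ℝ) < d := by exact_mod_cast hd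
      nlinarith
  set U := ∑ x ∈ box d σ, |u x| ^ (2 / (1 - P)) with hU
  have hU0 : 0 ≤ U := hv0.trans hv
  have hC : (0 : ℝ) ≤ d * 5 ^ d * (n : ℝ) ^ d := by positivity
  have hlast : (∑ e ∈ bondsIn (box d σ), g e) ^ P *
      (2 * d * ∑ x ∈ box d σ, trunc u K x ^ (2 / (1 - P))) ^ (1 - P) ≤
      (d * 5 ^ d * (n : ℝ) ^ d) ^ P * (d * 5 ^ d * (n : ℝ) ^ d * (U / (n : ℝ) ^ d)) ^ (1 - P) := by
    refine mul_le_mul (Real.rpow_le_rpow (sum_nonneg fun e _ => H.g_nonneg e) hg hP)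
      (Real.rpow_le_rpow (by positivity) ?_ (by linarith)) (by positivity) (by positivity)
    calc 2 * d * ∑ x ∈ box d σ, trunc u K x ^ (2 / (1 - P)) ≤ d * 5 ^ d * U :=
          mul_le_mul h25 hv hv0 (by positivity)
      _ = _ := by
          rw [mul_assoc _ _ (U / _), mul_div_cancel₀ _ hn0.ne']
  have hsplit : (d * 5 ^ d * (n : ℝ) ^ d) ^ P * (d * 5 ^ d * (n : ℝ) ^ d * (U / (n : ℝ) ^ d)) ^ (1 - P)
      = d * 5 ^ d * (n : ℝ) ^ d * (U / (n : ℝ) ^ d) ^ (1 - P) := by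
    rw [Real.mul_rpow hC (by positivity), ← mul_assoc, ← Real.rpow_add_of_nonneg hC hP (by linarith)]
    rw [add_sub_cancel, Real.rpow_one]
  rw [hsplit] at hlast
  refine (mul_le_mul_of_nonneg_left hlast H.Wp_nonneg).trans (le_of_eq ?_)
  ring

/-- The half of the iteration that passes from energy to support. It uses the Sobolev inequality on
the full d-dimensional box: the support has at most n^d points, which is within the admissible
fraction of the box and gives |supp|^{1/d} ≤ n. The gradient is split by Hölder with exponents 1/2,
Q/2 and 1/2 − Q/2. -/
theorem sum_trunc_sq_le {d n : ℕ} (hd : 2 ≤ d) (hn : 1 ≤ n) {ω : Bond d → ℝ} {P Q Wp Wq : ℝ}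
    {g h : Bond d → ℝ} (H : Majorized ω n P Q Wp Wq g h) (hQ : 0 ≤ Q) (hQ1 : Q ≤ 1)
    (u : Vertex d → ℝ) (K : ℝ) {σ : ℕ} (hnσ : n ≤ σ) (hσ : σ ≤ 2 * n)
    (hA : above u K σ ≤ (n : ℝ) ^ d) :
    (∑ x ∈ box d σ, trunc u K x) ^ 2 ≤
      4 * (d * 5 ^ d) * (n : ℝ) ^ 2 * (Wq * energy ω (trunc u K) σ * (n : ℝ) ^ d) := by
  have hsub := bondsIn_mono (box_mono (d := d) hσ)
  have hfilter : (box d σ).filter (fun x => 0 < trunc u K x) =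
      (box d σ).filter fun x => K < u x := filter_congr fun x _ => trunc_pos
  have hnσ' : (n : ℝ) ≤ ((2 * σ + 1 : ℕ) : ℝ) / 2 := by
    have : (n : ℝ) ≤ σ := by exact_mod_cast hnσ
    push_cast
    linarith
  have hS := sobolev_box_of_card_support_le (k := σ) hd (trunc u K) (trunc_nonneg u K) (by
    rw [hfilter]
    exact hA.trans (pow_le_pow_left₀ (by positivity) hnσ' _))
  rw [hfilter] at hS
  change _ ≤ above u K σ ^ _ * _ ∧ _ at hS
  have hA1 : above u K σ ^ (1 / (d : ℝ)) ≤ n := by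
    refine (Real.rpow_le_rpow (above_nonneg _ _ _) hA (by positivity)).trans (le_of_eq ?_)
    rw [one_div, Real.pow_rpow_inv_natCast (by positivity) (by omega)]
  have hE := energy_nonneg H.pos (trunc u K) σ
  have hgr : ∑ e ∈ bondsIn (box d σ), |grad (trunc u K) e| ≤ Wq ^ (1 / 2 : ℝ) *
      (energy ω (trunc u K) σ ^ (1 / 2 : ℝ) * (d * 5 ^ d * (n : ℝ) ^ d) ^ (1 / 2 : ℝ)) := by
    refine (sum_le_sum fun e he => abs_grad_le H (trunc u K) (hsub he)).trans ?_
    rw [← mul_sum]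
    refine mul_le_mul_of_nonneg_left ?_ (Real.rpow_nonneg H.Wq_nonneg _)
    have hHol := sum_rpow_mul_four_le (bondsIn (box d σ))
      (f₁ := fun e => ω e * grad (trunc u K) e ^ 2) (f₂ := h) (f₃ := fun _ => 1) (f₄ := fun _ => 1)
      (fun e _ => mul_nonneg (H.pos e).le (sq_nonneg _)) (fun e _ => H.h_nonneg e) (by simp)
      (by simp) (by norm_num : (0 : ℝ) ≤ 1 / 2) (by linarith : 0 ≤ Q / 2)
      (by linarith : 0 ≤ 1 / 2 - Q / 2) le_rfl (by ring)
    simp only [Real.one_rpow, mul_one, Real.rpow_zero, sum_const, nsmul_eq_mul] at hHol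
    refine hHol.trans ?_
    change energy ω (trunc u K) σ ^ (1 / 2 : ℝ) * _ * _ ≤ _
    rw [mul_assoc]
    refine mul_le_mul_of_nonneg_left ?_ (by positivity)
    have h1 : ∑ e ∈ bondsIn (box d σ), h e ≤ d * 5 ^ d * (n : ℝ) ^ d :=
      (sum_le_sum_of_subset_of_nonneg hsub fun e _ _ => H.h_nonneg e).trans
        (H.sum_h.trans (card_bondsIn_le hn))
    have h2 : ((bondsIn (box d σ)).card : ℝ) ≤ d * 5 ^ d * (n : ℝ) ^ d :=
      (Nat.cast_le.2 (card_le_card hsub)).trans (card_bondsIn_le hn)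
    calc _ ≤ (d * 5 ^ d * (n : ℝ) ^ d) ^ (Q / 2) * (d * 5 ^ d * (n : ℝ) ^ d) ^ (1 / 2 - Q / 2) :=
          mul_le_mul (Real.rpow_le_rpow (sum_nonneg fun e _ => H.h_nonneg e) h1 (by linarith))
            (Real.rpow_le_rpow (by positivity) h2 (by linarith)) (by positivity) (by positivity)
      _ = _ := by
          rw [← Real.rpow_add_of_nonneg (by positivity) (by linarith) (by linarith)]
          congr 1
          ring
  have hfin : ∑ x ∈ box d σ, trunc u K x ≤ n * (2 * (Wq ^ (1 / 2 : ℝ) *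
      (energy ω (trunc u K) σ ^ (1 / 2 : ℝ) * (d * 5 ^ d * (n : ℝ) ^ d) ^ (1 / 2 : ℝ)))) := by
    refine hS.1.trans (mul_le_mul hA1 (hS.2.trans (mul_le_mul_of_nonneg_left hgr two_pos.le)) ?_
      (by positivity))
    exact Real.rpow_nonneg (sum_nonneg fun x _ => Real.rpow_nonneg (trunc_nonneg _ _ _) _) _
  have hsq : ∀ x : ℝ, 0 ≤ x → (x ^ (1 / 2 : ℝ)) ^ 2 = x := fun x hx => by
    rw [← Real.sqrt_eq_rpow, Real.sq_sqrt hx]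
  refine (pow_le_pow_left₀ (sum_nonneg fun x _ => trunc_nonneg _ _ _) hfin 2).trans (le_of_eq ?_)
  rw [mul_pow, mul_pow, mul_pow, mul_pow, hsq _ H.Wq_nonneg, hsq _ hE, hsq _ (by positivity)]
  ring

end RandomConductance

end

/-! ### Decay of the energy across good layers -/

noncomputable section

namespace RandomConductance

open Finset

/-- Bonds crossing layer k end on the spheres k and k + 1, so each sphere is counted at most twice.
-/
theorem sum_succ_le {I : Finset ℕ} (F : ℕ → ℝ) {M : ℝ}
    (hM : ∀ J : Finset ℕ, J ⊆ I ∪ I.image (· + 1) → ∑ k ∈ J, F k ≤ M) :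
    ∑ k ∈ I, (F k + F (k + 1)) ≤ 2 * M := by
  rw [sum_add_distrib, ← sum_image (f := F) (g := (· + 1)) (fun x _ y _ h => by simpa using h)]
  linarith [hM I subset_union_left, hM _ subset_union_right]

/-- The constant in the Sobolev inequality on spheres. -/
def sphereConst (D : ℕ) (P : ℝ) : ℝ := 2 * (D + 1) * (4 * D * (1 + 2 / (1 - P))) ^ 2

theorem sphereConst_nonneg {D : ℕ} {P : ℝ} (hP1 : P < 1) : 0 ≤ sphereConst D P := by
  have : 0 < 1 - P := by linarith
  rw [sphereConst]
  positivity

/-- N is the average volume of a layer. In `energy_step` its exponents P, 2δ, Q add up to τ = 2/D,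
so N enters only through N^{2/D}, of order n²; this scaling makes the cut-off estimate independent
of n. -/
theorem rpow_combine_le {C₀ N α b P Q δ τ : ℝ} (hC₀ : 1 ≤ C₀) (hN : 0 < N) (hα : 0 ≤ α)
    (hδ : 0 < δ) (hτ : P + 2 * δ + Q = τ) (hτ1 : τ ≤ 1) (hNb : N ^ τ ≤ b) :
    (16 * C₀ * N) ^ P * ((16 * (α * N)) ^ (2 * δ) * (16 * C₀ * N) ^ Q) ≤
        16 * C₀ * b * α ^ (2 * δ) := by
  have i1 : (16 * C₀ * N) ^ P = (16 * C₀) ^ P * N ^ P := Real.mul_rpow (by positivity) hN.le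
  have i2 : (16 * C₀ * N) ^ Q = (16 * C₀) ^ Q * N ^ Q := Real.mul_rpow (by positivity) hN.le
  have i3 : (16 * (α * N)) ^ (2 * δ) = 16 ^ (2 * δ) * (α ^ (2 * δ) * N ^ (2 * δ)) := by
    rw [Real.mul_rpow (by positivity) (by positivity), Real.mul_rpow hα hN.le]
  have i4 : (16 : ℝ) ^ (2 * δ) ≤ (16 * C₀) ^ (2 * δ) :=
    Real.rpow_le_rpow (by norm_num) (by linarith) (by positivity)
  have i5 : (16 * C₀) ^ P * (16 * C₀) ^ (2 * δ) * (16 * C₀) ^ Q ≤ 16 * C₀ := by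
    rw [← Real.rpow_add (by positivity), ← Real.rpow_add (by positivity), hτ]
    calc (16 * C₀) ^ τ ≤ (16 * C₀) ^ (1 : ℝ) :=
          Real.rpow_le_rpow_of_exponent_le (by linarith) hτ1
      _ = _ := Real.rpow_one _
  have i6 : N ^ P * N ^ (2 * δ) * N ^ Q ≤ b := by
    rw [← Real.rpow_add hN, ← Real.rpow_add hN, hτ]
    exact hNb
  rw [i1, i2, i3]
  calc (16 * C₀) ^ P * N ^ P * (16 ^ (2 * δ) * (α ^ (2 * δ) * N ^ (2 * δ)) *
        ((16 * C₀) ^ Q * N ^ Q))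
      = ((16 * C₀) ^ P * 16 ^ (2 * δ) * (16 * C₀) ^ Q) * (N ^ P * N ^ (2 * δ) * N ^ Q) *
        α ^ (2 * δ) := by ring
    _ ≤ ((16 * C₀) ^ P * (16 * C₀) ^ (2 * δ) * (16 * C₀) ^ Q) *
        (N ^ P * N ^ (2 * δ) * N ^ Q) * α ^ (2 * δ) := by gcongr
    _ ≤ 16 * C₀ * b * α ^ (2 * δ) := by gcongr

/-- Hölder on the crossing bonds of one layer, then `sobolev_sphere` on each of its two spheres. The
bound b ≤ n^D makes the support on the sphere small enough, since its radius is at least n. -/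
theorem sum_crossing_weight_le {D n : ℕ} (hD : 2 ≤ D) {P Q δ : ℝ} (hP : 0 ≤ P)
    (hP1 : P < 1) (hQ : 0 ≤ Q) (hδ : 0 < δ) (hδ' : δ = 1 / D - P / 2 - Q / 2)
    {ω : Bond (D + 1) → ℝ} {Wp Wq : ℝ} {g h : Bond (D + 1) → ℝ} (H : Majorized ω n P Q Wp Wq g h)
    {v : Vertex (D + 1) → ℝ} (hv : ∀ x, 0 ≤ v x) {σ k : ℕ} (hnk : n ≤ k) (hkσ : k < σ)
    (hσ : σ ≤ 2 * n) {a b c : ℝ} (hb0 : 0 ≤ b)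
    (hg : ∑ e ∈ crossing (D + 1) σ k, g e ≤ a)
    (hs : ∀ j, (j = k ∨ j = k + 1) → (((sphere (D + 1) j).filter fun x => 0 < v x).card : ℝ) ≤ b)
    (he : ∀ j, (j = k ∨ j = k + 1) → ∑ e ∈ tangential (D + 1) j, ω e * grad v e ^ 2 ≤ c)
    (hh : ∀ j, (j = k ∨ j = k + 1) → ∑ e ∈ tangential (D + 1) j, h e ≤ a)
    (hb : b ≤ (n : ℝ) ^ D) :
    ∑ e ∈ crossing (D + 1) σ k, ω e * (v e.lower * v e.upper) ≤
      4 * (D + 1) * sphereConst D P * (Wp * Wq) * c * (a ^ P * (b ^ (2 * δ) * a ^ Q)) := by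
  set t : ℝ := 2 / (1 - P) with ht
  set κ : ℝ := Wq ^ (1 / 2 : ℝ) with hκ
  have hκ0 : 0 ≤ κ := Real.rpow_nonneg H.Wq_nonneg _
  have hκ2 : κ ^ 2 = Wq := by rw [hκ, ← Real.sqrt_eq_rpow, Real.sq_sqrt H.Wq_nonneg]
  have hsub := bondsIn_mono (box_mono (d := D + 1) hσ)
  have hg0 : 0 ≤ ∑ e ∈ crossing (D + 1) σ k, g e := sum_nonneg fun e _ => H.g_nonneg e
  have ha0 : 0 ≤ a := hg0.trans hg
  have hen : ∀ e, 0 ≤ ω e * grad v e ^ 2 := fun e => mul_nonneg (H.pos e).le (sq_nonneg _)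
  have hc0 : 0 ≤ c := (sum_nonneg fun e _ => hen e).trans (he k (Or.inl rfl))
  have hspC := sphereConst_nonneg (D := D) hP1
  have hWp := H.Wp_nonneg
  have hWq := H.Wq_nonneg
  have hsob : ∀ j, (j = k ∨ j = k + 1) → (∑ x ∈ sphere (D + 1) j, v x ^ t) ^ (1 - P) ≤
      sphereConst D P * Wq * (b ^ (2 * δ) * c * a ^ Q) := by
    intro j hj
    have hnj : n ≤ j := by omega
    have hjσ : j ≤ σ := by omega
    have hsup : (((sphere (D + 1) j).filter fun x => 0 < v x).card : ℝ) ≤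
        ((2 * j + 1 : ℕ) / 2 : ℝ) ^ D := by
      refine (hs j hj).trans (hb.trans (pow_le_pow_left₀ (by positivity) ?_ _))
      have : (n : ℝ) ≤ j := by exact_mod_cast hnj
      push_cast
      linarith
    have := sobolev_sphere (k := j) hD hP hP1 hQ hδ hδ' v hv (fun e => ω e * grad v e ^ 2) h hen
      H.h_nonneg hκ0 (fun e he => abs_grad_le H v (bondsIn_mono (fun x hx => box_mono
        (hjσ.trans hσ) (rad_le.1 (mem_sphere.1 hx).le)) he)) hsup
    rw [hκ2] at this
    refine this.trans (mul_le_mul_of_nonneg_left ?_ (mul_nonneg (by positivity) hWq))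
    have f1 := Real.rpow_le_rpow (Nat.cast_nonneg _) (hs j hj) (by positivity : 0 ≤ 2 * δ)
    have h0 : 0 ≤ ∑ e ∈ tangential (D + 1) j, h e := sum_nonneg fun e _ => H.h_nonneg e
    have f3 := Real.rpow_le_rpow h0 (hh j hj) hQ
    exact mul_le_mul (mul_le_mul f1 (he j hj) (sum_nonneg fun e _ => hen e) (by positivity)) f3
      (Real.rpow_nonneg h0 _) (by positivity)
  have hzn : ∀ j, 0 ≤ ∑ x ∈ sphere (D + 1) j, v x ^ t := fun j =>
    sum_nonneg fun x _ => Real.rpow_nonneg (hv x) _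
  have hdisj : Disjoint (sphere (D + 1) k) (sphere (D + 1) (k + 1)) := by
    rw [disjoint_left]
    intro x hx hx'
    rw [mem_sphere] at hx hx'
    omega
  have hcr : crossing (D + 1) σ k ⊆ bondsIn (sphere (D + 1) k ∪ sphere (D + 1) (k + 1)) := by
    intro e he
    have h1 := (mem_filter.1 he).2
    have h2 := rad_upper_le e
    have h3 := rad_lower_le e
    rw [mem_bondsIn, mem_union, mem_union, mem_sphere, mem_sphere, mem_sphere, mem_sphere]
    omega
  have hw := sum_weight_mul_le H hP hP1 hv ((filter_subset _ _).trans hsub) hcr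
  refine hw.trans ?_
  rw [sum_union hdisj, ← ht]
  set R := sphereConst D P * Wq * (b ^ (2 * δ) * c * a ^ Q) with hR
  have hR0 : 0 ≤ R := by positivity
  have hZ : (2 * ((D + 1 : ℕ) : ℝ) * (∑ x ∈ sphere (D + 1) k, v x ^ t +
      ∑ x ∈ sphere (D + 1) (k + 1), v x ^ t)) ^ (1 - P) ≤ 2 * (D + 1) * (2 * R) := by
    rw [Real.mul_rpow (by positivity) (add_nonneg (hzn _) (hzn _))]
    refine mul_le_mul ?_ ?_ (Real.rpow_nonneg (add_nonneg (hzn _) (hzn _)) _) (by positivity)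
    · push_cast
      have hD0 : (0 : ℝ) ≤ D := Nat.cast_nonneg D
      calc (2 * ((D : ℝ) + 1)) ^ (1 - P) ≤ (2 * ((D : ℝ) + 1)) ^ (1 : ℝ) :=
            Real.rpow_le_rpow_of_exponent_le (by linarith) (by linarith)
        _ = _ := Real.rpow_one _
    · refine (Real.rpow_add_le_add_rpow (hzn _) (hzn _) (by linarith) (by linarith)).trans ?_
      linarith [hsob k (Or.inl rfl), hsob (k + 1) (Or.inr rfl)]
  have hgP : (∑ e ∈ crossing (D + 1) σ k, g e) ^ P ≤ a ^ P := Real.rpow_le_rpow hg0 hg hP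
  refine (mul_le_mul_of_nonneg_left (mul_le_mul hgP hZ (Real.rpow_nonneg
    (mul_nonneg (by positivity) (add_nonneg (hzn _) (hzn _))) _) (by positivity)) hWp).trans
    (le_of_eq ?_)
  rw [hR]
  ring

set_option maxHeartbeats 1000000 in
/-- One step of the iteration: on at least half of the layers between the two boxes the weights, the
energy and the support are controlled by their averages, and cutting off along these layers combines
with the Sobolev inequality on spheres. -/
theorem energy_step {D n : ℕ} (hD : 2 ≤ D) (hn : 1 ≤ n) {P Q δ : ℝ} (hP : 0 ≤ P) (hP1 : P < 1)
    (hQ : 0 ≤ Q) (hδ : 0 < δ) (hδ' : δ = 1 / D - P / 2 - Q / 2) {ω : Bond (D + 1) → ℝ} {Wp Wq : ℝ}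
    {g h : Bond (D + 1) → ℝ} (H : Majorized ω n P Q Wp Wq g h) {u : Vertex (D + 1) → ℝ}
    (hu : IsSolution ω u) (K : ℝ) {ρ σ : ℕ} (hnρ : n ≤ ρ) (hρσ : ρ < σ) (hσ : σ ≤ 2 * n)
    {lam : ℝ} (hlam1 : 1 ≤ lam) (hlam : (n : ℝ) ≤ lam * ((σ : ℝ) - ρ))
    (hA : lam * above u K σ ≤ (n : ℝ) ^ (D + 1) / 16) :
    energy ω (trunc u K) ρ ≤
      128 * (D + 1) * sphereConst D P * (16 * ((D + 1 : ℕ) * 5 ^ (D + 1))) * (Wp * Wq) * lam ^ 3 *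
        (above u K σ / (n : ℝ) ^ (D + 1)) ^ (2 * δ) * energy ω (trunc u K) σ := by
  have hD' : (2 : ℝ) ≤ D := by exact_mod_cast hD
  have hn' : (1 : ℝ) ≤ n := by exact_mod_cast hn
  have hsub := bondsIn_mono (box_mono (d := D + 1) hσ)
  set v := trunc u K with hv
  have hv0 : ∀ x, 0 ≤ v x := trunc_nonneg u K
  set A := above u K σ with hAdef
  have hA0 : 0 ≤ A := above_nonneg _ _ _
  set E := energy ω v σ with hE
  have hE0 : 0 ≤ E := energy_nonneg H.pos _ _
  set C₀ : ℝ := (D + 1 : ℕ) * 5 ^ (D + 1) with hC₀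
  have hC₀1 : 1 ≤ C₀ := by
    have h1 : (1 : ℝ) ≤ (D + 1 : ℕ) := by exact_mod_cast Nat.succ_pos D
    have h2 : (1 : ℝ) ≤ 5 ^ (D + 1) := one_le_pow₀ (by norm_num)
    exact one_le_mul_of_one_le_of_one_le h1 h2
  have hnd : (0 : ℝ) < (n : ℝ) ^ (D + 1) := by positivity
  set l : ℝ := (σ : ℝ) - ρ with hl
  have hl1 : 1 ≤ l := by
    have : (ρ : ℝ) + 1 ≤ σ := by exact_mod_cast hρσ
    linarith
  have hl0 : 0 < l := by linarith
  let en : Bond (D + 1) → ℝ := fun e => ω e * grad v e ^ 2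
  have hen : ∀ e, 0 ≤ en e := fun e => mul_nonneg (H.pos e).le (sq_nonneg _)
  let s : ℕ → ℝ := fun k => (((sphere (D + 1) k).filter fun x => 0 < v x).card : ℝ)
  let ee : ℕ → ℝ := fun k => ∑ e ∈ tangential (D + 1) k, en e
  let hs : ℕ → ℝ := fun k => ∑ e ∈ tangential (D + 1) k, h e
  have hs0 : ∀ k, 0 ≤ s k := fun k => Nat.cast_nonneg _
  have hee0 : ∀ k, 0 ≤ ee k := fun k => sum_nonneg fun e _ => hen e
  have hhs0 : ∀ k, 0 ≤ hs k := fun k => sum_nonneg fun e _ => H.h_nonneg e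
  let I : Finset ℕ := Ico ρ σ
  have hI : (I.card : ℝ) = l := by
    simp only [I]
    rw [Nat.card_Ico, Nat.cast_sub hρσ.le]
  have hJ : ∀ J : Finset ℕ, J ⊆ I ∪ I.image (· + 1) → ∀ k ∈ J, k ≤ σ := by
    intro J hJ k hk
    rcases mem_union.1 (hJ hk) with h' | h'
    · exact (mem_Ico.1 h').2.le
    · obtain ⟨j, hj, rfl⟩ := mem_image.1 h'
      have := (mem_Ico.1 hj).2
      change j + 1 ≤ σ
      omega
  have hbox_h : ∑ e ∈ bondsIn (box (D + 1) σ), h e ≤ C₀ * (n : ℝ) ^ (D + 1) :=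
    (sum_le_sum_of_subset_of_nonneg hsub fun e _ _ => H.h_nonneg e).trans
      (H.sum_h.trans (card_bondsIn_le hn))
  have hbox_g : ∑ e ∈ bondsIn (box (D + 1) σ), g e ≤ C₀ * (n : ℝ) ^ (D + 1) :=
    (sum_le_sum_of_subset_of_nonneg hsub fun e _ _ => H.g_nonneg e).trans
      (H.sum_g.trans (card_bondsIn_le hn))
  have hsum0 : ∑ k ∈ I, ∑ e ∈ crossing (D + 1) σ k, g e ≤ C₀ * (n : ℝ) ^ (D + 1) :=
    (sum_crossing_le I g H.g_nonneg).trans hbox_g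
  have hsum1 : ∑ k ∈ I, (s k + s (k + 1)) ≤ 2 * A := by
    refine sum_succ_le s fun J hJ' => ?_
    have e1 : A = ∑ x ∈ box (D + 1) σ, if 0 < v x then 1 else 0 := by
      rw [← card_filter_pos_eq_sum, hAdef, above]
      congr 2
      exact filter_congr fun x _ => trunc_pos.symm
    rw [e1]
    refine le_trans (sum_le_sum fun k hk => ?_) (sum_sum_filter_le (box (D + 1) σ) J rad _
      fun x _ => by positivity)
    simp only [s]
    rw [card_filter_pos_eq_sum]
    refine sum_le_sum_of_subset_of_nonneg (fun x hx => ?_) fun x _ _ => by positivity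
    rw [mem_sphere] at hx
    exact mem_filter.2 ⟨rad_le.1 (hx.le.trans (hJ J hJ' k hk)), hx⟩
  have hsum2 : ∑ k ∈ I, (ee k + ee (k + 1)) ≤ 2 * E :=
    sum_succ_le ee fun J hJ' => sum_tangential_le J (hJ J hJ') en hen
  have hsum3 : ∑ k ∈ I, (hs k + hs (k + 1)) ≤ 2 * (C₀ * (n : ℝ) ^ (D + 1)) :=
    sum_succ_le hs fun J hJ' => (sum_tangential_le J (hJ J hJ') h H.h_nonneg).trans hbox_h
  -- The four averaged quantities are g on crossing bonds and, on the two adjacent spheres, the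
  -- support, the energy and h.
  obtain ⟨G, hGI, hGcard, hG⟩ := exists_good_subset I
    ![fun k => ∑ e ∈ crossing (D + 1) σ k, g e, fun k => s k + s (k + 1),
      fun k => ee k + ee (k + 1), fun k => hs k + hs (k + 1)] (by
    intro j k _
    fin_cases j
    · exact sum_nonneg fun e _ => H.g_nonneg e
    · exact add_nonneg (hs0 _) (hs0 _)
    · exact add_nonneg (hee0 _) (hee0 _)
    · exact add_nonneg (hhs0 _) (hhs0 _))
  rw [hI] at hGcard hG
  set N : ℝ := (n : ℝ) ^ (D + 1) / l with hN
  have hN0 : 0 < N := by positivity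
  set α : ℝ := A / (n : ℝ) ^ (D + 1) with hα
  have hα0 : 0 ≤ α := by positivity
  have hαN : α * N = A / l := by
    rw [hα, hN]
    field_simp
  -- The only use of the smallness assumption `hA`: on a good layer the support is small enough for
  -- the Sobolev inequality without zero order term.
  have hαN1 : 16 * (α * N) ≤ (n : ℝ) ^ D := by
    rw [hαN, ← mul_div_assoc, div_le_iff₀ hl0]
    have h1 : (n : ℝ) * A ≤ lam * l * A := mul_le_mul_of_nonneg_right hlam hA0
    have h2 : (n : ℝ) * (16 * A) ≤ n * ((n : ℝ) ^ D * l) := by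
      have h3 : lam * A * l ≤ (n : ℝ) ^ (D + 1) / 16 * l := mul_le_mul_of_nonneg_right hA hl0.le
      rw [pow_succ] at h3
      linarith
    exact le_of_mul_le_mul_left h2 (by linarith)
  have hNpow : N ^ (2 / (D : ℝ)) ≤ lam * (n : ℝ) ^ 2 := by
    have h1 : N ≤ lam * (n : ℝ) ^ D := by
      rw [hN, div_le_iff₀ hl0, pow_succ]
      have := mul_le_mul_of_nonneg_left hlam (by positivity : (0 : ℝ) ≤ (n : ℝ) ^ D)
      linarith
    have h2D : 2 / (D : ℝ) ≤ 1 := by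
      rw [div_le_one (by linarith)]
      exact hD'
    have h2D0 : 0 ≤ 2 / (D : ℝ) := by positivity
    calc N ^ (2 / (D : ℝ)) ≤ (lam * (n : ℝ) ^ D) ^ (2 / (D : ℝ)) :=
          Real.rpow_le_rpow hN0.le h1 h2D0
      _ = lam ^ (2 / (D : ℝ)) * (n : ℝ) ^ 2 := by
          rw [Real.mul_rpow (by linarith) (by positivity), ← Real.rpow_natCast,
            ← Real.rpow_natCast, ← Real.rpow_mul (by linarith)]
          congr 2
          push_cast
          field_simp
      _ ≤ lam ^ (1 : ℝ) * (n : ℝ) ^ 2 :=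
          mul_le_mul_of_nonneg_right (Real.rpow_le_rpow_of_exponent_le hlam1 h2D) (by positivity)
      _ = _ := by rw [Real.rpow_one]
  -- the layers in `G`
  have hlayer : ∀ k ∈ G, ∑ e ∈ crossing (D + 1) σ k, ω e * (v e.lower * v e.upper) ≤
      64 * (D + 1) * sphereConst D P * (16 * C₀) * (Wp * Wq) * (lam * (n : ℝ) ^ 2) *
        α ^ (2 * δ) * (E / l) := by
    intro k hk
    have hkI := mem_Ico.1 (hGI hk)
    have g0 : ∑ e ∈ crossing (D + 1) σ k, g e ≤ 16 * C₀ * N := by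
      have : (∑ e ∈ crossing (D + 1) σ k, g e) * l ≤
          8 * ∑ i ∈ I, ∑ e ∈ crossing (D + 1) σ i, g e := hG k hk 0
      rw [hN, mul_div_assoc', le_div_iff₀ hl0]
      have := mul_pos (lt_of_lt_of_le one_pos hC₀1) hnd
      linarith
    have g1 : s k + s (k + 1) ≤ 16 * (α * N) := by
      have : (s k + s (k + 1)) * l ≤ 8 * ∑ i ∈ I, (s i + s (i + 1)) := hG k hk 1
      rw [hαN, ← mul_div_assoc, le_div_iff₀ hl0]
      linarith
    have g2 : ee k + ee (k + 1) ≤ 16 * (E / l) := by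
      have : (ee k + ee (k + 1)) * l ≤ 8 * ∑ i ∈ I, (ee i + ee (i + 1)) := hG k hk 2
      rw [← mul_div_assoc, le_div_iff₀ hl0]
      linarith
    have g3 : hs k + hs (k + 1) ≤ 16 * C₀ * N := by
      have : (hs k + hs (k + 1)) * l ≤ 8 * ∑ i ∈ I, (hs i + hs (i + 1)) := hG k hk 3
      rw [hN, mul_div_assoc', le_div_iff₀ hl0]
      linarith
    have hcross := sum_crossing_weight_le hD hP hP1 hQ hδ hδ' H hv0 (hnρ.trans hkI.1) hkI.2 hσ
      (by positivity) g0 (b := 16 * (α * N)) (c := 16 * (E / l))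
      (by rintro j (rfl | rfl); exacts [by linarith [hs0 (j + 1)], by linarith [hs0 k]])
      (by rintro j (rfl | rfl); exacts [by linarith [hee0 (j + 1)], by linarith [hee0 k]])
      (by rintro j (rfl | rfl); exacts [by linarith [hhs0 (j + 1)], by linarith [hhs0 k]]) hαN1
    refine hcross.trans ?_
    have hspC := sphereConst_nonneg (D := D) hP1
    have hWp := H.Wp_nonneg
    have hWq := H.Wq_nonneg
    have hexp : P + 2 * δ + Q = 2 / D := by rw [hδ']; ring
    have h16 := rpow_combine_le hC₀1 hN0 hα0 hδ hexp (by rwa [div_le_one (by linarith)]) hNpow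
    refine (mul_le_mul_of_nonneg_left h16 (by positivity)).trans (le_of_eq ?_)
    ring
  set B := 64 * (D + 1) * sphereConst D P * (16 * C₀) * (Wp * Wq) * (lam * (n : ℝ) ^ 2) *
        α ^ (2 * δ) * (E / l) with hB
  have hcut := card_sq_mul_energy_le H.pos hu K hGI
  have hcut2 : (G.card : ℝ) ^ 2 * energy ω v ρ ≤ G.card * B := by
    refine hcut.trans ((sum_le_sum hlayer).trans (le_of_eq ?_))
    rw [sum_const, nsmul_eq_mul]
  have hGpos : (0 : ℝ) < G.card := by linarith
  have hcut3 : (G.card : ℝ) * energy ω v ρ ≤ B :=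
    le_of_mul_le_mul_left (by linarith) hGpos
  have hEρ : 0 ≤ energy ω v ρ := energy_nonneg H.pos _ _
  -- Since |G| ≥ l/2, one division by |G| gains a factor 1/l; the average energy per layer in B
  -- contributes the other. With lam·n² from the weights and n ≤ lam·l, the total is lam³.
  have hcut4 : l * energy ω v ρ ≤ 2 * B := by
    have := mul_le_mul_of_nonneg_right hGcard hEρ
    linarith
  have hB2 : 2 * B ≤ l * (128 * (D + 1) * sphereConst D P * (16 * C₀) * (Wp * Wq) * lam ^ 3 *
      α ^ (2 * δ) * E) := by
    have hWp := H.Wp_nonneg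
    have hWq := H.Wq_nonneg
    have hspC := sphereConst_nonneg (D := D) hP1
    have hnl : (n : ℝ) ^ 2 / l ≤ lam ^ 2 * l := by
      rw [div_le_iff₀ hl0]
      calc (n : ℝ) ^ 2 ≤ (lam * l) ^ 2 := pow_le_pow_left₀ (by positivity) hlam 2
        _ = _ := by ring
    have e1 : 2 * B = 128 * (D + 1) * sphereConst D P * (16 * C₀) * (Wp * Wq) * lam *
        α ^ (2 * δ) * E * ((n : ℝ) ^ 2 / l) := by
      rw [hB]
      field_simp
      ring
    rw [e1]
    refine (mul_le_mul_of_nonneg_left hnl (by positivity)).trans (le_of_eq ?_)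
    ring
  exact le_of_mul_le_mul_left (hcut4.trans hB2) hl0

end RandomConductance

end

noncomputable section

namespace RandomConductance

open Finset

/-! ### The iteration -/

/-- Raising the level composes the truncation with a 1-Lipschitz map. -/
theorem energy_mono {d : ℕ} {ω : Bond d → ℝ} (hω : ∀ e, 0 < ω e) (u : Vertex d → ℝ) {K K' : ℝ}
    (hK : K ≤ K') (m : ℕ) : energy ω (trunc u K') m ≤ energy ω (trunc u K) m := by
  refine sum_le_sum fun e _ => mul_le_mul_of_nonneg_left ?_ (hω e).le
  have h : ∀ x, trunc u K' x = max (trunc u K x - (K' - K)) 0 := by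
    intro x
    simp only [trunc]
    rcases le_total (u x - K) 0 with h | h
    · rw [max_eq_right h, max_eq_right, max_eq_right] <;> linarith
    · rw [max_eq_left h]
      congr 1
      ring
  rw [sq_le_sq, grad, grad, h, h]
  refine (abs_max_sub_max_le_abs _ _ _).trans (le_of_eq ?_)
  congr 1
  ring

/-- Chebyshev: (u − K)₊ exceeds K' − K wherever u > K'. -/
theorem mul_above_le {d : ℕ} (u : Vertex d → ℝ) {K K' : ℝ} {m m' : ℕ} (hm : m' ≤ m) :
    (K' - K) * above u K' m' ≤ ∑ x ∈ box d m, trunc u K x := by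
  have h1 : ((box d m').filter fun x => K' < u x).card • (K' - K) ≤
      ∑ x ∈ box d m' with K' < u x, trunc u K x :=
    card_nsmul_le_sum _ _ _ fun x hx =>
      le_max_of_le_left (by linarith [(mem_filter.1 hx).2])
  rw [nsmul_eq_mul, mul_comm] at h1
  refine h1.trans (sum_le_sum_of_subset_of_nonneg ?_ fun x _ _ => trunc_nonneg _ _ _)
  exact (filter_subset _ _).trans (box_mono hm)

/-- Provides the initial density, up to powers of lam and Λ. The factor 4096 = 16³ comes from the
cube of 16·lam; the bound 1/(512·2^d) serves the two other smallness conditions of the iteration. -/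
theorem exists_small_const {δ C θ : ℝ} (hδ : 0 < δ) (hC : 1 ≤ C) (hθ : 0 < θ) (hθ1 : θ ≤ 1) (d : ℕ) :
    ∃ c : ℝ, 0 < c ∧ c ≤ 1 / (512 * 2 ^ d) ∧ C * 4096 * c ^ (2 * δ) ≤ θ ^ 2 := by
  have hb : 0 < θ ^ 2 / (C * 4096) := by positivity
  have hb1 : θ ^ 2 / (C * 4096) ≤ 1 := by
    rw [div_le_one (by positivity)]
    nlinarith
  set b := (θ ^ 2 / (C * 4096)) ^ (1 / (2 * δ)) with hbdef
  have hbpos : 0 < b := Real.rpow_pos_of_pos hb _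
  have hble : b ≤ 1 := Real.rpow_le_one hb.le hb1 (by positivity)
  have hs : (0 : ℝ) < 1 / (512 * 2 ^ d) := by positivity
  have hs1 : (1 : ℝ) / (512 * 2 ^ d) ≤ 1 := by
    rw [div_le_one (by positivity)]
    have : (1 : ℝ) ≤ 2 ^ d := one_le_pow₀ (by norm_num)
    linarith
  refine ⟨b * (1 / (512 * 2 ^ d)), by positivity, mul_le_of_le_one_left hs.le hble, ?_⟩
  have h1 : (b * (1 / (512 * 2 ^ d))) ^ (2 * δ) ≤ b ^ (2 * δ) :=
    Real.rpow_le_rpow (by positivity) (mul_le_of_le_one_right hbpos.le hs1) (by positivity)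
  have h2 : b ^ (2 * δ) = θ ^ 2 / (C * 4096) := by
    rw [hbdef, ← Real.rpow_mul hb.le, one_div_mul_cancel (by positivity), Real.rpow_one]
  rw [h2] at h1
  calc C * 4096 * (b * (1 / (512 * 2 ^ d))) ^ (2 * δ) ≤ C * 4096 * (θ ^ 2 / (C * 4096)) :=
        mul_le_mul_of_nonneg_left h1 (by positivity)
    _ = θ ^ 2 := by field_simp

/-- The constant of `energy_step`. -/
def stepConst (D : ℕ) (P : ℝ) : ℝ :=
  128 * (D + 1) * sphereConst D P * (16 * ((D + 1 : ℕ) * 5 ^ (D + 1)))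

theorem one_le_volConst (D : ℕ) : (1 : ℝ) ≤ (D + 1 : ℕ) * 5 ^ (D + 1) := by
  have h1 : (1 : ℝ) ≤ (D + 1 : ℕ) := by exact_mod_cast Nat.succ_pos D
  have h2 : (1 : ℝ) ≤ 5 ^ (D + 1) := one_le_pow₀ (by norm_num)
  exact one_le_mul_of_one_le_of_one_le h1 h2

theorem one_le_stepConst {D : ℕ} (hD : 2 ≤ D) {P : ℝ} (hP1 : P < 1) : 1 ≤ stepConst D P := by
  have hD' : (2 : ℝ) ≤ D := by exact_mod_cast hD
  have h1 : (1 : ℝ) ≤ sphereConst D P := by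
    have h2 : 0 < 2 / (1 - P) := div_pos two_pos (by linarith)
    have h3 : (1 : ℝ) ≤ 4 * D * (1 + 2 / (1 - P)) := by nlinarith
    rw [sphereConst]
    have h4 : (1 : ℝ) ≤ (4 * D * (1 + 2 / (1 - P))) ^ 2 := one_le_pow₀ h3
    nlinarith
  have h2 := one_le_volConst D
  rw [stepConst]
  have h3 : 1 ≤ 128 * ((D : ℝ) + 1) * sphereConst D P := by nlinarith
  nlinarith

/-- Up to a constant, the gap between consecutive radii is L/2^j in spite of the rounding, as long
as l/2^j has not reached zero. The hypothesis on L permits l = L/2 rounded down. -/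
theorem half_radius_le {n l L j : ℕ} {lam : ℝ} (hlam0 : 0 ≤ lam) (hlam : (n : ℝ) ≤ lam * L)
    (hl : L ≤ 2 * l + 1) (hj : 1 ≤ l / 2 ^ j) :
    (n : ℝ) ≤ (16 * 2 ^ j * lam) * (((l / 2 ^ j : ℕ) : ℝ) - (l / 2 ^ (j + 1) : ℕ)) := by
  have h1 : l / 2 ^ (j + 1) = l / 2 ^ j / 2 := by rw [pow_succ, Nat.div_div_eq_div_mul]
  have h2 : l < 2 ^ j * (l / 2 ^ j + 1) := Nat.lt_mul_div_succ l (by positivity)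
  set a := l / 2 ^ j with ha
  have h3 : a ≤ 2 * (a - a / 2) := by omega
  have h4 : L ≤ 16 * 2 ^ j * (a - a / 2) := by
    calc L ≤ 2 * (2 ^ j * (a + 1)) := by omega
      _ ≤ 2 * (2 ^ j * (2 * a)) := by gcongr; omega
      _ ≤ 2 * (2 ^ j * (2 * (2 * (a - a / 2)))) := by gcongr
      _ = 8 * (2 ^ j * (a - a / 2)) := by ring
      _ ≤ 16 * (2 ^ j * (a - a / 2)) := Nat.mul_le_mul_right _ (by norm_num)
      _ = _ := by ring
  have h5 : (L : ℝ) ≤ 16 * 2 ^ j * ((a : ℝ) - (a / 2 : ℕ)) := by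
    rw [← Nat.cast_sub (Nat.div_le_self a 2)]
    exact_mod_cast h4
  rw [h1]
  calc (n : ℝ) ≤ lam * L := hlam
    _ ≤ lam * (16 * 2 ^ j * ((a : ℝ) - (a / 2 : ℕ))) := mul_le_mul_of_nonneg_left h5 hlam0
    _ = _ := by ring

/-- The De Giorgi iteration. The parameters `ν`, `xs`, `Ys` are the decay rate and the initial sizes of
the support and the energy. -/
theorem le_two_mul_of_iteration {D n : ℕ} (hD : 2 ≤ D) (hn : 1 ≤ n) {P Q δ : ℝ} (hP : 0 ≤ P)
    (hP1 : P < 1) (hQ : 0 ≤ Q) (hδ : 0 < δ) (hδ' : δ = 1 / D - P / 2 - Q / 2)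
    {ω : Bond (D + 1) → ℝ} {Wp Wq : ℝ} {g h : Bond (D + 1) → ℝ} (H : Majorized ω n P Q Wp Wq g h)
    {u : Vertex (D + 1) → ℝ} (hu : IsSolution ω u) {K : ℝ} (hK : 0 < K) {ρ l L : ℕ} (hnρ : n ≤ ρ)
    (hl : L ≤ 2 * l + 1) (hσ : ρ + l ≤ 2 * n) {lam : ℝ} (hlam1 : 1 ≤ lam)
    (hlam : (n : ℝ) ≤ lam * L) {ν xs Ys : ℝ} (hν : 0 < ν) (hν8 : ν ^ δ ≤ 1 / 8)
    (hνd : ν ≤ 1 / 2 ^ (D + 1)) (hxs : 0 < xs) (hxs1 : 256 * lam * xs ≤ 1)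
    (hxs2 : xs * (2 * lam) ^ (D + 1) < 1)
    (hxs3 : stepConst D P * (Wp * Wq) * (16 * lam) ^ 3 * xs ^ (2 * δ) ≤ (ν / 2) ^ 2)
    (hYs : 4 * ((D + 1 : ℕ) * 5 ^ (D + 1)) * Ys ≤ (xs * K * (ν / 2)) ^ 2)
    (hx0 : above u K (ρ + l) ≤ xs * (n : ℝ) ^ (D + 1))
    (hY0 : (n : ℝ) ^ 2 * Wq * energy ω (trunc u K) (ρ + l) ≤ Ys * (n : ℝ) ^ (D + 1))
    {x : Vertex (D + 1)} (hx : x ∈ box (D + 1) ρ) : u x ≤ 2 * K := by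
  have hn' : (1 : ℝ) ≤ n := by exact_mod_cast hn
  have hnd : (0 : ℝ) < (n : ℝ) ^ (D + 1) := by positivity
  have hWp := H.Wp_nonneg
  have hWq := H.Wq_nonneg
  have hQ1 : Q ≤ 1 := by
    have : 1 / (D : ℝ) ≤ 1 / 2 := one_div_le_one_div_of_le (by norm_num) (by exact_mod_cast hD)
    linarith
  have h2D : (2 : ℝ) ≤ 2 ^ (D + 1) := by
    calc (2 : ℝ) = 2 ^ 1 := (pow_one _).symm
      _ ≤ 2 ^ (D + 1) := pow_le_pow_right₀ (by norm_num) (by omega)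
  have hν2 : ν ≤ 1 / 2 := hνd.trans (one_div_le_one_div_of_le two_pos h2D)
  set C₀ : ℝ := (D + 1 : ℕ) * 5 ^ (D + 1) with hC₀
  -- Radii decrease to ρ while the levels increase from K towards 2K, in steps K/2^{j+1}.
  let r : ℕ → ℕ := fun j => ρ + l / 2 ^ j
  let κ : ℕ → ℝ := fun j => K * (2 - (1 / 2) ^ j)
  have hr : ∀ j, r j ≤ 2 * n := fun j => by
    have := Nat.div_le_self l (2 ^ j)
    simp only [r]
    omega
  have hrn : ∀ j, n ≤ r j := fun j => hnρ.trans (Nat.le_add_right _ _)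
  have hrmono : ∀ j, r (j + 1) ≤ r j := fun j =>
    Nat.add_le_add_left (Nat.div_le_div_left (Nat.pow_le_pow_right (by norm_num) (Nat.le_succ j))
      (by positivity)) _
  have hκstep : ∀ j, κ (j + 1) - κ j = K * (1 / 2) ^ (j + 1) := fun j => by
    simp only [κ]
    rw [pow_succ]
    ring
  have hκmono : ∀ j, κ j ≤ κ (j + 1) := fun j => by
    have := hκstep j
    have h2 : 0 < K * (1 / 2) ^ (j + 1) := by positivity
    linarith
  -- The root of the energy decays like (ν/2)^j; the additional 2^{-j} pays for the shrinking level
  -- steps and leaves ν^j for the support. The proviso makes the radii used strictly decreasing.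
  have key : ∀ j, (∀ i < j, 1 ≤ l / 2 ^ i) →
      above u (κ j) (r j) ≤ xs * ν ^ j * (n : ℝ) ^ (D + 1) ∧
      (n : ℝ) ^ 2 * Wq * energy ω (trunc u (κ j)) (r j) ≤
        Ys * ((ν / 2) ^ 2) ^ j * (n : ℝ) ^ (D + 1) := by
    intro j
    induction j with
    | zero =>
      intro _
      have e1 : κ 0 = K := by simp only [κ, pow_zero]; ring
      have e2 : r 0 = ρ + l := by simp [r]
      rw [e1, e2, pow_zero, mul_one, pow_zero, mul_one]
      exact ⟨hx0, hY0⟩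
    | succ j ih =>
      intro hj
      obtain ⟨ihx, ihY⟩ := ih fun i hi => hj i (hi.trans (Nat.lt_succ_self j))
      have hνj : 0 < ν ^ j := pow_pos hν j
      have hνj1 : (2 * ν) ^ j ≤ 1 := pow_le_one₀ (by positivity) (by linarith)
      have hA0 := above_nonneg u (κ j) (r j)
      have hsmall : (16 * 2 ^ j * lam) * above u (κ j) (r j) ≤ (n : ℝ) ^ (D + 1) / 16 := by
        calc (16 * 2 ^ j * lam) * above u (κ j) (r j)
            ≤ (16 * 2 ^ j * lam) * (xs * ν ^ j * (n : ℝ) ^ (D + 1)) :=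
              mul_le_mul_of_nonneg_left ihx (by positivity)
          _ = (256 * lam * xs) * (2 * ν) ^ j * ((n : ℝ) ^ (D + 1) / 16) := by
              rw [mul_pow]
              ring
          _ ≤ 1 * 1 * ((n : ℝ) ^ (D + 1) / 16) := by gcongr
          _ = _ := by ring
      have h16 : 1 ≤ 16 * 2 ^ j * lam := by
        have : (1 : ℝ) ≤ 2 ^ j := one_le_pow₀ (by norm_num)
        nlinarith
      constructor
      · have hAn : above u (κ j) (r j) ≤ (n : ℝ) ^ (D + 1) := by
          have := le_mul_of_one_le_left hA0 h16
          linarith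
        have h1 := mul_above_le u (K := κ j) (K' := κ (j + 1)) (hrmono j)
        have h2 := sum_trunc_sq_le (by omega : 2 ≤ D + 1) hn H hQ hQ1 u (κ j) (hrn j) (hr j) hAn
        rw [hκstep] at h1
        have hA1 := above_nonneg u (κ (j + 1)) (r (j + 1))
        have h3 : (K * (1 / 2) ^ (j + 1) * above u (κ (j + 1)) (r (j + 1))) ^ 2 ≤
            (K * (1 / 2) ^ (j + 1) * (xs * ν ^ (j + 1) * (n : ℝ) ^ (D + 1))) ^ 2 := by
          refine (pow_le_pow_left₀ (by positivity) h1 2).trans (h2.trans ?_)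
          calc 4 * C₀ * (n : ℝ) ^ 2 * (Wq * energy ω (trunc u (κ j)) (r j) * (n : ℝ) ^ (D + 1))
              = 4 * C₀ * ((n : ℝ) ^ 2 * Wq * energy ω (trunc u (κ j)) (r j)) *
                (n : ℝ) ^ (D + 1) := by ring
            _ ≤ 4 * C₀ * (Ys * ((ν / 2) ^ 2) ^ j * (n : ℝ) ^ (D + 1)) * (n : ℝ) ^ (D + 1) := by
                gcongr
            _ = (4 * C₀ * Ys) * (((ν / 2) ^ 2) ^ j * ((n : ℝ) ^ (D + 1)) ^ 2) := by ring
            _ ≤ (xs * K * (ν / 2)) ^ 2 * (((ν / 2) ^ 2) ^ j * ((n : ℝ) ^ (D + 1)) ^ 2) :=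
                mul_le_mul_of_nonneg_right hYs (by positivity)
            _ = _ := by
                rw [div_eq_mul_one_div ν 2, pow_succ ν, pow_succ (1 / 2 : ℝ)]
                generalize (n : ℝ) ^ (D + 1) = w
                rw [← pow_mul, mul_comm 2 j, pow_mul, mul_pow ν]
                ring
        have h4 := le_of_sq_le_sq h3 (by positivity)
        exact le_of_mul_le_mul_left h4 (by positivity)
      · have hstep := energy_step hD hn hP hP1 hQ hδ hδ' H hu (κ j) (hrn (j + 1))
          (σ := r j) (by
            have h1 : l / 2 ^ (j + 1) = l / 2 ^ j / 2 := by rw [pow_succ, Nat.div_div_eq_div_mul]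
            have h2 := hj j (Nat.lt_succ_self j)
            simp only [r]
            omega) (hr j) h16 (by
            have := half_radius_le (by linarith) hlam hl (hj j (Nat.lt_succ_self j))
            simp only [r]
            push_cast at this ⊢
            linarith) hsmall
        have hE0 := energy_nonneg H.pos (trunc u (κ j)) (r j)
        have hS := one_le_stepConst hD hP1
        have hα : (above u (κ j) (r j) / (n : ℝ) ^ (D + 1)) ^ (2 * δ) ≤
            xs ^ (2 * δ) * ((1 / 8) ^ 2) ^ j := by
          have h1 : above u (κ j) (r j) / (n : ℝ) ^ (D + 1) ≤ xs * ν ^ j := by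
            rw [div_le_iff₀ hnd]
            exact ihx
          refine (Real.rpow_le_rpow (by positivity) h1 (by positivity)).trans ?_
          rw [Real.mul_rpow hxs.le hνj.le]
          refine mul_le_mul_of_nonneg_left ?_ (by positivity)
          have h2 : (ν ^ j) ^ (2 * δ) = ((ν ^ δ) ^ 2) ^ j := by
            rw [← Real.rpow_natCast, ← Real.rpow_natCast, ← Real.rpow_natCast, ← Real.rpow_mul hν.le,
              ← Real.rpow_mul hν.le, ← Real.rpow_mul hν.le]
            congr 1
            push_cast
            ring
          rw [h2]
          gcongr
        -- The cut-off constants grow like 8^j, while ν^δ ≤ 1/8 makes the density factor decay like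
        -- 64^{-j}.
        have h83 : ((2 : ℝ) ^ j) ^ 3 * ((1 / 8) ^ 2) ^ j ≤ 1 := by
          have : ((2 : ℝ) ^ j) ^ 3 * ((1 / 8) ^ 2) ^ j = (1 / 8) ^ j := by
            rw [← pow_mul, mul_comm j 3, pow_mul, ← mul_pow]
            norm_num
          rw [this]
          exact pow_le_one₀ (by norm_num) (by norm_num)
        have hx2 : 0 ≤ xs ^ (2 * δ) := by positivity
        have hfac : stepConst D P * (Wp * Wq) * (16 * 2 ^ j * lam) ^ 3 *
            (above u (κ j) (r j) / (n : ℝ) ^ (D + 1)) ^ (2 * δ) ≤ (ν / 2) ^ 2 := by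
          have hs0 : 0 ≤ stepConst D P * (Wp * Wq) := by positivity
          calc stepConst D P * (Wp * Wq) * (16 * 2 ^ j * lam) ^ 3 *
                (above u (κ j) (r j) / (n : ℝ) ^ (D + 1)) ^ (2 * δ)
              ≤ stepConst D P * (Wp * Wq) * (16 * 2 ^ j * lam) ^ 3 *
                (xs ^ (2 * δ) * ((1 / 8) ^ 2) ^ j) := by gcongr
            _ = (stepConst D P * (Wp * Wq) * (16 * lam) ^ 3 * xs ^ (2 * δ)) *
                (((2 : ℝ) ^ j) ^ 3 * ((1 / 8) ^ 2) ^ j) := by ring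
            _ ≤ (stepConst D P * (Wp * Wq) * (16 * lam) ^ 3 * xs ^ (2 * δ)) * 1 :=
                mul_le_mul_of_nonneg_left h83 (by positivity)
            _ ≤ _ := by rw [mul_one]; exact hxs3
        calc (n : ℝ) ^ 2 * Wq * energy ω (trunc u (κ (j + 1))) (r (j + 1))
            ≤ (n : ℝ) ^ 2 * Wq * energy ω (trunc u (κ j)) (r (j + 1)) :=
              mul_le_mul_of_nonneg_left (energy_mono H.pos u (hκmono j) _) (by positivity)
          _ ≤ (n : ℝ) ^ 2 * Wq * ((ν / 2) ^ 2 * energy ω (trunc u (κ j)) (r j)) := by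
              refine mul_le_mul_of_nonneg_left (hstep.trans ?_) (by positivity)
              exact mul_le_mul_of_nonneg_right hfac hE0
          _ = (ν / 2) ^ 2 * ((n : ℝ) ^ 2 * Wq * energy ω (trunc u (κ j)) (r j)) := by ring
          _ ≤ (ν / 2) ^ 2 * (Ys * ((ν / 2) ^ 2) ^ j * (n : ℝ) ^ (D + 1)) :=
              mul_le_mul_of_nonneg_left ihY (by positivity)
          _ = _ := by
              rw [pow_succ _ j]
              ring
  have hex : ∃ j, l / 2 ^ j = 0 := ⟨l, Nat.div_eq_of_lt Nat.lt_two_pow_self⟩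
  classical
  set J := Nat.find hex with hJ
  have hJ0 : l / 2 ^ J = 0 := Nat.find_spec hex
  have hkey := (key J fun i hi => Nat.one_le_iff_ne_zero.2 (Nat.find_min hex hi)).1
  have hrJ : r J = ρ := by simp only [r, hJ0, add_zero]
  have hlJ : l < 2 ^ J := by
    rcases Nat.div_eq_zero_iff.1 hJ0 with h0 | h0
    · exact absurd h0 (by positivity)
    · exact h0
  have hLJ : (L : ℝ) ≤ 2 * 2 ^ J := by
    have : L ≤ 2 * 2 ^ J := by omega
    exact_mod_cast this
  have hnJ : (n : ℝ) ≤ 2 * lam * 2 ^ J := by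
    have := mul_le_mul_of_nonneg_left hLJ (by linarith : 0 ≤ lam)
    linarith
  -- At the last step n is at most 2·lam·2^J, so ν ≤ 2^{-d} makes the bound on the number of points
  -- less than one: no point is left.
  have hlt : xs * ν ^ J * (n : ℝ) ^ (D + 1) < 1 := by
    calc xs * ν ^ J * (n : ℝ) ^ (D + 1)
        ≤ xs * (1 / 2 ^ (D + 1)) ^ J * (2 * lam * 2 ^ J) ^ (D + 1) := by gcongr
      _ = xs * (2 * lam) ^ (D + 1) := by
          rw [mul_pow (2 * lam), ← pow_mul, one_div, inv_pow, ← pow_mul, mul_comm J]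
          field_simp
      _ < 1 := hxs2
  by_contra! hcon
  have hmem : x ∈ (box (D + 1) (r J)).filter fun x => κ J < u x := by
    rw [hrJ]
    refine mem_filter.2 ⟨hx, lt_of_le_of_lt ?_ hcon⟩
    simp only [κ]
    have : 0 < K * (1 / 2) ^ J := by positivity
    linarith
  have hpos : 1 ≤ above u (κ J) (r J) := by
    rw [above]
    exact_mod_cast card_pos.2 ⟨x, hmem⟩
  linarith

end RandomConductance

end

/-! ### Choice of the parameters and the one-sided maximum bound -/

noncomputable section

namespace RandomConductance

open Finset

/-- The condition on ν^δ beats the growth of the cut-off constants, and ν ≤ 2^{-d} empties the last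
level set. -/
theorem exists_decay_rate {δ : ℝ} (hδ : 0 < δ) (d : ℕ) :
    ∃ ν : ℝ, 0 < ν ∧ ν ≤ 1 ∧ ν ^ δ ≤ 1 / 8 ∧ ν ≤ 1 / 2 ^ d := by
  refine ⟨(8 : ℝ) ^ (-(1 / δ + d)), by positivity, ?_, ?_, ?_⟩
  · exact Real.rpow_le_one_of_one_le_of_nonpos (by norm_num) (by
      have : 0 ≤ 1 / δ + d := by positivity
      linarith)
  · rw [← Real.rpow_mul (by norm_num)]
    have h1 : -(1 / δ + d) * δ ≤ -1 := by
      have h2 : 1 / δ * δ = 1 := one_div_mul_cancel hδ.ne'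
      have h3 : 0 ≤ d * δ := by positivity
      linarith
    refine (Real.rpow_le_rpow_of_exponent_le (by norm_num) h1).trans (le_of_eq ?_)
    rw [Real.rpow_neg_one]
    norm_num
  · have h1 : -(1 / δ + d) ≤ -(d : ℝ) := by
      have : 0 ≤ 1 / δ := by positivity
      linarith
    refine (Real.rpow_le_rpow_of_exponent_le (by norm_num) h1).trans ?_
    rw [Real.rpow_neg (by norm_num), Real.rpow_natCast, one_div]
    exact inv_anti₀ (by positivity) (pow_le_pow_left₀ (by norm_num) (by norm_num) _)

set_option maxHeartbeats 1000000 in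
-- K is taken so large that the iteration can start with density xs = c/(lam^m Λ^{1/(2δ)}). The
-- initial energy contributes Λ^{1/2}, and dividing by xs contributes Λ^{1/(2δ)}. The dependence on
-- lam must be polynomial for the later interpolation between nearby boxes.
theorem le_of_isSolution {D : ℕ} (hD : 2 ≤ D) {P Q δ : ℝ} (hP : 0 ≤ P) (hP1 : P < 1) (hQ : 0 ≤ Q)
    (hδ : 0 < δ) (hδ' : δ = 1 / D - P / 2 - Q / 2) :
    ∃ C : ℝ, 1 ≤ C ∧ ∃ m : ℕ, ∀ (n : ℕ) (_ : 1 ≤ n) (ω g h : Bond (D + 1) → ℝ) (Wp Wq : ℝ)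
      (_ : Majorized ω n P Q Wp Wq g h) (_ : 1 ≤ Wp * Wq) (u : Vertex (D + 1) → ℝ)
      (_ : IsSolution ω u) (ρ L : ℕ) (_ : n ≤ ρ) (_ : 1 ≤ L) (_ : ρ + L ≤ 2 * n)
      (lam : ℝ) (_ : 1 ≤ lam) (_ : (n : ℝ) ≤ lam * L),
      ∀ x ∈ box (D + 1) ρ, u x ≤ C * lam ^ m * (Wp * Wq) ^ (1 / 2 + 1 / (2 * δ)) *
        ((∑ x ∈ box (D + 1) (ρ + L), |u x| ^ (2 / (1 - P))) / (n : ℝ) ^ (D + 1)) ^ ((1 - P) / 2) := by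
  obtain ⟨ν, hν, hν1, hν8, hνd⟩ := exists_decay_rate hδ (D + 1)
  have hθ : 0 < ν / 2 := by positivity
  obtain ⟨c, hc, hcle, hc2⟩ := exists_small_const hδ (one_le_stepConst hD hP1) hθ (by linarith) (D + 1)
  set C₀ : ℝ := (D + 1 : ℕ) * 5 ^ (D + 1) with hC₀
  have hC₀1 : 1 ≤ C₀ := one_le_volConst D
  have h2D : (1 : ℝ) ≤ 2 ^ (D + 1) := one_le_pow₀ (by norm_num)
  have hc512 : c * (512 * 2 ^ (D + 1)) ≤ 1 := by
    rwa [← le_div_iff₀ (by positivity)]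
  have hc1 : c * 512 ≤ 1 := by
    have := mul_le_mul_of_nonneg_left h2D (by positivity : 0 ≤ c * 512)
    linarith
  -- Large enough that xs·lam^{D+1} ≤ c and that xs^{2δ} absorbs the factor lam³.
  set m := D + 1 + ⌈3 / (2 * δ)⌉₊ with hm
  have hmδ : 3 ≤ (m : ℝ) * (2 * δ) := by
    have h1 : 3 / (2 * δ) ≤ (m : ℝ) := by
      refine (Nat.le_ceil _).trans ?_
      rw [hm]
      exact_mod_cast Nat.le_add_left _ _
    rwa [div_le_iff₀ (by positivity)] at h1
  refine ⟨8 * C₀ / (c * (ν / 2)), ?_, m + 1, ?_⟩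
  · rw [one_le_div (by positivity)]
    have : c * (ν / 2) ≤ 1 * 1 := mul_le_mul (by linarith) (by linarith) hθ.le zero_le_one
    linarith
  intro n hn ω g h Wp Wq H hΛ u hu ρ L hnρ hL hρL lam hlam1 hlam x hx
  set Λ := Wp * Wq with hΛdef
  have hWq := H.Wq_nonneg
  have hn' : (1 : ℝ) ≤ n := by exact_mod_cast hn
  have hnd : (0 : ℝ) < (n : ℝ) ^ (D + 1) := by positivity
  have hP1' : 0 < 1 - P := by linarith
  set t : ℝ := 2 / (1 - P) with ht
  have ht1 : 1 ≤ t := by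
    rw [ht, one_le_div hP1']
    linarith
  set U := ∑ x ∈ box (D + 1) (ρ + L), |u x| ^ t with hU
  have hU0 : 0 ≤ U := sum_nonneg fun x _ => Real.rpow_nonneg (abs_nonneg _) _
  have hV0 : 0 ≤ U / (n : ℝ) ^ (D + 1) := by positivity
  set N := (U / (n : ℝ) ^ (D + 1)) ^ ((1 - P) / 2) with hN
  have hN0 : 0 ≤ N := Real.rpow_nonneg hV0 _
  have hN2 : N ^ 2 = (U / (n : ℝ) ^ (D + 1)) ^ (1 - P) := by
    rw [hN, ← Real.rpow_natCast, ← Real.rpow_mul hV0]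
    congr 1
    push_cast
    ring
  have hNt : N ^ t = U / (n : ℝ) ^ (D + 1) := by
    rw [hN, ← Real.rpow_mul hV0, ht]
    have : (1 - P) / 2 * (2 / (1 - P)) = 1 := by field_simp
    rw [this, Real.rpow_one]
  have hΛ0 : 0 < Λ := by linarith
  have hlam0 : 0 < lam := by linarith
  -- If the norm is zero then u vanishes on the box, and the choice of K below would give K = 0.
  rcases hN0.eq_or_lt with hN00 | hNpos
  · have hUz : U = 0 := by
      rw [← hN00, Real.zero_rpow (by linarith)] at hNt
      have := (div_eq_iff hnd.ne').1 hNt.symm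
      simpa using this
    have hxz := (sum_eq_zero_iff_of_nonneg fun x _ => Real.rpow_nonneg (abs_nonneg (u x)) t).1
      (hU.symm.trans hUz) x (box_mono (Nat.le_add_right ρ L) hx)
    have : u x = 0 := by
      rw [Real.rpow_eq_zero (abs_nonneg _) (by linarith)] at hxz
      exact abs_eq_zero.1 hxz
    rw [this, ← hN00, mul_zero]
  set M := lam ^ m * Λ ^ (1 / (2 * δ)) with hM
  have hΛδ : 1 ≤ Λ ^ (1 / (2 * δ)) := Real.one_le_rpow hΛ (by positivity)
  have hlamm : ∀ i ≤ m, lam ^ i ≤ M := fun i hi => by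
    have h1 : lam ^ i ≤ lam ^ m := pow_le_pow_right₀ hlam1 hi
    have h2 : 0 ≤ lam ^ m := by positivity
    exact h1.trans (le_mul_of_one_le_right h2 hΛδ)
  have hMpos : 0 < M := by positivity
  set xs := c / M with hxs
  have hxs0 : 0 < xs := by positivity
  have hxsM : xs * M = c := div_mul_cancel₀ _ hMpos.ne'
  have hsqΛ : (Λ ^ (1 / 2 : ℝ)) ^ 2 = Λ := by
    rw [← Real.sqrt_eq_rpow, Real.sq_sqrt hΛ0.le]
  have hΛh : 1 ≤ Λ ^ (1 / 2 : ℝ) := Real.one_le_rpow hΛ (by norm_num)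
  -- Chosen so that the condition linking the initial energy Ys to xs·K·(ν/2) = a holds with
  -- equality.
  set a := 4 * C₀ * lam * Λ ^ (1 / 2 : ℝ) * N with ha
  have haN : N ≤ a := by
    have h1 : 1 ≤ 4 * C₀ * lam := one_le_mul_of_one_le_of_one_le (by linarith) hlam1
    have h2 : 1 ≤ 4 * C₀ * lam * Λ ^ (1 / 2 : ℝ) := one_le_mul_of_one_le_of_one_le h1 hΛh
    exact le_mul_of_one_le_left hN0 h2
  have ha0 : 0 < a := by linarith
  set K := a / (xs * (ν / 2)) with hKdef
  have hK0 : 0 < K := by positivity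
  have hKmul : xs * K * (ν / 2) = a := by
    rw [hKdef]
    field_simp
  have hxs1 : xs ≤ 1 := by
    have := hlamm 0 (Nat.zero_le m)
    rw [pow_zero] at this
    rw [hxs, div_le_one hMpos]
    linarith
  have hNK : N / K ≤ xs := by
    rw [div_le_iff₀ hK0]
    have : xs * K * (ν / 2) ≤ xs * K * 1 := mul_le_mul_of_nonneg_left (by linarith) (by positivity)
    linarith
  -- The outer half of the gap is used for the initial linear cut-off, the inner half for the
  -- iteration.
  have hres := le_two_mul_of_iteration hD hn hP hP1 hQ hδ hδ' H hu hK0 (l := L / 2) (L := L) hnρ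
    (by omega) (by omega) hlam1 hlam hν hν8 hνd hxs0 (Ys := 4 * lam ^ 2 * C₀ * Λ * N ^ 2)
    ?_ ?_ ?_ ?_ ?_ ?_ hx
  · refine hres.trans (le_of_eq ?_)
    rw [hKdef, ha, hxs, hM, Real.rpow_add hΛ0]
    field_simp
    ring
  · have h1 : xs * lam ≤ xs * M := mul_le_mul_of_nonneg_left (by simpa using hlamm 1 (by omega)) hxs0.le
    linarith
  · have h1 : xs * lam ^ (D + 1) ≤ xs * M :=
      mul_le_mul_of_nonneg_left (hlamm (D + 1) (by omega)) hxs0.le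
    rw [hxsM] at h1
    rw [mul_pow]
    have h2 : 2 ^ (D + 1) * (xs * lam ^ (D + 1)) ≤ 2 ^ (D + 1) * c :=
      mul_le_mul_of_nonneg_left h1 (by positivity)
    linarith
  · have h1 : M ^ (2 * δ) = lam ^ ((m : ℝ) * (2 * δ)) * Λ := by
      rw [hM, Real.mul_rpow (by positivity) (by positivity), ← Real.rpow_natCast,
        ← Real.rpow_mul hlam0.le, ← Real.rpow_mul hΛ0.le, one_div_mul_cancel (by positivity),
        Real.rpow_one]
    have h2 : lam ^ 3 ≤ lam ^ ((m : ℝ) * (2 * δ)) := by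
      rw [← Real.rpow_natCast]
      exact Real.rpow_le_rpow_of_exponent_le hlam1 (by exact_mod_cast hmδ)
    have h3 : xs ^ (2 * δ) = c ^ (2 * δ) / (lam ^ ((m : ℝ) * (2 * δ)) * Λ) := by
      rw [hxs, Real.div_rpow hc.le hMpos.le, h1]
    have hS := one_le_stepConst hD hP1
    have hpow : 0 < lam ^ ((m : ℝ) * (2 * δ)) := by positivity
    rw [h3]
    calc stepConst D P * Λ * (16 * lam) ^ 3 * (c ^ (2 * δ) / (lam ^ ((m : ℝ) * (2 * δ)) * Λ))
        = (stepConst D P * 4096 * c ^ (2 * δ)) * (lam ^ 3 / lam ^ ((m : ℝ) * (2 * δ))) := by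
          field_simp
          ring
      _ ≤ (stepConst D P * 4096 * c ^ (2 * δ)) * 1 := by
          refine mul_le_mul_of_nonneg_left ?_ (by positivity)
          rwa [div_le_one hpow]
      _ ≤ _ := by rw [mul_one]; exact hc2
  · rw [hKmul, ha, mul_pow, mul_pow _ (Λ ^ (1 / 2 : ℝ)), hsqΛ]
    apply le_of_eq
    ring
  · have h1 : above u K (ρ + L / 2) * K ^ t ≤ U := by
      have h2 : ((box (D + 1) (ρ + L / 2)).filter fun x => K < u x).card • K ^ t ≤
          ∑ x ∈ box (D + 1) (ρ + L / 2) with K < u x, |u x| ^ t :=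
        card_nsmul_le_sum _ _ _ fun x hx => Real.rpow_le_rpow hK0.le
          ((mem_filter.1 hx).2.le.trans (le_abs_self _)) (by linarith)
      rw [nsmul_eq_mul] at h2
      refine h2.trans (sum_le_sum_of_subset_of_nonneg ?_ fun x _ _ =>
        Real.rpow_nonneg (abs_nonneg _) _)
      exact (filter_subset _ _).trans (box_mono (by omega))
    have hKt : 0 < K ^ t := Real.rpow_pos_of_pos hK0 _
    -- The initial density from Chebyshev; as N/K ≤ 1 and t ≥ 1, the power t may be dropped.
    have h2 : (N / K) ^ t ≤ xs := by
      have h0 : 0 < N / K := by positivity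
      calc (N / K) ^ t ≤ (N / K) ^ (1 : ℝ) :=
            Real.rpow_le_rpow_of_exponent_ge h0 (hNK.trans hxs1) ht1
        _ ≤ xs := by rw [Real.rpow_one]; exact hNK
    rw [Real.div_rpow hN0 hK0.le, hNt, div_le_iff₀ hKt, div_le_iff₀ hnd] at h2
    refine le_of_mul_le_mul_right (h1.trans (h2.trans (le_of_eq ?_))) hKt
    ring
  · have hcut := energy_le_of_cutoff hn H hP hP1 hu hK0.le (ρ := ρ + L / 2) (σ := ρ + L)
      (by omega) hρL
    rw [← ht, ← hU, ← hN2, ← hC₀] at hcut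
    have hE := energy_nonneg H.pos (trunc u K) (ρ + L / 2)
    set E := energy ω (trunc u K) (ρ + L / 2) with hEdef
    have hw : (((ρ + L : ℕ) : ℝ) - (ρ + L / 2 : ℕ)) = (L : ℝ) - (L / 2 : ℕ) := by
      push_cast
      ring
    rw [hw] at hcut
    set w := (L : ℝ) - (L / 2 : ℕ) with hwdef
    have hw2 : (L : ℝ) ≤ 2 * w := by
      have : 2 * (L / 2) ≤ L := by omega
      have : 2 * ((L / 2 : ℕ) : ℝ) ≤ L := by exact_mod_cast this
      rw [hwdef]
      linarith
    have hnw : (n : ℝ) ≤ 2 * lam * w := by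
      have := mul_le_mul_of_nonneg_left hw2 hlam0.le
      linarith
    calc (n : ℝ) ^ 2 * Wq * E ≤ (2 * lam * w) ^ 2 * Wq * E := by gcongr
      _ = 4 * lam ^ 2 * Wq * (w ^ 2 * E) := by ring
      _ ≤ 4 * lam ^ 2 * Wq * (C₀ * Wp * (n : ℝ) ^ (D + 1) * N ^ 2) :=
          mul_le_mul_of_nonneg_left hcut (by positivity)
      _ = _ := by
          rw [hΛdef]
          ring

end RandomConductance

end

noncomputable section

namespace RandomConductance

open Finset

/-! ### Averaged norms and the choice of the majorants -/

theorem inv_toReal_lt_one {p : ℝ≥0∞} (hp : 1 < p) : p⁻¹.toReal < 1 := by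
  have h : p⁻¹ < 1 := ENNReal.inv_lt_one.2 hp
  have := (ENNReal.toReal_lt_toReal h.ne_top ENNReal.one_ne_top).2 h
  simpa using this

/-- For p < ∞ take g = (f/‖f‖_p)^p, which has average one. For p = ∞ the exponent is zero and g = 1
works, so both cases have the same form. -/
theorem exists_majorant {α : Type*} {p : ℝ≥0∞} (hp : 1 < p) {S : Finset α} (hS : S.Nonempty)
    {f : α → ℝ} (hf : ∀ x, 0 < f x) :
    0 ≤ avgNorm p S f ∧ ∃ g : α → ℝ, (∀ x, 0 ≤ g x) ∧
      (∀ x ∈ S, f x ≤ avgNorm p S f * g x ^ p⁻¹.toReal) ∧ ∑ x ∈ S, g x ≤ S.card := by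
  by_cases htop : p = ∞
  · have hle : ∀ x ∈ S, f x ≤ avgNorm p S f := by
      intro x hx
      rw [avgNorm, if_pos htop]
      refine (le_abs_self _).trans (le_csSup ?_ ⟨x, hx, rfl⟩)
      exact (S.finite_toSet.image _).bddAbove
    obtain ⟨x₀, hx₀⟩ := hS
    refine ⟨(hf x₀).le.trans (hle x₀ hx₀), fun _ => 1, fun _ => zero_le_one, fun x hx => ?_, ?_⟩
    · simpa using hle x hx
    · simp
  · have hr : 0 < p.toReal := ENNReal.toReal_pos (zero_lt_one.trans hp).ne' htop
    set r := p.toReal with hrdef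
    have hcard : (0 : ℝ) < S.card := by exact_mod_cast hS.card_pos
    have hsum : 0 < ∑ x ∈ S, |f x| ^ r :=
      sum_pos (fun x _ => Real.rpow_pos_of_pos (abs_pos.2 (hf x).ne') _) hS
    have hbase : 0 < (1 / (S.card : ℝ)) * ∑ x ∈ S, |f x| ^ r := by positivity
    have hA : avgNorm p S f = ((1 / (S.card : ℝ)) * ∑ x ∈ S, |f x| ^ r) ^ (1 / r) := by
      rw [avgNorm, if_neg htop]
    have hApos : 0 < avgNorm p S f := by
      rw [hA]
      exact Real.rpow_pos_of_pos hbase _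
    have hAr : avgNorm p S f ^ r = (1 / (S.card : ℝ)) * ∑ x ∈ S, |f x| ^ r := by
      rw [hA, ← Real.rpow_mul hbase.le, one_div_mul_cancel hr.ne', Real.rpow_one]
    refine ⟨hApos.le, fun x => (f x / avgNorm p S f) ^ r, fun x =>
      Real.rpow_nonneg (div_nonneg (hf x).le hApos.le) _, fun x _ => ?_, ?_⟩
    · rw [ENNReal.toReal_inv, ← Real.rpow_mul (div_nonneg (hf x).le hApos.le),
        mul_inv_cancel₀ hr.ne', Real.rpow_one, mul_div_cancel₀ _ hApos.ne']
    · refine le_of_eq ?_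
      calc ∑ x ∈ S, (f x / avgNorm p S f) ^ r
          = (∑ x ∈ S, |f x| ^ r) / avgNorm p S f ^ r := by
            rw [sum_div]
            refine sum_congr rfl fun x _ => ?_
            rw [Real.div_rpow (hf x).le hApos.le, abs_of_pos (hf x)]
        _ = S.card := by
            rw [hAr]
            field_simp

theorem bondsIn_box_nonempty {d n : ℕ} (hd : 1 ≤ d) (hn : 1 ≤ n) :
    (bondsIn (box d (2 * n))).Nonempty := by
  refine ⟨((0 : Vertex d), ⟨0, hd⟩), mem_bondsIn.2 ?_⟩
  have h0 : rad (0 : Vertex d) ≤ 0 := rad_le.2 (mem_box.2 fun i => by simp)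
  have h1 := rad_upper_le ((0 : Vertex d), (⟨0, hd⟩ : Fin d))
  simp only [Bond.lower] at h1
  exact ⟨rad_le.1 (h0.trans (Nat.zero_le _)), rad_le.1 (by omega)⟩

theorem exists_majorized {d n : ℕ} (hd : 1 ≤ d) (hn : 1 ≤ n) {p q : ℝ≥0∞} (hp : 1 < p) (hq : 1 < q)
    {ω : Bond d → ℝ} (hω : ∀ e, 0 < ω e) :
    ∃ g h : Bond d → ℝ, Majorized ω n p⁻¹.toReal q⁻¹.toReal
      (avgNorm p (bondsIn (box d (2 * n))) ω)
      (avgNorm q (bondsIn (box d (2 * n))) fun e => (ω e)⁻¹) g h := by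
  have hne := bondsIn_box_nonempty hd hn
  obtain ⟨hWp, g, hg0, hg, hgs⟩ := exists_majorant hp hne hω
  obtain ⟨hWq, h, hh0, hh, hhs⟩ := exists_majorant hq hne (f := fun e => (ω e)⁻¹)
    fun e => inv_pos.2 (hω e)
  exact ⟨g, h, hω, hg0, hh0, hWp, hWq, hg, hh, hgs, hhs⟩

/-- Average 1 = ω·ω⁻¹ over the bonds and apply Hölder with exponents P, Q and 1 − P − Q. This allows
powers of Λ to be enlarged. -/
theorem Majorized.one_le {d n : ℕ} (hd : 1 ≤ d) (hn : 1 ≤ n) {ω : Bond d → ℝ} {P Q Wp Wq : ℝ}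
    {g h : Bond d → ℝ} (H : Majorized ω n P Q Wp Wq g h) (hP : 0 ≤ P) (hQ : 0 ≤ Q)
    (hPQ : P + Q ≤ 1) : 1 ≤ Wp * Wq := by
  set T := bondsIn (box d (2 * n)) with hT
  have hcard : (0 : ℝ) < T.card := by exact_mod_cast (bondsIn_box_nonempty hd hn).card_pos
  have hWp := H.Wp_nonneg
  have hWq := H.Wq_nonneg
  have h1 : (T.card : ℝ) ≤ ∑ e ∈ T, Wp * Wq * (g e ^ P * h e ^ Q) := by
    rw [← nsmul_one T.card]
    refine card_nsmul_le_sum _ _ _ fun e he => ?_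
    have := mul_le_mul (H.le_g e he) (H.inv_le_h e he) (inv_pos.2 (H.pos e)).le
      ((H.pos e).le.trans (H.le_g e he))
    rw [mul_inv_cancel₀ (H.pos e).ne'] at this
    linarith
  have h2 := sum_rpow_mul_four_le T (f₁ := g) (f₂ := h) (f₃ := fun _ => 1) (f₄ := fun _ => 1)
    (fun e _ => H.g_nonneg e) (fun e _ => H.h_nonneg e) (by simp) (by simp) hP hQ
    (by linarith : 0 ≤ 1 - P - Q) le_rfl (by ring)
  simp only [Real.one_rpow, mul_one, Real.rpow_zero, sum_const, nsmul_eq_mul] at h2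
  have h3 : ∑ e ∈ T, g e ^ P * h e ^ Q ≤ T.card := by
    refine h2.trans ?_
    calc _ ≤ (T.card : ℝ) ^ P * (T.card : ℝ) ^ Q * (T.card : ℝ) ^ (1 - P - Q) := by
          refine mul_le_mul_of_nonneg_right (mul_le_mul ?_ ?_ ?_ (by positivity)) (by positivity)
          · exact Real.rpow_le_rpow (sum_nonneg fun e _ => H.g_nonneg e) H.sum_g hP
          · exact Real.rpow_le_rpow (sum_nonneg fun e _ => H.h_nonneg e) H.sum_h hQ
          · exact Real.rpow_nonneg (sum_nonneg fun e _ => H.h_nonneg e) _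
      _ = _ := by
          rw [← Real.rpow_add hcard, ← Real.rpow_add hcard]
          rw [show P + Q + (1 - P - Q) = 1 by ring, Real.rpow_one]
  rw [← mul_sum] at h1
  have h4 := h1.trans (mul_le_mul_of_nonneg_left h3 (mul_nonneg hWp hWq))
  exact le_of_mul_le_mul_right (by linarith) hcard

theorem IsSolution.neg {d : ℕ} {ω : Bond d → ℝ} {u : Vertex d → ℝ} (hu : IsSolution ω u) :
    IsSolution ω fun x => -u x := by
  intro x
  have h := hu x
  simp only [divStar, grad] at h ⊢
  rw [← neg_eq_zero, ← sum_neg_distrib, ← h]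
  refine sum_congr rfl fun i _ => ?_
  ring

/-! ### Lowering the exponent of integrability -/

theorem sum_rpow_avgNorm_le {d n : ℕ} (hn : 1 ≤ n) {r : ℝ} (hr : 0 < r) (u : Vertex d → ℝ) :
    0 ≤ avgNorm (ENNReal.ofReal r) (box d (2 * n)) u ∧
    ∑ x ∈ box d (2 * n), |u x| ^ r ≤
      5 ^ d * (n : ℝ) ^ d * avgNorm (ENNReal.ofReal r) (box d (2 * n)) u ^ r := by
  have hS : 0 ≤ ∑ x ∈ box d (2 * n), |u x| ^ r :=
    sum_nonneg fun x _ => Real.rpow_nonneg (abs_nonneg _) _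
  have hcard : (0 : ℝ) < (box d (2 * n)).card := by
    rw [card_box]
    positivity
  have hA : avgNorm (ENNReal.ofReal r) (box d (2 * n)) u =
      ((1 / ((box d (2 * n)).card : ℝ)) * ∑ x ∈ box d (2 * n), |u x| ^ r) ^ (1 / r) := by
    rw [avgNorm, if_neg ENNReal.ofReal_ne_top, ENNReal.toReal_ofReal hr.le]
  have hb : 0 ≤ (1 / ((box d (2 * n)).card : ℝ)) * ∑ x ∈ box d (2 * n), |u x| ^ r := by positivity
  refine ⟨by rw [hA]; exact Real.rpow_nonneg hb _, ?_⟩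
  rw [hA, ← Real.rpow_mul hb, one_div_mul_cancel hr.ne', Real.rpow_one]
  have hle : ((box d (2 * n)).card : ℝ) ≤ 5 ^ d * (n : ℝ) ^ d := by
    rw [card_box, ← mul_pow]
    push_cast
    refine pow_le_pow_left₀ (by positivity) ?_ _
    have : (1 : ℝ) ≤ n := by exact_mod_cast hn
    linarith
  calc ∑ x ∈ box d (2 * n), |u x| ^ r
      = (box d (2 * n)).card * ((1 / ((box d (2 * n)).card : ℝ)) *
        ∑ x ∈ box d (2 * n), |u x| ^ r) := by field_simp
    _ ≤ _ := mul_le_mul_of_nonneg_right hle hb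

/-- The algebra of the backward induction: the bounds `A^{1/γ} B^{i+1/γ} N` with `B = 2^{m/γ}` are
compatible with the recursion `M ↦ A b^i M^{1-γ} N^γ`. -/
theorem recursion_bound {A N γ : ℝ} (hA : 1 ≤ A) (hN : 0 ≤ N) (hγ : 0 < γ) (hγ1 : γ ≤ 1)
    {m k : ℕ} (hmk : m ≤ k) (i : ℕ) :
    A * (2 ^ i) ^ m * (((2 : ℝ) ^ ((k : ℝ) / γ)) ^ (1 / γ) * A ^ (1 / γ) *
      ((2 : ℝ) ^ ((k : ℝ) / γ)) ^ (i + 1) * N) ^ (1 - γ) * N ^ γ ≤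
    ((2 : ℝ) ^ ((k : ℝ) / γ)) ^ (1 / γ) * A ^ (1 / γ) * ((2 : ℝ) ^ ((k : ℝ) / γ)) ^ i * N := by
  set B : ℝ := (2 : ℝ) ^ ((k : ℝ) / γ) with hB
  have hB1 : 1 ≤ B := Real.one_le_rpow (by norm_num) (by positivity)
  have hB0 : 0 < B := by linarith
  have hA0 : 0 < A := by linarith
  have hBγ : (2 : ℝ) ^ m ≤ B ^ γ := by
    rw [hB, ← Real.rpow_mul (by norm_num), div_mul_cancel₀ _ hγ.ne', Real.rpow_natCast]
    exact pow_le_pow_right₀ (by norm_num) hmk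
  have hN' : N ^ (1 - γ) * N ^ γ = N := by
    rw [← Real.rpow_add_of_nonneg hN (by linarith) hγ.le, sub_add_cancel, Real.rpow_one]
  have hA' : A * (A ^ (1 / γ)) ^ (1 - γ) = A ^ (1 / γ) := by
    rw [← Real.rpow_mul hA0.le]
    nth_rewrite 1 [← Real.rpow_one A]
    rw [← Real.rpow_add hA0]
    congr 1
    field_simp
    ring
  have hBB : (2 ^ i) ^ m * ((B ^ (1 / γ)) ^ (1 - γ) * (B ^ (i + 1)) ^ (1 - γ)) ≤
      B ^ (1 / γ) * B ^ i := by
    have h1 : ((2 : ℝ) ^ i) ^ m ≤ (B ^ γ) ^ i := by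
      rw [← pow_mul, mul_comm, pow_mul]
      exact pow_le_pow_left₀ (by positivity) hBγ i
    calc (2 ^ i) ^ m * ((B ^ (1 / γ)) ^ (1 - γ) * (B ^ (i + 1)) ^ (1 - γ))
        ≤ (B ^ γ) ^ i * ((B ^ (1 / γ)) ^ (1 - γ) * (B ^ (i + 1)) ^ (1 - γ)) :=
          mul_le_mul_of_nonneg_right h1 (by positivity)
      _ = B ^ (γ * i + ((1 / γ) * (1 - γ) + ((i + 1 : ℕ) : ℝ) * (1 - γ))) := by
          rw [← Real.rpow_natCast, ← Real.rpow_natCast B (i + 1), ← Real.rpow_mul hB0.le,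
            ← Real.rpow_mul hB0.le, ← Real.rpow_mul hB0.le, ← Real.rpow_add hB0, ← Real.rpow_add hB0]
      -- The exponent before this step equals 1/γ + i − γ.
      _ ≤ B ^ (1 / γ + i) := by
          refine Real.rpow_le_rpow_of_exponent_le hB1 ?_
          have : 1 / γ * (1 - γ) = 1 / γ - 1 := by field_simp
          rw [this]
          push_cast
          linarith
      _ = _ := by rw [Real.rpow_add hB0, Real.rpow_natCast]
  rw [Real.mul_rpow (by positivity) hN, Real.mul_rpow (by positivity) (by positivity),
    Real.mul_rpow (by positivity) (by positivity)]
  calc A * (2 ^ i) ^ m * ((B ^ (1 / γ)) ^ (1 - γ) * (A ^ (1 / γ)) ^ (1 - γ) *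
        (B ^ (i + 1)) ^ (1 - γ) * N ^ (1 - γ)) * N ^ γ
      = (A * (A ^ (1 / γ)) ^ (1 - γ)) * (N ^ (1 - γ) * N ^ γ) *
        ((2 ^ i) ^ m * ((B ^ (1 / γ)) ^ (1 - γ) * (B ^ (i + 1)) ^ (1 - γ))) := by ring
    _ ≤ A ^ (1 / γ) * N * (B ^ (1 / γ) * B ^ i) := by
        rw [hA', hN']
        exact mul_le_mul_of_nonneg_left hBB (by positivity)
    _ = _ := by ring

/-- The sum of the `t`-th powers is interpolated between the maximum and the sum of the `tγ`-th
powers. -/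
theorem avg_rpow_le {α : Type*} {S T : Finset α} (hST : S ⊆ T) {u : α → ℝ} {t γ M N V c : ℝ}
    (ht : 1 ≤ t) (hγ : 0 < γ) (hγ1 : γ ≤ 1) (hV : 0 < V) (hc : 1 ≤ c) (hN : 0 ≤ N)
    (hM : 0 ≤ M) (hu : ∀ x ∈ S, |u x| ≤ M)
    (hsum : ∑ x ∈ T, |u x| ^ (t * γ) ≤ c * V * N ^ (t * γ)) :
    ((∑ x ∈ S, |u x| ^ t) / V) ^ (1 / t) ≤ c * (M ^ (1 - γ) * N ^ γ) := by
  have ht0 : 0 < t := by linarith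
  have h1 : ∑ x ∈ S, |u x| ^ t ≤ M ^ (t * (1 - γ)) * (c * V * N ^ (t * γ)) := by
    calc ∑ x ∈ S, |u x| ^ t ≤ ∑ x ∈ S, M ^ (t * (1 - γ)) * |u x| ^ (t * γ) := by
          refine sum_le_sum fun x hx => ?_
          have h2 : |u x| ^ t = |u x| ^ (t * (1 - γ)) * |u x| ^ (t * γ) := by
            rw [← Real.rpow_add_of_nonneg (abs_nonneg _) (mul_nonneg ht0.le (by linarith))
              (by positivity)]
            congr 1
            ring
          rw [h2]
          exact mul_le_mul_of_nonneg_right (Real.rpow_le_rpow (abs_nonneg _) (hu x hx)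
            (mul_nonneg ht0.le (by linarith))) (Real.rpow_nonneg (abs_nonneg _) _)
      _ ≤ _ := by
          rw [← mul_sum]
          refine mul_le_mul_of_nonneg_left ((sum_le_sum_of_subset_of_nonneg hST fun x _ _ =>
            Real.rpow_nonneg (abs_nonneg _) _).trans hsum) (Real.rpow_nonneg hM _)
  have h2 : (∑ x ∈ S, |u x| ^ t) / V ≤ c * (M ^ (1 - γ) * N ^ γ) ^ t := by
    rw [div_le_iff₀ hV]
    refine h1.trans (le_of_eq ?_)
    rw [Real.mul_rpow (Real.rpow_nonneg hM _) (Real.rpow_nonneg hN _), ← Real.rpow_mul hM,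
      ← Real.rpow_mul hN, mul_comm (1 - γ), mul_comm γ]
    ring
  have hMN : 0 ≤ M ^ (1 - γ) * N ^ γ := mul_nonneg (Real.rpow_nonneg hM _) (Real.rpow_nonneg hN _)
  have h0 : 0 ≤ (∑ x ∈ S, |u x| ^ t) / V :=
    div_nonneg (sum_nonneg fun x _ => Real.rpow_nonneg (abs_nonneg _) _) hV.le
  refine (Real.rpow_le_rpow h0 h2 (by positivity)).trans ?_
  rw [Real.mul_rpow (by linarith) (Real.rpow_nonneg hMN _), ← Real.rpow_mul hMN,
    mul_one_div_cancel ht0.ne', Real.rpow_one]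
  refine mul_le_mul_of_nonneg_right ?_ hMN
  calc c ^ (1 / t) ≤ c ^ (1 : ℝ) :=
        Real.rpow_le_rpow_of_exponent_le hc (by rwa [div_le_one ht0])
    _ = c := Real.rpow_one c

/-- One term is at most the whole sum. This crude bound, polynomial in n, starts the backward
recursion. -/
theorem abs_le_of_sum_rpow_le {α : Type*} {S : Finset α} {u : α → ℝ} {r N c : ℝ} (hr : 0 < r)
    (hN : 0 ≤ N) (hc : 0 ≤ c) (hsum : ∑ x ∈ S, |u x| ^ r ≤ c * N ^ r) {x : α} (hx : x ∈ S) :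
    |u x| ≤ c ^ (1 / r) * N := by
  have h1 : |u x| ^ r ≤ c * N ^ r :=
    (single_le_sum (f := fun x => |u x| ^ r) (fun x _ => Real.rpow_nonneg (abs_nonneg _) _)
      hx).trans hsum
  have h2 := Real.rpow_le_rpow (Real.rpow_nonneg (abs_nonneg _) _) h1 (by positivity : 0 ≤ 1 / r)
  rwa [← Real.rpow_mul (abs_nonneg _), mul_one_div_cancel hr.ne', Real.rpow_one,
    Real.mul_rpow hc (Real.rpow_nonneg hN _), ← Real.rpow_mul hN, mul_one_div_cancel hr.ne',
    Real.rpow_one] at h2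

/-- Let M_i be a bound for |u| on the box of radius 2n − n/2^i. The bound for ±u on neighbouring
boxes and the interpolation in `avg_rpow_le` give M_i ≤ A 2^{im} M_{i+1}^{1−γ} N^γ. At i = J, where
n/2^J rounds to zero, the crude bound applies on B(2n); descending to i = 0 reaches B(n). -/
theorem abs_le_of_isSolution {D : ℕ} (hD : 2 ≤ D) {p q : ℝ≥0∞} (hp : 1 < p) (hq : 1 < q) {δ : ℝ}
    (hδ : 0 < δ) (hδ' : δ = 1 / D - p⁻¹.toReal / 2 - q⁻¹.toReal / 2) {γ : ℝ} (hγ : 0 < γ)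
    (hγ1 : γ ≤ 1) :
    ∃ c : ℝ, 1 ≤ c ∧ ∀ ω : Bond (D + 1) → ℝ, (∀ e, 0 < ω e) → ∀ u : Vertex (D + 1) → ℝ,
      IsSolution ω u → ∀ n : ℕ, 1 ≤ n → ∀ x ∈ box (D + 1) n,
        |u x| ≤ c * Lam p q ω (box (D + 1) (2 * n)) ^ ((1 / 2 + 1 / (2 * δ)) / γ) *
          avgNorm (ENNReal.ofReal (2 / (1 - p⁻¹.toReal) * γ)) (box (D + 1) (2 * n)) u := by
  set P := p⁻¹.toReal with hPdef
  set Q := q⁻¹.toReal with hQdef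
  have hP : 0 ≤ P := ENNReal.toReal_nonneg
  have hQ : 0 ≤ Q := ENNReal.toReal_nonneg
  have hP1 : P < 1 := inv_toReal_lt_one hp
  have hPQ : P + Q ≤ 1 := by
    have : 1 / (D : ℝ) ≤ 1 / 2 := one_div_le_one_div_of_le (by norm_num) (by exact_mod_cast hD)
    linarith
  obtain ⟨C, hC, m, hmain⟩ := le_of_isSolution hD hP hP1 hQ hδ hδ'
  set t : ℝ := 2 / (1 - P) with ht
  have ht1 : 1 ≤ t := by
    rw [ht, one_le_div (by linarith)]
    linarith
  have hP1t : (1 - P) / 2 = 1 / t := by rw [ht, one_div_div]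
  -- The summand m is for the factor 2^{im} of the recursion, D + 1 for the power of n in the crude
  -- bound.
  set k := m + (D + 1) with hk
  set B : ℝ := (2 : ℝ) ^ ((k : ℝ) / γ) with hB
  have hB1 : 1 ≤ B := Real.one_le_rpow (by norm_num) (by positivity)
  set c₀ : ℝ := C * 16 ^ m * 5 ^ (D + 1) with hc₀
  have h5 : (1 : ℝ) ≤ 5 ^ (D + 1) := one_le_pow₀ (by norm_num)
  have h16 : (1 : ℝ) ≤ C * 16 ^ m :=
    one_le_mul_of_one_le_of_one_le hC (one_le_pow₀ (by norm_num))
  have hc₀1 : 1 ≤ c₀ := one_le_mul_of_one_le_of_one_le h16 h5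
  have hγi : 0 ≤ 1 / γ := by positivity
  refine ⟨B ^ (1 / γ) * c₀ ^ (1 / γ), one_le_mul_of_one_le_of_one_le (Real.one_le_rpow hB1 hγi)
    (Real.one_le_rpow hc₀1 hγi), ?_⟩
  intro ω hω u hu n hn
  obtain ⟨g, h, H⟩ := exists_majorized (Nat.succ_pos D) hn hp hq hω
  have hΛ := H.one_le (Nat.succ_pos D) hn hP hQ hPQ
  change 1 ≤ Lam p q ω (box (D + 1) (2 * n)) at hΛ
  set Λ := Lam p q ω (box (D + 1) (2 * n)) with hΛdef
  set s : ℝ := 1 / 2 + 1 / (2 * δ) with hs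
  have hs0 : 0 ≤ s := by positivity
  have htγ : 0 < t * γ := by positivity
  obtain ⟨hN0, hNsum⟩ := sum_rpow_avgNorm_le (d := D + 1) hn htγ u
  set N := avgNorm (ENNReal.ofReal (t * γ)) (box (D + 1) (2 * n)) u with hNdef
  have hnd : (0 : ℝ) < (n : ℝ) ^ (D + 1) := by positivity
  set A : ℝ := c₀ * Λ ^ s with hA
  have hΛs : 1 ≤ Λ ^ s := Real.one_le_rpow hΛ hs0
  have hA1 : 1 ≤ A := one_le_mul_of_one_le_of_one_le hc₀1 hΛs
  have hbox : ∀ i, 2 * n - n / 2 ^ i ≤ 2 * n := fun i => Nat.sub_le _ _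
  have hstep : ∀ i M, 1 ≤ n / 2 ^ i → 0 ≤ M →
      (∀ x ∈ box (D + 1) (2 * n - n / 2 ^ (i + 1)), |u x| ≤ M) →
      ∀ x ∈ box (D + 1) (2 * n - n / 2 ^ i), |u x| ≤ A * (2 ^ i) ^ m * M ^ (1 - γ) * N ^ γ := by
    intro i M hi hM hMu x hx
    have hdiv : n / 2 ^ (i + 1) = n / 2 ^ i / 2 := by rw [pow_succ, Nat.div_div_eq_div_mul]
    have hle := Nat.div_le_self n (2 ^ i)
    set L := n / 2 ^ i - n / 2 ^ (i + 1) with hL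
    have hsum : 2 * n - n / 2 ^ i + L = 2 * n - n / 2 ^ (i + 1) := by omega
    have hlam : (n : ℝ) ≤ (16 * 2 ^ i * 1) * (L : ℝ) := by
      rw [hL, Nat.cast_sub (by omega)]
      exact half_radius_le zero_le_one (by rw [one_mul]) (by omega) hi
    rw [mul_one] at hlam
    have hlam1 : (1 : ℝ) ≤ 16 * 2 ^ i := by
      have : (1 : ℝ) ≤ 2 ^ i := one_le_pow₀ (by norm_num)
      linarith
    have havg := avg_rpow_le (box_mono (d := D + 1) (hbox (i + 1))) ht1 hγ hγ1 hnd h5 hN0 hM hMu hNsum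
    have hfac : 0 ≤ C * (16 * 2 ^ i) ^ m * Λ ^ s := by positivity
    have hbd : C * (16 * 2 ^ i) ^ m * Λ ^ s * ((∑ x ∈ box (D + 1) (2 * n - n / 2 ^ i + L),
        |u x| ^ t) / (n : ℝ) ^ (D + 1)) ^ ((1 - P) / 2) ≤
        A * (2 ^ i) ^ m * M ^ (1 - γ) * N ^ γ := by
      rw [hsum, hP1t]
      refine (mul_le_mul_of_nonneg_left havg hfac).trans (le_of_eq ?_)
      rw [hA, hc₀, mul_pow]
      ring
    refine abs_le'.2 ⟨?_, ?_⟩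
    · exact (hmain n hn ω g h _ _ H hΛ u hu _ L (by omega) (by omega) (by omega) _ hlam1 hlam x
        hx).trans hbd
    · have := hmain n hn ω g h _ _ H hΛ _ hu.neg _ L (by omega) (by omega) (by omega) _ hlam1 hlam x hx
      simp only [abs_neg] at this
      exact this.trans hbd
  set W : ℝ := B ^ (1 / γ) * A ^ (1 / γ) with hW
  have hW0 : 0 ≤ W := by positivity
  have hex : ∃ j, n / 2 ^ j = 0 := ⟨n, Nat.div_eq_of_lt Nat.lt_two_pow_self⟩
  classical
  set J := Nat.find hex with hJ
  have hJ0 : n / 2 ^ J = 0 := Nat.find_spec hex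
  have hnJ : n ≤ 2 ^ J := by
    rcases Nat.div_eq_zero_iff.1 hJ0 with h0 | h0
    · exact absurd h0 (by positivity)
    · exact h0.le
  -- Since n ≤ 2^J, the power of n in the crude bound is absorbed into B^J.
  have hbase : ∀ x ∈ box (D + 1) (2 * n - n / 2 ^ J), |u x| ≤ W * B ^ J * N := by
    intro x hx
    have h1 := abs_le_of_sum_rpow_le htγ hN0 (by positivity) hNsum (box_mono (hbox J) hx)
    refine h1.trans (mul_le_mul_of_nonneg_right ?_ hN0)
    have hnJ' : (n : ℝ) ≤ 2 ^ J := by exact_mod_cast hnJ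
    have e1 : (5 : ℝ) ^ (D + 1) * (n : ℝ) ^ (D + 1) ≤ A * (2 ^ J) ^ k := by
      have a1 : (5 : ℝ) ^ (D + 1) ≤ A := by
        have : (5 : ℝ) ^ (D + 1) ≤ c₀ := le_mul_of_one_le_left (by positivity) h16
        exact this.trans (le_mul_of_one_le_right (by positivity) hΛs)
      have a2 : (n : ℝ) ^ (D + 1) ≤ (2 ^ J) ^ k :=
        (pow_le_pow_left₀ (by positivity) hnJ' _).trans
          (pow_le_pow_right₀ (one_le_pow₀ (by norm_num)) (by omega))
      exact mul_le_mul a1 a2 hnd.le (by positivity)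
    have e2 : (1 : ℝ) ≤ A * (2 ^ J) ^ k :=
      one_le_mul_of_one_le_of_one_le hA1 (one_le_pow₀ (one_le_pow₀ (by norm_num)))
    calc (5 ^ (D + 1) * (n : ℝ) ^ (D + 1)) ^ (1 / (t * γ))
        ≤ (A * (2 ^ J) ^ k) ^ (1 / (t * γ)) := Real.rpow_le_rpow (by positivity) e1 (by positivity)
      _ ≤ (A * (2 ^ J) ^ k) ^ (1 / γ) := by
          refine Real.rpow_le_rpow_of_exponent_le e2 (one_div_le_one_div_of_le hγ ?_)
          exact le_mul_of_one_le_left hγ.le ht1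
      _ = A ^ (1 / γ) * B ^ J := by
          rw [Real.mul_rpow (by positivity) (by positivity), hB, ← Real.rpow_natCast,
            ← Real.rpow_natCast, ← Real.rpow_natCast, ← Real.rpow_mul (by norm_num),
            ← Real.rpow_mul (by norm_num), ← Real.rpow_mul (by norm_num)]
          congr 2
          ring
      _ ≤ W * B ^ J := by
          refine mul_le_mul_of_nonneg_right ?_ (by positivity)
          exact le_mul_of_one_le_left (by positivity) (Real.one_le_rpow hB1 hγi)
  have hdown : ∀ j ≤ J, ∀ x ∈ box (D + 1) (2 * n - n / 2 ^ (J - j)), |u x| ≤ W * B ^ (J - j) * N := by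
    intro j
    induction j with
    | zero => intro _; exact hbase
    | succ j ih =>
      intro hj x hx
      obtain ⟨i, hi⟩ : ∃ i, J - j = i + 1 := ⟨J - j - 1, by omega⟩
      have hi' : J - (j + 1) = i := by omega
      have ih' := ih (by omega)
      rw [hi] at ih'
      rw [hi'] at hx ⊢
      have hfind : 1 ≤ n / 2 ^ i := Nat.one_le_iff_ne_zero.2 (Nat.find_min hex (by omega))
      exact (hstep i _ hfind (by positivity) ih' x hx).trans
        (recursion_bound hA1 hN0 hγ hγ1 (Nat.le_add_right m (D + 1)) i)
  intro x hx
  have hfin := hdown J le_rfl x (by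
    rw [Nat.sub_self, pow_zero, Nat.div_one]
    have : 2 * n - n = n := by omega
    rwa [this])
  rw [Nat.sub_self, pow_zero, mul_one] at hfin
  refine hfin.trans (le_of_eq ?_)
  rw [hW, hA, Real.mul_rpow (by positivity) (by positivity),
    ← Real.rpow_mul (zero_le_one.trans hΛ) s (1 / γ), mul_one_div]
  ring

end RandomConductance

end

/-! ### The theorem -/

theorem corollary3p4 (d : ℕ) (hd : 3 ≤ d) (p q : ℝ≥0∞) (hp : 1 < p) (hq : 1 < q)
    (hpq : p⁻¹.toReal + q⁻¹.toReal < 2 / ((d : ℝ) - 1)) :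
    0 < RandomConductance.delta d p q ∧
    ∀ γ : ℝ, 0 < γ → γ ≤ 1 →
      ∃ c : ℝ, 1 ≤ c ∧
        ∀ ω : RandomConductance.Bond d → ℝ, (∀ e, 0 < ω e) →
        ∀ u : RandomConductance.Vertex d → ℝ, RandomConductance.IsSolution ω u →
        ∀ n : ℕ, 1 ≤ n →
        ∀ x ∈ RandomConductance.box d n,
          |u x| ≤
            c * RandomConductance.Lam p q ω (RandomConductance.box d (2 * n)) ^
                  ((RandomConductance.delta d p q + 1) / (2 * RandomConductance.delta d p q * γ)) *
              RandomConductance.avgNorm (ENNReal.ofReal (2 * RandomConductance.conj p * γ))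
                (RandomConductance.box d (2 * n)) u := by
  obtain ⟨D, rfl⟩ : ∃ D, d = D + 1 := ⟨d - 1, by omega⟩
  have hcast : (((D + 1 : ℕ) : ℝ) - 1) = D := by
    push_cast
    ring
  have hδ : 0 < RandomConductance.delta (D + 1) p q := by
    have h : 2 / (((D + 1 : ℕ) : ℝ) - 1) = 2 * (1 / (((D + 1 : ℕ) : ℝ) - 1)) := by ring
    rw [h] at hpq
    rw [RandomConductance.delta]
    linarith
  refine ⟨hδ, fun γ hγ hγ1 => ?_⟩
  obtain ⟨c, hc, hmain⟩ := RandomConductance.abs_le_of_isSolution (by omega : 2 ≤ D) hp hq hδ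
    (by rw [RandomConductance.delta, hcast]) hγ hγ1
  refine ⟨c, hc, ?_⟩
  have h1 : (RandomConductance.delta (D + 1) p q + 1) / (2 * RandomConductance.delta (D + 1) p q * γ) =
      (1 / 2 + 1 / (2 * RandomConductance.delta (D + 1) p q)) / γ := by
    field_simp
  have h2 : 2 * RandomConductance.conj p * γ = 2 / (1 - p⁻¹.toReal) * γ := by
    rw [RandomConductance.conj, div_eq_mul_inv]
  rw [h1, h2]
  exact hmain
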